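/- Let $\alpha>0$, $\alpha\notin\mathbb Z$, $\beta>0$. For $n\ge 0$, $t\ge 0$ let $$D_n(t,\alpha,\beta)=\det\Big(\int_0^1 x^{j+k}\,x^{\alpha}(1-x)^{\beta}e^{-t/x}\,dx\Big)_{j,k=0}^{n-1},$$ which is positive. Then, for every $s\in(0,\infty)$, the limits $$\Delta(s)=\lim_{n\to\infty}\frac{D_n(\frac{s}{2n^2},\alpha,\beta)}{D_n(0,\alpha,\beta)}>0,\qquad \mathcal H(s)=\lim_{n\to\infty}s\frac{d}{ds}\ln\frac{D_n(\frac{s}{2n^2},\alpha,\beta)}{D_n(0,\alpha,\beta)}$$ exist (with the logarithms differentiable in $s$), and $\mathcal H(s)=s\frac{d}{ds}\ln\Delta(s)$. For some $\rho>0$, $\mathcal H$ continues from $(0,\rho)$ to an analytic function on $\{|\arg s|<\pi,\ 0<|s|<\rho\}$, and there $$\mathcal H(s)=-\frac{s}{2\alpha}+\frac{s^2}{4\alpha^2(\alpha^2-1)}+\mathcal O(s^3)+\frac{\pi s^{\alpha+1}}{2^{\alpha+1}(\alpha+1)\Gamma^3(\alpha+1)\sin(\alpha\pi)}\big(1+\mathcal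 O(s)\big)+\mathcal O\big(s^{2(\alpha+1)}\big)$$ as $s\to0$, with principal powers of $s$. Here the terms $\mathcal O(s^3)$ and $\mathcal O(s)$ are analytic functions of $s$ at $s=0$ of these orders (so that the non-power term $s^{\alpha+1}$ is separated from the power series for every $\alpha$), and the bound $\mathcal O(s^{2(\alpha+1)})$ is uniform in $|\arg s|<\pi$. -/

import Mathlib

open Filter Topology Asymptotics

/-- The Pollaczek-Jacobi type weight `x ^ α * (1 - x) ^ β * exp (-t / x)` on `[0, 1]`. -/
noncomputable def pjWeight (t α β x : ℝ) : ℝ :=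
  x ^ α * (1 - x) ^ β * Real.exp (-t / x)

/-- The Hankel determinant `D_n(t, α, β)` of the moments of the weight. -/
noncomputable def hankelDet (n : ℕ) (t α β : ℝ) : ℝ :=
  Matrix.det (Matrix.of fun j k : Fin n =>
    ∫ x in (0 : ℝ)..1, x ^ ((j : ℕ) + (k : ℕ)) * pjWeight t α β x)

/-- The normalized determinant at `t = s / (2 n ^ 2)`. -/
noncomputable def scaledRatio (α β : ℝ) (n : ℕ) (s : ℝ) : ℝ :=
  hankelDet n (s / (2 * (n : ℝ) ^ 2)) α β / hankelDet n 0 α β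

/-- `s * d/ds log (D_n(s / (2 n ^ 2), α, β) / D_n(0, α, β))`. -/
noncomputable def scaledLogDeriv (α β : ℝ) (n : ℕ) (s : ℝ) : ℝ :=
  s * deriv (fun u : ℝ => Real.log (scaledRatio α β n u)) s

/-- The coefficient of `s ^ (α + 1)`. -/
noncomputable def specialCoeff (α : ℝ) : ℝ :=
  Real.pi /
    ((2 : ℝ) ^ (α + 1) * (α + 1) * Real.Gamma (α + 1) ^ 3 * Real.sin (α * Real.pi))

/-! ### Binomial coefficients and the beta function continued to negative arguments. -/

section

open Finset (range)

/-! Put t = σ / n² with σ = s / 2, and write H(t) for the Hankel matrix of size n = N + 1.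
Multiplying H(t) on the right by a unipotent matrix leaves the determinant unchanged and replaces
x^k e^(-t/x) by x^k `truncExp k (t/x)`. Since `truncExp k y` = 1 + O(y^(k+1)), the new matrix is
H(0) plus a correction. Its column k is a series in t^(k+m+1), whose coefficients are continued beta
values B(α+j-m, β+1), plus a series in t^(α+1+k+R), whose coefficients come from the binomial series
of (1-x)^β (`exists_hasSum_integral_truncExp`).

As functions of the row j, both kinds of coefficients are, up to factors independent of j, values at
ζ = α-m and ζ = -R of the same polynomials of degree at most N in ζ, and the values of these at ζ =
α+1+i give the columns of H(0). Lagrange interpolation thus divides the correction by H(0)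
explicitly (`betaSeries_sub_eq_sum`, `binomCoeff_mul_Gamma_eq_sum`). After conjugation by
diag(n^(2i)) one obtains D_n(t)/D_n(0) = det(1 + M) (`hankelDet_eq_mul_det`), where M is built from
power series in σ and from τ = c_n σ^(α+1) times such series. The coefficients are polynomials in x
= 1/n with factorial bounds uniform in n (`exists_coeff_bound`), and c_n → 1/Γ(α+1)²
(`tendsto_scaleConst`).

Expanding det(1 + M) into principal minors over finite sets of naturals gives a function `infDet` of
x, σ, τ that makes sense at x = 0 and is entire in σ and in τ; dominated convergence gives the limit
n → ∞. In the variable ζ = log s no branch is left, so Cauchy's formula gives convergence of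
derivatives as well. The limit Δ is positive because Δ(s)² ≤ Δ(2s), a Cauchy-Schwarz inequality for
Hankel matrices (`hankelDet_sq_le`), while Δ(s) → 1 as s → 0.

For small s, Taylor expansion in τ gives P(s) + τQ(s) + O(τ²) with P, Q entire. The regular terms
come from P, found to second order from three minors, the term s^(α+1) from Q(0) and the reflection
formula. The error is controlled on a half-plane Re ζ → -∞, hence uniformly in arg s. -/

/-- The coefficients of the binomial series of `(1 - x) ^ β`. -/
noncomputable def binomCoeff (β : ℝ) (r : ℕ) : ℝ :=
  ∏ l ∈ range r, ((l : ℝ) - β) / (l + 1)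

theorem binomCoeff_zero (β : ℝ) : binomCoeff β 0 = 1 := by simp [binomCoeff]

theorem binomCoeff_succ (β : ℝ) (r : ℕ) :
    ((r : ℝ) + 1) * binomCoeff β (r + 1) = (r - β) * binomCoeff β r := by
  have : (r : ℝ) + 1 ≠ 0 := by positivity
  simp only [binomCoeff, Finset.prod_range_succ]
  field_simp

/-- For r ≥ β the recursion reads (r+1)|c_(r+1)| = (r-β)|c_r|. Hence β|c_r| = r|c_r| -
(r+1)|c_(r+1)| telescopes and the partial sums stay bounded. -/
theorem summable_abs_binomCoeff {β : ℝ} (hβ : 0 < β) : Summable fun r => |binomCoeff β r| := by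
  obtain ⟨N, hN⟩ := exists_nat_ge β
  rw [← summable_nat_add_iff N]
  have key : ∀ K : ℕ, β * ∑ r ∈ range K, |binomCoeff β (r + N)|
      = N * |binomCoeff β N| - (K + N : ℕ) * |binomCoeff β (K + N)| := by
    intro K
    induction K with
    | zero => simp
    | succ K ih =>
      rw [Finset.sum_range_succ, mul_add, ih]
      have h := congrArg abs (binomCoeff_succ β (K + N))
      rw [abs_mul, abs_mul, abs_of_nonneg (show (0 : ℝ) ≤ ((K + N : ℕ) : ℝ) + 1 by positivity),
        abs_of_nonneg (show (0 : ℝ) ≤ ((K + N : ℕ) : ℝ) - β by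
          push_cast; linarith [Nat.cast_nonneg (α := ℝ) K])] at h
      have e : K + 1 + N = K + N + 1 := by ring
      rw [e]
      push_cast at h ⊢
      linarith
  refine summable_of_sum_range_le (c := N * |binomCoeff β N| / β) (fun _ => abs_nonneg _) fun K => ?_
  rw [le_div_iff₀ hβ, mul_comm, key]
  have : 0 ≤ ((K + N : ℕ) : ℝ) * |binomCoeff β (K + N)| := by positivity
  linarith

theorem summable_binomCoeff {β : ℝ} (hβ : 0 < β) : Summable (binomCoeff β) :=
  (summable_abs_binomCoeff hβ).of_abs

theorem ringChoose_eq_binomCoeff (β : ℝ) (r : ℕ) :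
    Ring.choose β r = (-1) ^ r * binomCoeff β r := by
  induction r with
  | zero => simp [binomCoeff]
  | succ r ih =>
    have h : ((r : ℝ) + 1) * Ring.choose β (r + 1) = (β - r) * Ring.choose β r := by
      have h1 := Ring.descPochhammer_eq_factorial_smul_choose β (r + 1)
      have h2 := Ring.descPochhammer_eq_factorial_smul_choose β r
      rw [descPochhammer_succ_right, Polynomial.smeval_mul, h2] at h1
      simp only [Polynomial.smeval_sub, Polynomial.smeval_X, nsmul_eq_mul, Nat.factorial_succ,
        Polynomial.smeval_natCast, pow_one, pow_zero, mul_one] at h1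
      push_cast at h1
      have hf : (r.factorial : ℝ) ≠ 0 := by positivity
      apply mul_left_cancel₀ hf
      linear_combination -h1
    have h' := binomCoeff_succ β r
    have : (r : ℝ) + 1 ≠ 0 := by positivity
    apply mul_left_cancel₀ this
    rw [h, ih, pow_succ]
    linear_combination (-1) ^ r * h'

theorem hasSum_binomCoeff (β : ℝ) {x : ℝ} (hx : |x| < 1) :
    HasSum (fun r => binomCoeff β r * x ^ r) ((1 - x) ^ β) := by
  have h := (Real.one_add_rpow_hasFPowerSeriesOnBall_zero (a := β)).hasSum (y := -x)
    (by simpa [enorm_eq_nnnorm, ← NNReal.coe_lt_coe] using hx)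
  simp only [binomialSeries_apply, zero_add, ← sub_eq_add_neg (1 : ℝ), List.ofFn_const, List.prod_replicate,
    smul_eq_mul, ringChoose_eq_binomCoeff] at h
  convert! h using 2 with r
  rw [neg_pow]
  have : ((-1 : ℝ) ^ r) * (-1) ^ r = 1 := by rw [← mul_pow]; simp
  linear_combination -(binomCoeff β r * x ^ r) * this

/-- The partial fraction series of the beta function `B (z, β + 1)`. -/
noncomputable def betaSeries (β z : ℝ) : ℝ := ∑' r : ℕ, binomCoeff β r / (z + r)

/-- A real number at positive distance `δ` from all nonpositive integers. -/
theorem exists_le_abs_add_nat {z : ℝ} (hz : ∀ r : ℕ, z + r ≠ 0) :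
    ∃ δ : ℝ, 0 < δ ∧ ∀ r : ℕ, δ ≤ |z + r| := by
  have h : Tendsto (fun r : ℕ => |z + r|) atTop atTop :=
    tendsto_abs_atTop_atTop.comp (tendsto_atTop_add_const_left _ _ tendsto_natCast_atTop_atTop)
  obtain ⟨N, hN⟩ := eventually_atTop.1 (h.eventually_ge_atTop 1)
  obtain ⟨i, -, hi⟩ := Finset.exists_min_image (range (N + 1)) (fun r : ℕ => |z + r|) ⟨0, by simp⟩
  refine ⟨min 1 |z + i|, lt_min one_pos (abs_pos.2 (hz i)), fun r => ?_⟩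
  rcases le_total N r with hr | hr
  · exact (min_le_left _ _).trans (hN r hr)
  · exact (min_le_right _ _).trans (hi r (by simp; omega))

theorem summable_mul_div_add {e : ℕ → ℝ} (he : Summable fun r => |e r|) {z : ℝ}
    (hz : ∀ r : ℕ, z + r ≠ 0) : Summable fun r : ℕ => e r / (z + r) := by
  obtain ⟨δ, hδ, h⟩ := exists_le_abs_add_nat hz
  refine .of_norm_bounded (he.div_const δ) fun r => ?_
  rw [Real.norm_eq_abs, abs_div]
  gcongr
  exact h r

/-- The functional equation of the beta function, derived from the series because z will be negative
and non-integral, where no integral is available. Split z/(z+r) = 1 - r/(z+r) and shift r by one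
with `binomCoeff_succ`. -/
theorem betaSeries_rec {β z : ℝ} (hβ : 0 < β) (hz : ∀ r : ℕ, z + r ≠ 0) :
    z * betaSeries β z = (z + β + 1) * betaSeries β (z + 1) := by
  have hz1 : ∀ r : ℕ, z + 1 + r ≠ 0 := fun r => by
    have := hz (r + 1); push_cast at this; rwa [add_assoc, add_comm (1 : ℝ)]
  have s0 := summable_binomCoeff hβ
  have s1 := summable_mul_div_add (summable_abs_binomCoeff hβ) hz
  have s2 := summable_mul_div_add (summable_abs_binomCoeff hβ) hz1
  have hs : Summable fun r : ℕ => r * binomCoeff β r / (z + r) := by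
    refine (s0.sub (s1.mul_left z)).congr fun r => ?_
    have := hz r
    field_simp
    ring
  have e1 : z * betaSeries β z = ∑' r, binomCoeff β r - ∑' r : ℕ, r * binomCoeff β r / (z + r) := by
    rw [betaSeries, ← tsum_mul_left, ← s0.tsum_sub hs]
    refine tsum_congr fun r => ?_
    have := hz r
    field_simp
    ring
  have hs' := (summable_nat_add_iff 1).2 hs
  have e2 : (z + β + 1) * betaSeries β (z + 1)
      = ∑' r, binomCoeff β r - ∑' r : ℕ, (r + 1 : ℕ) * binomCoeff β (r + 1) / (z + (r + 1 : ℕ)) := by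
    rw [betaSeries, ← tsum_mul_left, ← s0.tsum_sub hs']
    refine tsum_congr fun r => ?_
    have h1 := hz1 r
    have h2 : z + (r + 1 : ℕ) = z + 1 + r := by push_cast; ring
    rw [h2]
    push_cast
    rw [binomCoeff_succ]
    field_simp
    ring
  rw [e1, e2, hs.tsum_eq_zero_add]
  simp

end

/-! ### Expansion of ∫₀¹ x^c e^(-w/x) dx for small w. -/

section

open Finset (range)
open MeasureTheory

/-- The exponential beats every power, also for c < 0. At x = 0 the expression is read as 0 ^ c *
exp 0, which agrees with the limit 0 because c ≠ 0. -/
theorem continuousOn_rpow_mul_exp_neg_div {c w : ℝ} (hc : c ≠ 0) (hw : 0 < w) :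
    ContinuousOn (fun x : ℝ => x ^ c * Real.exp (-w / x)) (Set.Ici 0) := by
  intro x hx
  rcases (Set.mem_Ici.1 hx).eq_or_lt with rfl | hx
  · rw [← continuousWithinAt_Ioi_iff_Ici]
    have h : Tendsto (fun x : ℝ => x ^ c * Real.exp (-w / x)) (𝓝[>] 0) (𝓝 0) := by
      refine ((tendsto_rpow_mul_exp_neg_mul_atTop_nhds_zero (-c) w hw).comp
        tendsto_inv_nhdsGT_zero).congr' ?_
      filter_upwards [self_mem_nhdsWithin] with x hx
      simp only [Function.comp]
      rw [Real.inv_rpow (le_of_lt hx), Real.rpow_neg (le_of_lt hx), inv_inv, div_eq_mul_inv]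
    simpa [ContinuousWithinAt, Real.zero_rpow hc] using h
  · refine ContinuousAt.continuousWithinAt ?_
    exact (Real.continuousAt_rpow_const _ _ (Or.inl hx.ne')).mul
      (Real.continuous_exp.continuousAt.comp (continuousAt_const.div continuousAt_id hx.ne'))

theorem intervalIntegrable_rpow_mul_exp_neg_div {c w : ℝ} (hc : c ≠ 0) (hw : 0 < w) :
    IntervalIntegrable (fun x : ℝ => x ^ c * Real.exp (-w / x)) volume 0 1 :=
  ((continuousOn_rpow_mul_exp_neg_div hc hw).mono (by
    rw [Set.uIcc_of_le zero_le_one]; exact Set.Icc_subset_Ici_self)).intervalIntegrable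

theorem hasDerivAt_exp_neg_div (w : ℝ) {x : ℝ} (hx : x ≠ 0) :
    HasDerivAt (fun x : ℝ => Real.exp (-w / x)) (Real.exp (-w / x) * (w / x ^ 2)) x := by
  have h := ((hasDerivAt_inv hx).const_mul (-w)).exp
  simp only [← div_eq_mul_inv] at h
  convert! h using 1
  field_simp

/-- The power series of the lower incomplete gamma function. -/
theorem hasSum_integral_rpow_mul_exp_neg {a w : ℝ} (ha : 0 < a) (hw : 0 ≤ w) :
    HasSum (fun m : ℕ => (-1) ^ m * w ^ m / (m.factorial * (a + m)) * w ^ a)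
      (∫ u in (0 : ℝ)..w, u ^ (a - 1) * Real.exp (-u)) := by
  have key : ∀ m : ℕ, ∫ u in (0 : ℝ)..w, u ^ (a - 1) * ((-u) ^ m / m.factorial)
      = (-1) ^ m * w ^ m / (m.factorial * (a + m)) * w ^ a := by
    intro m
    have : ∀ u ∈ Set.uIoc 0 w, u ^ (a - 1) * ((-u) ^ m / m.factorial)
        = (-1) ^ m / m.factorial * u ^ (a - 1 + m) := by
      intro u hu
      rw [Set.uIoc_of_le hw] at hu
      rw [Real.rpow_add_natCast hu.1.ne', neg_pow]
      ring
    rw [intervalIntegral.integral_congr_ae (.of_forall this), intervalIntegral.integral_const_mul,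
      integral_rpow (Or.inl (by linarith [Nat.cast_nonneg (α := ℝ) m]))]
    have e : a - 1 + m + 1 = a + m := by ring
    have h0 : a + m ≠ 0 := by positivity
    rw [e, Real.zero_rpow h0, Real.rpow_add_natCast' hw h0]
    field_simp
    ring
  simp_rw [← key]
  refine intervalIntegral.hasSum_integral_of_dominated_convergence
    (fun (m : ℕ) u => u ^ (a - 1) * (w ^ m / m.factorial)) (fun m => ?_) (fun m => ?_) ?_ ?_ ?_
  · refine (Measurable.aestronglyMeasurable ?_)
    fun_prop
  · refine .of_forall fun u hu => ?_
    rw [Set.uIoc_of_le hw] at hu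
    rw [norm_mul, norm_div, norm_pow, norm_neg, Real.norm_of_nonneg (Real.rpow_nonneg hu.1.le _),
      Real.norm_of_nonneg hu.1.le, Real.norm_natCast]
    have := hu.1.le
    gcongr
    exact hu.2
  · exact .of_forall fun u _ => (Real.summable_pow_div_factorial w).mul_left _
  · simp_rw [tsum_mul_left]
    exact (intervalIntegral.intervalIntegrable_rpow' (by linarith)).mul_const _
  · refine .of_forall fun u _ => ?_
    have := (NormedSpace.expSeries_div_hasSum_exp (-u)).mul_left (u ^ (a - 1))
    rwa [← Real.exp_eq_exp_ℝ] at this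

theorem tendsto_integral_rpow_mul_exp_neg {a : ℝ} (ha : 0 < a) :
    Tendsto (fun w : ℝ => ∫ u in (0 : ℝ)..w, u ^ (a - 1) * Real.exp (-u)) atTop
      (𝓝 (Real.Gamma a)) := by
  rw [Real.Gamma_eq_integral ha]
  have h := intervalIntegral_tendsto_integral_Ioi 0 (Real.GammaIntegral_convergent ha) tendsto_id
  simp_rw [mul_comm (Real.exp _)] at h
  simpa only [mul_comm (Real.exp _), id] using h

/-- The substitution u = w/x turns the integral into w^(c+1) times the upper incomplete gamma
function at -c-1 > 0, that is, Γ(-c-1) minus the lower one, whose power series is known. -/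
theorem integral_rpow_mul_exp_neg_div_of_lt {c w : ℝ} (hc : c < -1) (hw : 0 < w) :
    HasSum (fun m : ℕ => (-1) ^ m * w ^ m / (m.factorial * (c + 1 - m)))
      ((∫ x in (0 : ℝ)..1, x ^ c * Real.exp (-w / x)) - w ^ (c + 1) * Real.Gamma (-c - 1)) := by
  have ha : 0 < -c - 1 := by linarith
  set P : ℝ → ℝ := fun y => ∫ u in (0 : ℝ)..y, u ^ (-c - 1 - 1) * Real.exp (-u) with hP
  have hii : ∀ y, IntervalIntegrable (fun u : ℝ => u ^ (-c - 1 - 1) * Real.exp (-u)) volume 0 y :=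
    fun y => (intervalIntegral.intervalIntegrable_rpow' (by linarith)).mul_continuousOn
      (by fun_prop)
  have hPd : ∀ y : ℝ, 0 < y → HasDerivAt P (y ^ (-c - 1 - 1) * Real.exp (-y)) y := by
    intro y hy
    refine intervalIntegral.integral_hasDerivAt_right (hii y) ?_ ?_
    · exact (Measurable.stronglyMeasurable (by fun_prop)).stronglyMeasurableAtFilter
    · exact (Real.continuousAt_rpow_const _ _ (Or.inl hy.ne')).mul (by fun_prop)
  have hint : ∫ x in (0 : ℝ)..1, x ^ c * Real.exp (-w / x)
      = -w ^ (c + 1) * P (w / 1) - -w ^ (c + 1) * Real.Gamma (-c - 1) := by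
    refine intervalIntegral.integral_eq_sub_of_hasDerivAt_of_tendsto
      (f := fun x => -w ^ (c + 1) * P (w / x)) one_pos (fun x hx => ?_)
      (intervalIntegrable_rpow_mul_exp_neg_div (by linarith) hw) ?_ ?_
    · have hx0 := hx.1
      have h1 : HasDerivAt (fun x : ℝ => w / x) (w * -(x ^ 2)⁻¹) x := by
        simpa only [div_eq_mul_inv] using (hasDerivAt_inv hx0.ne').const_mul w
      have h2 := ((hPd (w / x) (by positivity)).comp x h1).const_mul (-w ^ (c + 1))
      convert! h2 using 1
      have e1 : (w / x) ^ (-c - 1 - 1) = w⁻¹ * (w ^ (c + 1))⁻¹ * (x ^ c * x ^ 2) := by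
        rw [show -c - 1 - 1 = -(c + 1) + -1 by ring, Real.rpow_add (by positivity),
          Real.rpow_neg_one, Real.rpow_neg (by positivity), Real.div_rpow hw.le hx0.le,
          Real.rpow_add_one hx0.ne']
        field_simp
      have e2 : w ^ (c + 1) ≠ 0 := by positivity
      rw [e1, show -(w / x) = -w / x by ring]
      field_simp
    · refine Tendsto.const_mul _ ((tendsto_integral_rpow_mul_exp_neg ha).comp ?_)
      exact (tendsto_inv_nhdsGT_zero.const_mul_atTop hw).congr fun x => (div_eq_mul_inv w x).symm
    · refine Tendsto.const_mul _ (Tendsto.mono_left ?_ nhdsWithin_le_nhds)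
      exact ((hPd (w / 1) (by simpa using hw)).continuousAt.tendsto).comp
        (continuousAt_const.div continuousAt_id one_ne_zero)
  have hs := (hasSum_integral_rpow_mul_exp_neg ha hw.le).mul_left (-w ^ (c + 1))
  rw [hint, div_one]
  change HasSum _ (-w ^ (c + 1) * P w) at hs
  convert! hs using 1
  · ext m
    have e : w ^ (-c - 1) = (w ^ (c + 1))⁻¹ := by rw [← Real.rpow_neg hw.le]; ring_nf
    have e2 : w ^ (c + 1) ≠ 0 := by positivity
    have e3 : c + 1 - m = -(-c - 1 + m) := by ring
    have e4 : -c - 1 + m ≠ 0 := by positivity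
    rw [e, e3]
    field_simp
  · ring

/-- Integrate the derivative of x^(c+1) e^(-w/x); this carries the expansion from the exponent c - 1
to c. -/
theorem integral_rpow_recurrence {c w : ℝ} (hc : ∀ k : ℤ, c ≠ k) (hw : 0 < w) :
    (c + 1) * (∫ x in (0 : ℝ)..1, x ^ c * Real.exp (-w / x))
      + w * (∫ x in (0 : ℝ)..1, x ^ (c - 1) * Real.exp (-w / x)) = Real.exp (-w) := by
  have h0 : c ≠ 0 := by simpa using hc 0
  have h1 : c - 1 ≠ 0 := fun h => hc 1 (by push_cast; linarith)
  have h2 : c + 1 ≠ 0 := fun h => hc (-1) (by push_cast; linarith)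
  have i0 := (intervalIntegrable_rpow_mul_exp_neg_div h0 hw).const_mul (c + 1)
  have i1 := (intervalIntegrable_rpow_mul_exp_neg_div h1 hw).const_mul w
  rw [← intervalIntegral.integral_const_mul, ← intervalIntegral.integral_const_mul,
    ← intervalIntegral.integral_add i0 i1,
    intervalIntegral.integral_eq_sub_of_hasDerivAt_of_le (f := fun x => x ^ (c + 1) *
      Real.exp (-w / x)) zero_le_one
      ((continuousOn_rpow_mul_exp_neg_div h2 hw).mono Set.Icc_subset_Ici_self) (fun x hx => ?_)
      (i0.add i1)]
  · simp [Real.zero_rpow h2]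
  · have hx0 := hx.1
    have h := (Real.hasDerivAt_rpow_const (p := c + 1) (Or.inl hx0.ne')).mul
      (hasDerivAt_exp_neg_div w hx0.ne')
    convert! h using 1
    rw [show c + 1 - 1 = c by ring, Real.rpow_add_one hx0.ne', Real.rpow_sub_one hx0.ne']
    field_simp

/-- Small-`w` expansion of `∫₀¹ x ^ c * exp (-w / x) dx` for non-integral `c`. -/
theorem hasSum_integral_rpow_mul_exp_neg_div {c w : ℝ} (hc : ∀ k : ℤ, c ≠ k) (hw : 0 < w) :
    HasSum (fun m : ℕ => (-1) ^ m * w ^ m / (m.factorial * (c + 1 - m)))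
      ((∫ x in (0 : ℝ)..1, x ^ c * Real.exp (-w / x)) - w ^ (c + 1) * Real.Gamma (-c - 1)) := by
  -- Induction on a natural bound N of c + 1: N = 0 is the range c < -1 of the incomplete gamma
  -- function, and each step lowers c by one.
  obtain ⟨N, hN⟩ := exists_nat_gt (c + 1)
  induction N generalizing c with
  | zero => exact integral_rpow_mul_exp_neg_div_of_lt (by push_cast at hN; linarith) hw
  | succ N ih =>
    have h := ih (c := c - 1) (fun k hk => hc (k + 1) (by push_cast; linarith))
      (by push_cast at hN; linarith)
    have hexp := NormedSpace.expSeries_div_hasSum_exp (-w)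
    rw [← Real.exp_eq_exp_ℝ] at hexp
    have h2 : c + 1 ≠ 0 := fun h => hc (-1) (by push_cast; linarith)
    have hr := integral_rpow_recurrence hc hw
    -- Without its term m = 0, the series for c matches the exponential series without its first
    -- term, minus w times the series for c - 1, all divided by c + 1.
    rw [← hasSum_nat_add_iff' 1] at hexp ⊢
    have hs := (hexp.sub (h.mul_left w)).div_const (c + 1)
    have hneg : -c - 1 ≠ 0 := fun h => h2 (by linarith)
    have hΓ := Real.Gamma_add_one hneg
    convert! hs using 1
    · ext m
      have h3 : c - m ≠ 0 := fun h => hc m (by push_cast; linarith)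
      have e1 : c + 1 - (m + 1 : ℕ) = c - m := by push_cast; ring
      have e2 : c - 1 + 1 - m = c - m := by ring
      rw [e1, e2, Nat.factorial_succ, neg_pow w, pow_succ, pow_succ]
      push_cast
      field_simp
      ring
    · rw [show c - 1 + 1 = c by ring, show -(c - 1) - 1 = -c - 1 + 1 by ring, hΓ,
        Real.rpow_add_one hw.ne']
      generalize (∫ x in (0 : ℝ)..1, x ^ c * Real.exp (-w / x)) = I at hr ⊢
      generalize (∫ x in (0 : ℝ)..1, x ^ (c - 1) * Real.exp (-w / x)) = J at hr ⊢
      simp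
      field_simp
      linear_combination hr

end

/-! ### Truncated exponentials and the two series for the moments. -/

section

open Finset (range)
open MeasureTheory

/-- `exp (-y)` times the Taylor polynomial of degree `k` of `exp y`. -/
noncomputable def truncExp (k : ℕ) (y : ℝ) : ℝ :=
  Real.exp (-y) * ∑ m ∈ range (k + 1), y ^ m / m.factorial

theorem continuous_truncExp (k : ℕ) : Continuous (truncExp k) := by
  unfold truncExp
  fun_prop

theorem truncExp_zero (k : ℕ) : truncExp k 0 = 1 := by
  simp [truncExp, Finset.sum_range_succ']

theorem truncExp_nonneg (k : ℕ) {y : ℝ} (hy : 0 ≤ y) : 0 ≤ truncExp k y :=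
  mul_nonneg (Real.exp_pos _).le (Finset.sum_nonneg fun _ _ => by positivity)

theorem truncExp_le_one (k : ℕ) {y : ℝ} (hy : 0 ≤ y) : truncExp k y ≤ 1 := by
  have := Real.sum_le_exp_of_nonneg hy (k + 1)
  calc truncExp k y ≤ Real.exp (-y) * Real.exp y := by
        unfold truncExp; gcongr
    _ = 1 := by rw [← Real.exp_add]; simp

/-- The sum telescopes to its last term; this single monomial is what makes the integration by parts
below close up. -/
theorem hasDerivAt_truncExp (k : ℕ) (y : ℝ) :
    HasDerivAt (truncExp k) (-(y ^ k / k.factorial * Real.exp (-y))) y := by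
  have hexp : HasDerivAt (fun y : ℝ => Real.exp (-y)) (-Real.exp (-y)) y := by
    simpa using (hasDerivAt_neg y).exp
  induction k with
  | zero =>
    have h0 : truncExp 0 = fun y => Real.exp (-y) := by ext y; simp [truncExp]
    simpa [h0] using hexp
  | succ k ih =>
    have hs : truncExp (k + 1) = fun y => truncExp k y +
        Real.exp (-y) * (y ^ (k + 1) / (k + 1).factorial) := by
      ext y
      simp only [truncExp]
      rw [Finset.sum_range_succ _ (k + 1)]
      ring
    rw [hs]
    have h := ih.add (hexp.mul ((hasDerivAt_pow (k + 1) y).div_const ((k + 1).factorial : ℝ)))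
    convert! h using 1
    rw [Nat.factorial_succ]
    push_cast
    have : (k.factorial : ℝ) ≠ 0 := by positivity
    field_simp
    ring

/-- `1 - truncExp k t` is the regularized lower incomplete gamma function of parameter k + 1, so its
series starts at t^(k+1). This gain in column k is the reason for truncating. -/
theorem hasSum_one_sub_truncExp (k : ℕ) {t : ℝ} (ht : 0 ≤ t) :
    HasSum (fun m : ℕ => (-1) ^ m * t ^ (k + m + 1) / (k.factorial * (m.factorial * (k + m + 1))))
      (1 - truncExp k t) := by
  have h := (hasSum_integral_rpow_mul_exp_neg (a := k + 1) (by positivity) ht).div_const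
    (k.factorial : ℝ)
  have hint : ∫ u in (0 : ℝ)..t, u ^ ((k : ℝ) + 1 - 1) * Real.exp (-u)
      = k.factorial * (1 - truncExp k t) := by
    have := intervalIntegral.integral_eq_sub_of_hasDerivAt (a := 0) (b := t)
      (fun y _ => hasDerivAt_truncExp k y) (Continuous.intervalIntegrable (by fun_prop) _ _)
    rw [truncExp_zero, intervalIntegral.integral_neg] at this
    simp only [add_sub_cancel_right, Real.rpow_natCast]
    rw [← neg_sub, ← this, neg_neg, ← intervalIntegral.integral_const_mul]
    refine intervalIntegral.integral_congr fun u _ => ?_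
    have : (k.factorial : ℝ) ≠ 0 := by positivity
    field_simp
  have hk : (k.factorial : ℝ) ≠ 0 := by positivity
  rw [hint, mul_div_cancel_left₀ _ hk] at h
  convert! h using 2 with m
  have e : t ^ ((k : ℝ) + 1) = t ^ (k + 1) := by
    rw [← Real.rpow_natCast]; push_cast; rfl
  have h0 : (k : ℝ) + m + 1 ≠ 0 := by positivity
  have h1 : (k : ℝ) + 1 + m ≠ 0 := by positivity
  rw [e, show k + m + 1 = m + (k + 1) by ring, pow_add t m]
  field_simp
  ring

theorem intervalIntegrable_rpow_mul_truncExp {k : ℕ} {b t : ℝ} (hb : 0 ≤ b) (ht : 0 ≤ t) :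
    IntervalIntegrable (fun x : ℝ => x ^ b * truncExp k (t / x)) volume 0 1 := by
  have h1 : IntervalIntegrable (fun _ : ℝ => (1 : ℝ)) volume 0 1 := by simp
  refine h1.mono_fun ?_ ?_
  · have := (continuous_truncExp k).measurable
    exact (Measurable.aestronglyMeasurable (by fun_prop))
  · filter_upwards [ae_restrict_mem measurableSet_uIoc] with x hx
    rw [Set.uIoc_of_le zero_le_one] at hx
    have h1 := hx.1.le
    rw [norm_one, norm_mul, Real.norm_of_nonneg (Real.rpow_nonneg h1 _),
      Real.norm_of_nonneg (truncExp_nonneg k (by positivity))]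
    exact mul_le_one₀ (Real.rpow_le_one h1 hx.2 hb) (truncExp_nonneg k (by positivity))
      (truncExp_le_one k (by positivity))

/-- Integrate the derivative of x^(c+k+2) `truncExp k (t/x)`; its value tends to 0 at x = 0 since
the exponent is positive. -/
theorem integral_rpow_mul_truncExp (k : ℕ) {c t : ℝ} (hc1 : -1 < c) (hc : ∀ k : ℤ, c ≠ k)
    (ht : 0 < t) :
    (c + k + 2) * ∫ x in (0 : ℝ)..1, x ^ (c + k + 1) * truncExp k (t / x)
      = truncExp k t -
        t ^ (k + 1) / k.factorial * ∫ x in (0 : ℝ)..1, x ^ c * Real.exp (-t / x) := by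
  have hk : (0 : ℝ) ≤ k := by positivity
  have h0 : c ≠ 0 := by simpa using hc 0
  have i0 := (intervalIntegrable_rpow_mul_truncExp (k := k) (b := c + k + 1) (t := t)
    (by linarith) ht.le).const_mul (c + k + 2)
  have i1 := (intervalIntegrable_rpow_mul_exp_neg_div h0 ht).const_mul (t ^ (k + 1) / k.factorial)
  rw [eq_sub_iff_add_eq, ← intervalIntegral.integral_const_mul,
    ← intervalIntegral.integral_const_mul, ← intervalIntegral.integral_add i0 i1]
  rw [intervalIntegral.integral_eq_sub_of_hasDerivAt_of_tendsto
    (f := fun x => x ^ (c + k + 2) * truncExp k (t / x)) (fa := 0) (fb := truncExp k t)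
    one_pos (fun x hx => ?_) (i0.add i1) ?_ ?_]
  · simp
  · refine squeeze_zero_norm' (a := fun x : ℝ => x ^ (c + k + 2)) ?_ ?_
    · filter_upwards [self_mem_nhdsWithin] with x hx
      have hx : 0 < x := hx
      rw [norm_mul, Real.norm_of_nonneg (Real.rpow_nonneg hx.le _),
        Real.norm_of_nonneg (truncExp_nonneg k (by positivity))]
      exact mul_le_of_le_one_right (by positivity) (truncExp_le_one k (by positivity))
    · have := (Real.continuousAt_rpow_const 0 (c + k + 2) (Or.inr (by linarith))).tendsto
      rw [Real.zero_rpow (by linarith)] at this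
      exact this.mono_left nhdsWithin_le_nhds
  · have : ContinuousAt (fun x : ℝ => x ^ (c + k + 2) * truncExp k (t / x)) 1 :=
      (Real.continuousAt_rpow_const _ _ (Or.inl one_ne_zero)).mul
        ((continuous_truncExp k).continuousAt.comp
          (continuousAt_const.div continuousAt_id one_ne_zero))
    have := this.tendsto
    simp only [Real.one_rpow, div_one, one_mul] at this
    exact this.mono_left nhdsWithin_le_nhds
  · have hx0 := hx.1
    have h1 : HasDerivAt (fun x : ℝ => t / x) (t * -(x ^ 2)⁻¹) x := by
      simpa only [div_eq_mul_inv] using (hasDerivAt_inv hx0.ne').const_mul t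
    have h := (Real.hasDerivAt_rpow_const (p := c + k + 2) (Or.inl hx0.ne')).mul
      ((hasDerivAt_truncExp k (t / x)).comp x h1)
    convert! h using 1
    rw [show c + k + 2 - 1 = c + k + 1 by ring, show c + k + 2 = c + ((k + 2 : ℕ) : ℝ) by
      push_cast; ring, Real.rpow_add_natCast hx0.ne', div_pow, neg_div]
    simp only [Function.comp]
    field_simp
    push_cast
    ring

/-- Small-`t` expansion of the truncated moments for non-integral exponents. -/
theorem hasSum_integral_rpow_mul_truncExp (k : ℕ) {c t : ℝ} (hc1 : -1 < c) (hc : ∀ k : ℤ, c ≠ k)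
    (ht : 0 < t) :
    HasSum (fun m : ℕ => (-1) ^ m * t ^ (k + m + 1) /
        (k.factorial * (m.factorial * (k + m + 1))) / (c + 1 - m))
      (1 / (c + k + 2) - (∫ x in (0 : ℝ)..1, x ^ (c + k + 1) * truncExp k (t / x))
        - t ^ (c + k + 2) * Real.Gamma (-c - 1) / ((c + k + 2) * k.factorial)) := by
  have hk : (0 : ℝ) ≤ k := by positivity
  have hck : c + k + 2 ≠ 0 := by linarith
  have h := ((hasSum_one_sub_truncExp k ht.le).add
    ((hasSum_integral_rpow_mul_exp_neg_div hc ht).mul_left (t ^ (k + 1) / k.factorial))).div_const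
    (c + k + 2)
  convert! h using 1
  · ext m
    have h3 : c + 1 - m ≠ 0 := fun h => hc (m - 1) (by push_cast; linarith)
    have h4 : (k : ℝ) + m + 1 ≠ 0 := by positivity
    rw [show k + m + 1 = (k + 1) + m by ring, pow_add t (k + 1)]
    field_simp
    ring
  · have hI := integral_rpow_mul_truncExp k hc1 hc ht
    have e : t ^ (c + k + 2) = t ^ (c + 1) * t ^ (k + 1) := by
      rw [← Real.rpow_natCast, ← Real.rpow_add ht]; push_cast; ring_nf
    rw [e]
    generalize (∫ x in (0 : ℝ)..1, x ^ c * Real.exp (-t / x)) = I at hI ⊢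
    generalize (∫ x in (0 : ℝ)..1, x ^ (c + k + 1) * truncExp k (t / x)) = J at hI ⊢
    field_simp
    field_simp at hI
    linear_combination -hI

/-- Termwise integration of the binomial series of `(1 - x) ^ β` against a bounded function. -/
theorem hasSum_integral_binomial {a β : ℝ} (ha : 0 ≤ a) (hβ : 0 < β) {g : ℝ → ℝ}
    (hg : Measurable g) (hg1 : ∀ x, 0 ≤ x → |g x| ≤ 1) :
    HasSum (fun r : ℕ => binomCoeff β r * ∫ x in (0 : ℝ)..1, x ^ (a + r) * g x)
      (∫ x in (0 : ℝ)..1, x ^ a * (1 - x) ^ β * g x) := by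
  simp_rw [← intervalIntegral.integral_const_mul]
  refine intervalIntegral.hasSum_integral_of_dominated_convergence
    (fun (r : ℕ) _ => |binomCoeff β r|) (fun r => ?_) (fun r => ?_) ?_ ?_ ?_
  · exact (Measurable.aestronglyMeasurable (by fun_prop))
  · refine .of_forall fun x hx => ?_
    rw [Set.uIoc_of_le zero_le_one] at hx
    rw [norm_mul, norm_mul, Real.norm_eq_abs, Real.norm_of_nonneg (Real.rpow_nonneg hx.1.le _)]
    exact mul_le_of_le_one_right (abs_nonneg _) (mul_le_one₀
      (Real.rpow_le_one hx.1.le hx.2 (by positivity)) (norm_nonneg _) (hg1 x hx.1.le))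
  · exact .of_forall fun _ _ => summable_abs_binomCoeff hβ
  · simp
  · have h1 : ∀ᵐ x : ℝ, x ≠ 1 := by simp [ae_iff, measure_singleton]
    filter_upwards [h1] with x hx1 hx
    rw [Set.uIoc_of_le zero_le_one] at hx
    have hlt : |x| < 1 := by
      rw [abs_of_pos hx.1]; exact lt_of_le_of_ne hx.2 hx1
    have h := ((hasSum_binomCoeff β hlt).mul_left (x ^ a)).mul_right (g x)
    convert! h using 2 with r
    rw [Real.rpow_add_natCast hx.1.ne']
    ring

theorem integral_rpow_mul_one_sub_rpow {a β : ℝ} (ha : 0 ≤ a) (hβ : 0 < β) :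
    ∫ x in (0 : ℝ)..1, x ^ a * (1 - x) ^ β = betaSeries β (a + 1) := by
  have h := hasSum_integral_binomial ha hβ (g := fun _ => 1) measurable_const (by simp)
  simp only [mul_one] at h
  rw [← h.tsum_eq, betaSeries]
  refine tsum_congr fun r => ?_
  have hr : (0 : ℝ) ≤ r := by positivity
  rw [integral_rpow (Or.inl (by linarith)), Real.one_rpow, Real.zero_rpow (by linarith)]
  rw [show a + r + 1 = a + 1 + r by ring]
  ring

theorem exists_le_abs_sub_int {a : ℝ} (ha : ∀ k : ℤ, a ≠ k) :
    ∃ δ : ℝ, 0 < δ ∧ ∀ k : ℤ, δ ≤ |a - k| :=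
  ⟨|a - round a|, abs_pos.2 (sub_ne_zero.2 (ha _)), fun k => round_le a k⟩

/-- Expansion of the truncated exponential moments of the Jacobi weight. -/
theorem exists_hasSum_integral_truncExp {α β t : ℝ} (hα : 0 < α) (hβ : 0 < β)
    (hαZ : ∀ k : ℤ, α ≠ k) (ht : 0 < t) (j k : ℕ) :
    ∃ A B : ℝ,
      HasSum (fun m : ℕ => (-1) ^ m * t ^ (k + m + 1) / (m.factorial * (k + m + 1)) *
        betaSeries β (α + j - m)) A ∧
      HasSum (fun R : ℕ => t ^ (α + 1 + k + R) * Real.Gamma (-α - R) / (α + k + R + 1) *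
        (if j ≤ R then binomCoeff β (R - j) else 0)) B ∧
      (∫ x in (0 : ℝ)..1, x ^ (α + j + k) * (1 - x) ^ β * truncExp k (t / x))
        = betaSeries β (α + 1 + j + k) - (A + B) / k.factorial := by
  have hk : (0 : ℝ) ≤ k := by positivity
  have hj : (0 : ℝ) ≤ j := by positivity
  have hkf : (k.factorial : ℝ) ≠ 0 := by positivity
  obtain ⟨δ, hδ, hδ'⟩ := exists_le_abs_sub_int hαZ
  have hZ : ∀ r m : ℕ, δ ≤ |α + j - m + r| := fun r m => by
    have := hδ' (m - j - r); push_cast at this; convert this using 2; ring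
  -- The family over (r, m) is absolutely summable, α having positive distance to the integers.
  -- Summing over r first yields continued beta values, the series A; summing over m first yields
  -- the integrals and the powers t^(α+1+k+R), which determine B.
  set f : ℕ × ℕ → ℝ := fun p => binomCoeff β p.1 *
    ((-1) ^ p.2 * t ^ (k + p.2 + 1) / (p.2.factorial * (k + p.2 + 1)) / (α + j - p.2 + p.1)) with hf
  have hfs : Summable f := by
    have h1 := (summable_abs_binomCoeff hβ).mul_of_nonneg
      ((Real.summable_pow_div_factorial t).mul_left (t ^ (k + 1) / δ))
      (fun _ => abs_nonneg _) (fun _ => by positivity)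
    refine .of_norm_bounded h1 fun p => ?_
    rw [hf, norm_mul, Real.norm_eq_abs]
    gcongr
    simp only [norm_div, norm_mul, norm_pow, norm_neg, norm_one, one_pow, one_mul,
      Real.norm_natCast, Real.norm_of_nonneg ht.le, Real.norm_eq_abs (_ + _)]
    rw [abs_of_nonneg (show (0 : ℝ) ≤ k + p.2 + 1 by positivity),
      show k + p.2 + 1 = (k + 1) + p.2 by ring, pow_add, div_mul_div_comm, div_div]
    rw [mul_comm δ]
    have : (1 : ℝ) ≤ k + p.2 + 1 := by
      have : (0 : ℝ) ≤ p.2 := by positivity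
      linarith
    gcongr
    · exact le_mul_of_one_le_right (by positivity) this
    · exact hZ _ _
  have hrow : ∀ r : ℕ, HasSum (fun m => f (r, m)) (k.factorial * (binomCoeff β r *
      (1 / (α + 1 + j + k + r) - (∫ x in (0 : ℝ)..1, x ^ (α + j + k + r) * truncExp k (t / x))
        - t ^ (α + 1 + k + (j + r : ℕ)) * Real.Gamma (-α - (j + r : ℕ)) /
          ((α + k + (j + r : ℕ) + 1) * k.factorial)))) := by
    intro r
    have hr : (0 : ℝ) ≤ r := by positivity
    have h := ((hasSum_integral_rpow_mul_truncExp k (c := α + j + r - 1) (by linarith)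
      (fun l hl => hαZ (l + 1 - j - r) (by push_cast; linarith)) ht).mul_left
      (binomCoeff β r)).mul_left (k.factorial : ℝ)
    convert! h using 1
    · ext m
      have h0 : (k : ℝ) + m + 1 ≠ 0 := by positivity
      have h3 : α + j - m + r ≠ 0 := fun h => by
        have := hZ r m; rw [h, abs_zero] at this; linarith
      rw [show α + j + r - 1 + 1 - m = α + j - m + r by ring]
      simp only [hf]
      field_simp
    · push_cast
      ring_nf
  refine ⟨∑' p, f p, k.factorial * (betaSeries β (α + 1 + j + k) -
    ∫ x in (0 : ℝ)..1, x ^ (α + j + k) * (1 - x) ^ β * truncExp k (t / x)) - ∑' p, f p,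
    ?_, ?_, ?_⟩
  · have h := (((Equiv.prodComm ℕ ℕ).hasSum_iff (f := f)).2 hfs.hasSum).prod_fiberwise
      (g := fun m : ℕ => (-1) ^ m * t ^ (k + m + 1) / (m.factorial * (k + m + 1)) *
        betaSeries β (α + j - m)) fun m => by
      have h1 := (summable_mul_div_add (summable_abs_binomCoeff hβ) (z := α + j - m)
        (fun r h => by have := hZ r m; rw [h, abs_zero] at this; linarith)).hasSum.mul_left
        ((-1) ^ m * t ^ (k + m + 1) / (m.factorial * (k + m + 1)))
      convert! h1 using 2 with r
      simp only [hf, Function.comp, Equiv.prodComm_apply, Prod.swap]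
      ring
    exact h
  · have h1 := hfs.hasSum.prod_fiberwise hrow
    have h2 := hasSum_integral_binomial (a := α + j + k) (g := fun x => truncExp k (t / x))
      (by positivity) hβ (by have := (continuous_truncExp k).measurable; fun_prop)
      (fun x hx => by
        rw [abs_of_nonneg (truncExp_nonneg k (by positivity))]
        exact truncExp_le_one k (by positivity))
    have h3 := (summable_mul_div_add (summable_abs_binomCoeff hβ) (z := α + 1 + j + k)
        (fun r => by positivity)).hasSum
    have h4 := ((h3.sub h2).mul_left (k.factorial : ℝ)).sub h1
    -- The r-th binomial term in row j contributes the power R = j + r, so the terms with R < j are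
    -- zero.
    have h5 : ∑ R ∈ range j, t ^ (α + 1 + k + R) * Real.Gamma (-α - R) / (α + k + R + 1) *
        (if j ≤ R then binomCoeff β (R - j) else 0) = 0 :=
      Finset.sum_eq_zero fun R hR => by
        rw [if_neg (by simpa using hR), mul_zero]
    rw [← hasSum_nat_add_iff' j, h5, sub_zero]
    convert! h4 using 2 with r
    rw [if_pos (by omega), Nat.add_sub_cancel, add_comm r j]
    have h6 : α + k + (j + r : ℕ) + 1 ≠ 0 := by positivity
    field_simp
    ring
  · field_simp
    ring

end

/-! ### The coefficients after scaling, as functions of x = 1/n, and their uniform bounds. -/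

section

open Finset (range)

/-- The row factor of the scaled matrix; here and below `x` stands for `1 / n`. -/
noncomputable def rowFactor (α β x : ℝ) (i : ℕ) : ℝ :=
  (-1) ^ i / i.factorial *
    ∏ j ∈ range i, (1 + (α + β + (j + 1)) * x) * (1 - (j + 1) * x) / (α + (j + 1))

/-- The factor of the Taylor coefficients of the analytic part. -/
noncomputable def regFactor (α β x : ℝ) (m : ℕ) : ℝ :=
  1 / m.factorial * ∏ j ∈ range (m + 1), (1 + (α + β - j) * x) * (1 + j * x) / (α - j)

/-- The factor of the Taylor coefficients of the part carrying the power `σ ^ (α + 1)`. -/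
noncomputable def singFactor (α β x : ℝ) (R : ℕ) : ℝ :=
  Real.Gamma (-α) / R.factorial *
    ∏ j ∈ range R, (1 + (β - (j + 1)) * x) * (1 + (α + (j + 1)) * x) / (α + (j + 1)) ^ 2

/-- Up to sign, the coefficient of σ^(k+m+1) in the entry (i, k) of M. The factor m + 1 + i is the
distance from the interpolation point α - m to the node α + 1 + i; the factors k!, m!, k + m + 1
come from `hasSum_one_sub_truncExp`. -/
noncomputable def regCoeff (α β x : ℝ) (i k m : ℕ) : ℝ :=
  (-1) ^ m * rowFactor α β x i * regFactor α β x m /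
    (k.factorial * m.factorial * (k + m + 1) * (m + 1 + i))

/-- The analogue for the part carrying σ^(α+1), whose interpolation point is -R. -/
noncomputable def singCoeff (α β x : ℝ) (i k R : ℕ) : ℝ :=
  rowFactor α β x i * singFactor α β x R /
    (k.factorial * (k + R + 1 + α) * (i + R + 1 + α))

/-- The admissible values of the parameter: reciprocals of positive integers and their limit. -/
def IsScale (x : ℝ) : Prop := x = 0 ∨ ∃ n : ℕ, x = ((n : ℝ) + 1)⁻¹

theorem IsScale.nonneg {x : ℝ} (hx : IsScale x) : 0 ≤ x := by
  rcases hx with rfl | ⟨n, rfl⟩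
  · exact le_rfl
  · positivity

theorem IsScale.le_one {x : ℝ} (hx : IsScale x) : x ≤ 1 := by
  rcases hx with rfl | ⟨n, rfl⟩
  · exact zero_le_one
  · exact inv_le_one_of_one_le₀ (by linarith [Nat.cast_nonneg (α := ℝ) n])

/-- The factor 1 - (n+1)x vanishes at this scale, so the infinite matrix has only n + 1 nonzero rows
and its truncation comes for free. -/
theorem rowFactor_eq_zero (α β : ℝ) {n i : ℕ} (hi : n + 1 ≤ i) :
    rowFactor α β ((n : ℝ) + 1)⁻¹ i = 0 := by
  rw [rowFactor, Finset.prod_eq_zero (i := n) (by simpa using hi), mul_zero]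
  rw [mul_inv_cancel₀ (by positivity)]
  simp

/-- In the rows that do not vanish, (j+1)x ≤ 1 for all j < i, so every factor of the product is at
most 2 + α + β in modulus. -/
theorem abs_rowFactor_le {α β x : ℝ} (hα : 0 < α) (hβ : 0 < β) (hx : IsScale x) (i : ℕ) :
    |rowFactor α β x i| ≤ (2 + α + β) ^ i / i.factorial := by
  have main : (∀ j < i, ((j : ℝ) + 1) * x ≤ 1) →
      |rowFactor α β x i| ≤ (2 + α + β) ^ i / i.factorial := by
    intro h
    rw [rowFactor, abs_mul, abs_div, abs_pow, abs_neg, abs_one, one_pow, Nat.abs_cast,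
      Finset.abs_prod, div_mul_eq_mul_div, one_mul]
    gcongr
    have hle := Finset.prod_le_prod (s := range i)
      (f := fun j : ℕ => |(1 + (α + β + ((j : ℝ) + 1)) * x) * (1 - ((j : ℝ) + 1) * x)
        / (α + ((j : ℝ) + 1))|) (g := fun _ => 2 + α + β) (fun _ _ => abs_nonneg _)
      fun j hj => by
        have h1 := h j (by simpa using hj)
        have h0 := hx.nonneg
        have h2 := hx.le_one
        have hj0 : (0 : ℝ) ≤ j := by positivity
        rw [abs_div, abs_mul, abs_of_nonneg (by positivity), abs_of_nonneg (by linarith),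
          abs_of_nonneg (by positivity), div_le_iff₀ (by positivity)]
        have h3 : 0 ≤ ((j : ℝ) + 1) * x := by positivity
        have h4 : 1 + (α + β + (j + 1)) * x ≤ 2 + α + β := by nlinarith
        have h5 : (1 : ℝ) ≤ α + (j + 1) := by linarith
        calc (1 + (α + β + (j + 1)) * x) * (1 - (j + 1) * x) ≤ (2 + α + β) * 1 := by
              gcongr
              linarith
          _ ≤ _ := by gcongr
    simpa using hle
  rcases hx with rfl | ⟨n, rfl⟩
  · exact main (by simp)
  · rcases le_or_gt (n + 1) i with hi | hi
    · rw [rowFactor_eq_zero α β hi, abs_zero]; positivity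
    · refine main fun j hj => ?_
      rw [← div_eq_mul_inv, div_le_one (by positivity)]
      have : j ≤ n := by omega
      have : (j : ℝ) ≤ n := by exact_mod_cast this
      linarith

/-- Compares the numerators of `regFactor`, which grow like j, with its denominators α - j; the
distance of α to the integers takes care of the j near α. -/
theorem exists_add_le_mul_abs_sub {α : ℝ} (hα : 0 < α) (hαZ : ∀ k : ℤ, α ≠ k) {β : ℝ}
    (hβ : 0 < β) : ∃ K : ℝ, 1 ≤ K ∧ ∀ j : ℕ, 1 + α + β + j ≤ K * |α - j| := by
  obtain ⟨δ, hδ, h⟩ := exists_le_abs_sub_int hαZ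
  refine ⟨1 + (1 + 2 * α + β) / δ, by have : 0 < (1 + 2 * α + β) / δ := by positivity
                                      linarith, fun j => ?_⟩
  have h1 : δ ≤ |α - j| := by simpa using h j
  have h2 : (j : ℝ) - α ≤ |α - j| := by rw [abs_sub_comm]; exact le_abs_self _
  have h3 : 1 + 2 * α + β ≤ (1 + 2 * α + β) / δ * |α - j| := by
    rw [div_mul_eq_mul_div, le_div_iff₀ hδ]
    gcongr
  rw [add_mul, one_mul]
  linarith

theorem abs_regFactor_le {α β x K : ℝ} (hα : 0 < α) (hβ : 0 < β) (hx : IsScale x)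
    (hαZ : ∀ k : ℤ, α ≠ k) (hK : ∀ j : ℕ, 1 + α + β + j ≤ K * |α - j|) (m : ℕ) :
    |regFactor α β x m| ≤ K ^ (m + 1) * (m + 1) := by
  have hle := Finset.prod_le_prod (s := range (m + 1))
      (f := fun j : ℕ => |(1 + (α + β - j) * x) * (1 + j * x) / (α - j)|)
      (g := fun j : ℕ => K * (j + 1)) (fun _ _ => abs_nonneg _)
      fun j _ => by
        have h0 := hx.nonneg
        have h2 := hx.le_one
        have hj0 : (0 : ℝ) ≤ j := by positivity
        have h3 : α - j ≠ 0 := sub_ne_zero.2 (by simpa using hαZ j)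
        rw [abs_div, abs_mul, div_le_iff₀ (abs_pos.2 h3)]
        have h4 : |1 + (α + β - j) * x| ≤ 1 + α + β + j := by
          rw [abs_le]; constructor <;> nlinarith
        have h5 : |1 + j * x| ≤ j + 1 := by
          rw [abs_of_nonneg (by positivity)]; nlinarith
        calc _ ≤ (1 + α + β + j) * (j + 1) := by gcongr
          _ ≤ K * |α - j| * (j + 1) := by gcongr; exact hK j
          _ = _ := by ring
  rw [regFactor, abs_mul, Finset.abs_prod, abs_div, abs_one, Nat.abs_cast, div_mul_eq_mul_div,
    one_mul, div_le_iff₀ (by positivity)]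
  refine hle.trans_eq ?_
  rw [Finset.prod_mul_distrib, Finset.prod_const, Finset.card_range]
  have : ∏ j ∈ range (m + 1), ((j : ℝ) + 1) = (m + 1).factorial := by
    rw [← Finset.prod_range_add_one_eq_factorial]; push_cast; rfl
  rw [this, Nat.factorial_succ]
  push_cast
  ring

theorem abs_singFactor_le {α β x : ℝ} (hα : 0 < α) (hβ : 0 < β) (hx : IsScale x) (R : ℕ) :
    |singFactor α β x R| ≤ |Real.Gamma (-α)| * ((2 * (2 + β)) ^ R / R.factorial) := by
  have hle := Finset.prod_le_prod (s := range R)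
      (f := fun j : ℕ => |(1 + (β - (j + 1)) * x) * (1 + (α + (j + 1)) * x) / (α + (j + 1)) ^ 2|)
      (g := fun j : ℕ => 2 * (2 + β)) (fun _ _ => abs_nonneg _)
      fun j _ => by
        have h0 := hx.nonneg
        have h2 := hx.le_one
        have hj0 : (0 : ℝ) ≤ j := by positivity
        rw [abs_div, abs_mul, abs_of_nonneg (show 0 ≤ (α + ((j : ℝ) + 1)) ^ 2 by positivity),
          div_le_iff₀ (by positivity)]
        have h4 : |1 + (β - (j + 1)) * x| ≤ (2 + β) * (α + (j + 1)) := by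
          have e : |1 + (β - (j + 1)) * x| ≤ 1 + β + (j + 1) := by
            rw [abs_le]; constructor <;> nlinarith
          nlinarith [mul_nonneg hβ.le hj0, mul_pos hα hβ]
        have h5 : |1 + (α + (j + 1)) * x| ≤ 2 * (α + (j + 1)) := by
          rw [abs_of_nonneg (by positivity)]; nlinarith
        calc _ ≤ ((2 + β) * (α + (j + 1))) * (2 * (α + (j + 1))) := by gcongr
          _ = _ := by ring
  rw [Finset.prod_const, Finset.card_range] at hle
  rw [singFactor, abs_mul, Finset.abs_prod, abs_div, Nat.abs_cast, div_mul_eq_mul_div,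
    mul_div_assoc]
  gcongr

/-- Uniform bounds for the coefficients. -/
theorem exists_coeff_bound {α β : ℝ} (hα : 0 < α) (hβ : 0 < β) (hαZ : ∀ k : ℤ, α ≠ k) :
    ∃ c C K : ℝ, 0 < c ∧ 0 < C ∧ 0 < K ∧ ∀ x, IsScale x → ∀ i k m : ℕ,
      |regCoeff α β x i k m| ≤ C * (c ^ i / i.factorial) * (1 / k.factorial)
        * (K ^ m / m.factorial) ∧
      |singCoeff α β x i k m| ≤ C * (c ^ i / i.factorial) * (1 / k.factorial)
        * (K ^ m / m.factorial) := by
  obtain ⟨K, hK1, hK⟩ := exists_add_le_mul_abs_sub hα hαZ hβ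
  have hK0 : 0 < K := by linarith
  refine ⟨2 + α + β, K + |Real.Gamma (-α)|, K + 2 * (2 + β), by positivity, by positivity,
    by positivity, fun x hx i k m => ⟨?_, ?_⟩⟩
  · have h1 := abs_rowFactor_le hα hβ hx i
    have h2 := abs_regFactor_le hα hβ hx hαZ hK m
    rw [regCoeff, abs_div, abs_mul, abs_mul, abs_pow, abs_neg, abs_one, one_pow, one_mul,
      abs_of_nonneg (by positivity : (0 : ℝ) ≤ k.factorial * m.factorial * (k + m + 1) * (m + 1 + i))]
    have hq : (m : ℝ) + 1 ≤ m + 1 + i := by linarith [Nat.cast_nonneg (α := ℝ) i]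
    generalize (m : ℝ) + 1 + i = q at hq ⊢
    calc _ ≤ (2 + α + β) ^ i / i.factorial * (K ^ (m + 1) * (m + 1)) /
          (k.factorial * m.factorial * 1 * (m + 1)) := by
          gcongr
          linarith [Nat.cast_nonneg (α := ℝ) k, Nat.cast_nonneg (α := ℝ) m]
      _ = K * ((2 + α + β) ^ i / i.factorial) * (1 / k.factorial) * (K ^ m / m.factorial) := by
          field_simp
          ring
      _ ≤ _ := by
          gcongr
          · linarith [abs_nonneg (Real.Gamma (-α))]
          · linarith
  · have h1 := abs_rowFactor_le hα hβ hx i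
    have h2 := abs_singFactor_le hα hβ hx m
    rw [singCoeff, abs_div, abs_mul,
      abs_of_nonneg (by positivity : (0 : ℝ) ≤ k.factorial * (k + m + 1 + α) * (i + m + 1 + α))]
    calc _ ≤ (2 + α + β) ^ i / i.factorial * (|Real.Gamma (-α)| *
          ((2 * (2 + β)) ^ m / m.factorial)) / (k.factorial * 1 * 1) := by
          gcongr
          · linarith [Nat.cast_nonneg (α := ℝ) k, Nat.cast_nonneg (α := ℝ) m]
          · linarith [Nat.cast_nonneg (α := ℝ) i, Nat.cast_nonneg (α := ℝ) m]
      _ = |Real.Gamma (-α)| * ((2 + α + β) ^ i / i.factorial) * (1 / k.factorial) *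
          ((2 * (2 + β)) ^ m / m.factorial) := by
          field_simp
      _ ≤ _ := by
          gcongr
          · linarith
          · linarith

theorem continuous_regCoeff (α β : ℝ) (i k m : ℕ) :
    Continuous fun x => regCoeff α β x i k m := by
  unfold regCoeff rowFactor regFactor
  fun_prop

theorem continuous_singCoeff (α β : ℝ) (i k m : ℕ) :
    Continuous fun x => singCoeff α β x i k m := by
  unfold singCoeff rowFactor singFactor
  fun_prop

end

/-! ### Beta values as polynomial values, and Lagrange interpolation. -/

section

open Finset (range)
open MeasureTheory

theorem betaSeries_eq_Gamma {β z : ℝ} (hβ : 0 < β) (hz : 1 ≤ z) :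
    betaSeries β z = Real.Gamma z * Real.Gamma (β + 1) / Real.Gamma (z + (β + 1)) := by
  have h1 := integral_rpow_mul_one_sub_rpow (a := z - 1) (by linarith) hβ
  have h2 := ProbabilityTheory.beta_eq_betaIntegralReal z (β + 1) (by linarith) (by linarith)
  rw [sub_add_cancel] at h1
  rw [← h1]
  change _ = ProbabilityTheory.beta z (β + 1)
  rw [h2, Complex.betaIntegral]
  have : ∫ x in (0 : ℝ)..1, (x : ℂ) ^ ((z : ℂ) - 1) * (1 - (x : ℂ)) ^ (((β + 1 : ℝ) : ℂ) - 1)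
      = ((∫ x in (0 : ℝ)..1, x ^ (z - 1) * (1 - x) ^ β : ℝ) : ℂ) := by
    rw [← intervalIntegral.integral_ofReal]
    refine intervalIntegral.integral_congr fun x hx => ?_
    rw [Set.uIcc_of_le zero_le_one] at hx
    have h3 : 0 ≤ 1 - x := by linarith [hx.2]
    rw [Complex.ofReal_mul, Complex.ofReal_cpow hx.1, Complex.ofReal_cpow h3]
    push_cast
    rw [add_sub_cancel_right]
  rw [this, Complex.ofReal_re]

theorem betaSeries_pos {β z : ℝ} (hβ : 0 < β) (hz : 1 ≤ z) : 0 < betaSeries β z := by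
  rw [betaSeries_eq_Gamma hβ hz]
  have h1 := Real.Gamma_pos_of_pos (show 0 < z by linarith)
  have h2 := Real.Gamma_pos_of_pos (show 0 < β + 1 by linarith)
  have h3 := Real.Gamma_pos_of_pos (show 0 < z + (β + 1) by linarith)
  positivity

/-- The rising factorial. -/
noncomputable def rise (z : ℝ) (N : ℕ) : ℝ := ∏ l ∈ range N, (z + l)

theorem rise_zero (z : ℝ) : rise z 0 = 1 := by simp [rise]

theorem rise_succ (z : ℝ) (N : ℕ) : rise z (N + 1) = rise z N * (z + N) := by
  simp [rise, Finset.prod_range_succ]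

theorem rise_succ' (z : ℝ) (N : ℕ) : rise z (N + 1) = z * rise (z + 1) N := by
  rw [rise, Finset.prod_range_succ', rise, mul_comm]
  push_cast
  simp only [add_zero]
  congr 1
  exact Finset.prod_congr rfl fun l _ => by ring

theorem rise_add (z : ℝ) (M N : ℕ) : rise z (M + N) = rise z M * rise (z + M) N := by
  rw [rise, Finset.prod_range_add]
  push_cast
  simp [rise, add_assoc]

theorem rise_ne_zero {z : ℝ} (hz : ∀ r : ℕ, z + r ≠ 0) (N : ℕ) : rise z N ≠ 0 :=
  Finset.prod_ne_zero_iff.2 fun l _ => hz l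

theorem rise_pos {z : ℝ} (hz : 0 < z) (N : ℕ) : 0 < rise z N :=
  Finset.prod_pos fun l _ => by positivity

theorem add_natCast_ne_zero_shift {z : ℝ} (hz : ∀ r : ℕ, z + r ≠ 0) (M : ℕ) :
    ∀ r : ℕ, z + M + r ≠ 0 := fun r => by
  have := hz (M + r); push_cast at this; rwa [← add_assoc] at this

theorem rise_mul_betaSeries {β : ℝ} (hβ : 0 < β) {z : ℝ} (hz : ∀ r : ℕ, z + r ≠ 0) (M : ℕ) :
    rise z M * betaSeries β z = rise (β + 1 + z) M * betaSeries β (z + M) := by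
  induction M with
  | zero => simp [rise_zero]
  | succ M ih =>
    have h := betaSeries_rec hβ (add_natCast_ne_zero_shift hz M)
    rw [rise_succ, rise_succ]
    push_cast
    rw [← add_assoc]
    linear_combination (z + M) * ih + rise (β + 1 + z) M * h

/-- The polynomials interpolated in the inversion of the Hankel matrix at `t = 0`. -/
noncomputable def interpPoly (β : ℝ) (N j : ℕ) (ζ : ℝ) : ℝ :=
  rise ζ j * rise (β + 1 + (ζ + j)) (N - j)

/-- The factor of B(ζ+j, β+1) that does not depend on j. -/
noncomputable def interpConst (β : ℝ) (N : ℕ) (ζ : ℝ) : ℝ := betaSeries β (ζ + N) / rise ζ N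

theorem betaSeries_eq_interpConst_mul {β ζ : ℝ} (hβ : 0 < β) (hz : ∀ r : ℕ, ζ + r ≠ 0) {N j : ℕ}
    (hj : j ≤ N) : betaSeries β (ζ + j) = interpConst β N ζ * interpPoly β N j ζ := by
  obtain ⟨M, rfl⟩ := Nat.exists_eq_add_of_le hj
  have h := rise_mul_betaSeries hβ (add_natCast_ne_zero_shift hz j) M
  have h1 := rise_ne_zero hz j
  have h2 := rise_ne_zero (add_natCast_ne_zero_shift hz j) M
  rw [interpConst, interpPoly, rise_add, Nat.add_sub_cancel_left]
  push_cast
  rw [← add_assoc ζ]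
  field_simp
  linear_combination h

/-- Iterated downwards and upwards, this compares the constants at α - m and at the nodes α + 1 + i
with the one at α + 1. -/
theorem interpConst_rec {β ζ : ℝ} (hβ : 0 < β) (hz : ∀ r : ℕ, ζ + r ≠ 0) (N : ℕ) :
    interpConst β N ζ = interpConst β N (ζ + 1) * ((ζ + N + 1 + β) / ζ) := by
  have h := betaSeries_rec hβ (add_natCast_ne_zero_shift hz N)
  have h0 : ζ ≠ 0 := by simpa using hz 0
  have hz1 : ∀ r : ℕ, ζ + 1 + r ≠ 0 := by simpa using add_natCast_ne_zero_shift hz 1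
  have h1 := rise_ne_zero hz N
  have h2 := rise_ne_zero hz1 N
  have h3 := rise_succ ζ N
  rw [rise_succ'] at h3
  have h4 := hz N
  have e : rise ζ N = ζ * rise (ζ + 1) N / (ζ + N) := by field_simp; linarith
  rw [interpConst, interpConst, e, show ζ + 1 + N = ζ + N + 1 by ring]
  field_simp
  linear_combination h

theorem interpConst_sub {α β : ℝ} (hβ : 0 < β) (hαZ : ∀ k : ℤ, α ≠ k) (N m : ℕ) :
    interpConst β N (α - m) = interpConst β N (α + 1) *
      ∏ j ∈ range (m + 1), ((α - j) + N + 1 + β) / (α - j) := by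
  have h : ∀ m : ℕ, ∀ r : ℕ, α - m + r ≠ 0 := fun m r h => hαZ (m - r) (by push_cast; linarith)
  induction m with
  | zero => simpa using interpConst_rec hβ (by simpa using h 0) N
  | succ m ih =>
    rw [Finset.prod_range_succ, ← mul_assoc, ← ih, interpConst_rec hβ (h (m + 1))]
    push_cast
    rw [show α - (m + 1) + 1 = α - m by ring]

theorem interpConst_add {α β : ℝ} (hα : 0 < α) (hβ : 0 < β) (N i : ℕ) :
    interpConst β N (α + 1) = interpConst β N (α + 1 + i) *
      ∏ j ∈ range i, (α + β + (j + 1) + (N + 1)) / (α + (j + 1)) := by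
  induction i with
  | zero => simp
  | succ i ih =>
    rw [Finset.prod_range_succ, mul_comm (∏ j ∈ range i, _), ← mul_assoc, ih,
      interpConst_rec hβ (fun r => by positivity) N]
    push_cast
    rw [← add_assoc (α + 1)]
    ring_nf

theorem interpConst_pos {β z : ℝ} (hβ : 0 < β) (hz : 1 ≤ z) (N : ℕ) : 0 < interpConst β N z :=
  div_pos (betaSeries_pos hβ (by linarith [Nat.cast_nonneg (α := ℝ) N]))
    (rise_pos (by linarith) N)

/-- The denominators of the Lagrange basis for equally spaced nodes. -/
theorem prod_erase_sub (N i : ℕ) (hi : i ≤ N) :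
    ∏ k ∈ (range (N + 1)).erase i, ((i : ℝ) - k) = (-1) ^ (N - i) * i.factorial * (N - i).factorial := by
  obtain ⟨M, rfl⟩ := Nat.exists_eq_add_of_le hi
  have e : (range (i + M + 1)).erase i = range i ∪ (range M).map (addLeftEmbedding (i + 1)) := by
    ext k
    simp only [Finset.mem_erase, Finset.mem_range, Finset.mem_union, Finset.mem_map,
      addLeftEmbedding_apply]
    constructor
    · intro h
      rcases lt_or_gt_of_ne h.1 with h1 | h1
      · exact Or.inl h1
      · exact Or.inr ⟨k - (i + 1), by omega, by omega⟩
    · rintro (h | ⟨l, h, rfl⟩) <;> omega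
  rw [e, Finset.prod_union, Finset.prod_map, Nat.add_sub_cancel_left]
  · have h1 : ∏ k ∈ range i, ((i : ℝ) - k) = i.factorial := by
      rw [← Finset.prod_range_add_one_eq_factorial, ← Finset.prod_range_reflect]
      push_cast
      refine Finset.prod_congr rfl fun k hk => ?_
      have : k + 1 ≤ i := by simpa using hk
      rw [show i - 1 - k = i - (k + 1) by omega, Nat.cast_sub this]
      push_cast; ring
    have h2 : ∏ k ∈ range M, ((i : ℝ) - ((addLeftEmbedding (i + 1) k : ℕ) : ℝ))
        = (-1) ^ M * M.factorial := by
      rw [← Finset.prod_range_add_one_eq_factorial]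
      push_cast
      have h3 : (-1 : ℝ) ^ M = ∏ k ∈ range M, (-1) := by simp
      rw [h3, ← Finset.prod_mul_distrib]
      refine Finset.prod_congr rfl fun k _ => ?_
      simp only [addLeftEmbedding_apply]
      push_cast; ring
    rw [h1, h2]; ring
  · rw [Finset.disjoint_left]
    intro k hk
    simp only [Finset.mem_range, Finset.mem_map, addLeftEmbedding_apply] at *
    rintro ⟨l, _, h⟩
    omega

-- `interpPoly` has degree at most N in ζ, so its values at the N + 1 nodes α + 1 + i, which index
-- the columns of H(0), determine it. The bound on ζ keeps it off the nodes, so each basis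
-- polynomial is the full nodal product divided by one factor.
open Polynomial in
theorem interpPoly_lagrange {α β ζ : ℝ} {N j : ℕ} (hj : j ≤ N) (hζ : ζ < α + 1) :
    interpPoly β N j ζ = ∑ i ∈ range (N + 1), interpPoly β N j (α + 1 + i) *
      ((-1) ^ i / (i.factorial * (N - i).factorial) *
        (rise (α + 1 - ζ) (N + 1) / (α + 1 - ζ + i))) := by
  set p : ℝ[X] := (∏ l ∈ range j, (X + C (l : ℝ))) *
    ∏ l ∈ range (N - j), (X + C (β + 1 + j + l)) with hp
  have hpe : ∀ z, p.eval z = interpPoly β N j z := by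
    intro z
    simp only [hp, interpPoly, rise, eval_mul, eval_prod, eval_add, eval_X, eval_C]
    congr 1
    exact Finset.prod_congr rfl fun l _ => by ring
  have hdeg : p.degree < (range (N + 1)).card := by
    rw [Finset.card_range, hp]
    have h1 := degree_prod_le (range j) fun l : ℕ => (X + C (l : ℝ) : ℝ[X])
    have h2 := degree_prod_le (range (N - j)) fun l : ℕ => (X + C (β + 1 + j + l) : ℝ[X])
    simp only [degree_X_add_C, Finset.sum_const, Finset.card_range, nsmul_eq_mul, mul_one] at h1 h2
    refine (degree_mul_le _ _).trans_lt ?_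
    calc _ ≤ ((j : ℕ) : WithBot ℕ) + ((N - j : ℕ) : WithBot ℕ) := add_le_add h1 h2
      _ = ((j + (N - j) : ℕ) : WithBot ℕ) := by push_cast; rfl
      _ < ((N + 1 : ℕ) : WithBot ℕ) := by
        rw [Nat.cast_lt]; omega
  have hinj : Set.InjOn (fun i : ℕ => α + 1 + (i : ℝ)) (range (N + 1)) := by
    intro a _ b _ h
    simpa using h
  have h := congrArg (eval ζ) (Lagrange.eq_interpolate hinj hdeg)
  rw [hpe, Lagrange.interpolate_apply, eval_finsetSum] at h
  rw [h]
  refine Finset.sum_congr rfl fun i hi => ?_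
  have hiN : i ≤ N := by simpa [Nat.lt_succ_iff] using hi
  rw [eval_mul, eval_C, hpe]
  congr 1
  simp only [Lagrange.basis, Lagrange.basisDivisor, eval_prod, eval_mul, eval_C, eval_sub, eval_X]
  rw [Finset.prod_mul_distrib, Finset.prod_inv_distrib]
  have h1 : ∏ k ∈ (range (N + 1)).erase i, (α + 1 + (i : ℝ) - (α + 1 + k))
      = (-1) ^ (N - i) * i.factorial * (N - i).factorial := by
    rw [← prod_erase_sub N i hiN]
    exact Finset.prod_congr rfl fun k _ => by ring
  have hpos : (0 : ℝ) < α + 1 - ζ + i := by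
    have : (0 : ℝ) ≤ i := by positivity
    linarith
  have h2 : ∏ k ∈ (range (N + 1)).erase i, (ζ - (α + 1 + k))
      = (-1) ^ N * (rise (α + 1 - ζ) (N + 1) / (α + 1 - ζ + i)) := by
    rw [rise, ← Finset.mul_prod_erase _ _ hi, mul_div_cancel_left₀ _ hpos.ne']
    have h3 : (-1 : ℝ) ^ N = ∏ k ∈ (range (N + 1)).erase i, (-1) := by
      simp [Finset.card_erase_of_mem hi]
    rw [h3, ← Finset.prod_mul_distrib]
    exact Finset.prod_congr rfl fun k _ => by ring
  rw [h1, h2]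
  have h4 : (-1 : ℝ) ^ N = (-1) ^ (N - i) * (-1) ^ i := by
    rw [← pow_add, Nat.sub_add_cancel hiN]
  have h5 : (-1 : ℝ) ^ (N - i) ≠ 0 := by positivity
  rw [h4]
  field_simp

theorem prod_neg_natCast_add (j r : ℕ) :
    rise (-((j + r : ℕ) : ℝ)) j * r.factorial = (-1) ^ j * (j + r).factorial := by
  induction j with
  | zero => simp [rise_zero]
  | succ j ih =>
    rw [rise_succ', show j + 1 + r = (j + r) + 1 by ring, Nat.factorial_succ]
    push_cast at ih ⊢
    rw [show -((j : ℝ) + r + 1) + 1 = -(j + r) by ring]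
    linear_combination (-((j : ℝ) + r + 1)) * ih

theorem rise_reverse (β : ℝ) (M j : ℕ) :
    rise (β + 1) (M + j) = rise (β + 1) M * ∏ l ∈ range j, (β + (M + j : ℕ) - l) := by
  induction j with
  | zero => simp
  | succ j ih =>
    rw [Finset.prod_range_succ', ← add_assoc, rise_succ, ih]
    push_cast
    have : ∏ l ∈ range j, (β + (M + j + 1) - ((l : ℝ) + 1)) = ∏ l ∈ range j, (β + (M + j) - (l : ℝ)) :=
      Finset.prod_congr rfl fun l _ => by ring
    rw [this]
    ring

theorem factorial_mul_binomCoeff_mul_rise (β : ℝ) (M r : ℕ) :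
    r.factorial * binomCoeff β r * rise (β + 1) M
      = (-1) ^ r * rise (β + 1 - r) M * ∏ l ∈ range r, (β + M - l) := by
  induction r with
  | zero => simp [binomCoeff_zero]
  | succ r ih =>
    have h := binomCoeff_succ β r
    have h1 := rise_succ (β - r) M
    rw [rise_succ', show β - r + 1 = β + 1 - r by ring] at h1
    rw [Finset.prod_range_succ, Nat.factorial_succ]
    push_cast
    rw [show β + 1 - (r + 1) = β - r by ring, pow_succ]
    linear_combination r.factorial * rise (β + 1) M * h + (r - β) * ih
      - (-1) ^ r * (∏ l ∈ range r, (β + M - l)) * h1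

/-- The truncated binomial coefficient is the residue of B(ζ+j, β+1) at ζ = -R, which explains why
it is proportional to the same polynomial there. For j > R the rising factorial of -R contains the
factor 0. -/
theorem binomCoeff_eq_interpPoly {β : ℝ} {N j : ℕ} (hj : j ≤ N) (R : ℕ) :
    (if j ≤ R then binomCoeff β (R - j) else 0) * rise (β + 1) N
      = interpPoly β N j (-R) * ((-1) ^ R / R.factorial *
        ∏ l ∈ range R, (β - (l + 1) + (N + 1))) := by
  split_ifs with hR
  · obtain ⟨r, rfl⟩ := Nat.exists_eq_add_of_le hR
    obtain ⟨M, rfl⟩ := Nat.exists_eq_add_of_le' hj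
    have h1 := prod_neg_natCast_add j r
    have h2 := rise_reverse β M j
    have h3 := factorial_mul_binomCoeff_mul_rise β M r
    have h4 : ∏ l ∈ range (j + r), (β - ((l : ℝ) + 1) + ((M + j : ℕ) + 1))
        = (∏ l ∈ range j, (β + (M + j : ℕ) - l)) * ∏ l ∈ range r, (β + M - l) := by
      rw [Finset.prod_range_add]
      push_cast
      congr 1 <;> exact Finset.prod_congr rfl fun l _ => by ring
    rw [interpPoly, Nat.add_sub_cancel, Nat.add_sub_cancel_left, h2, h4]
    have e : β + 1 + (-((j + r : ℕ) : ℝ) + j) = β + 1 - r := by push_cast; ring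
    rw [e]
    have hf : (r.factorial : ℝ) ≠ 0 := by positivity
    have hf' : ((j + r).factorial : ℝ) ≠ 0 := by positivity
    have h1' : rise (-((j + r : ℕ) : ℝ)) j = (-1) ^ j * (j + r).factorial / r.factorial := by
      field_simp; linarith
    have hs : (-1 : ℝ) ^ j * (-1) ^ j = 1 := by rw [← mul_pow]; simp
    rw [h1', pow_add]
    field_simp
    generalize (∏ l ∈ range j, (β + (M + j : ℕ) - (l : ℝ))) = P at *
    generalize (∏ l ∈ range r, (β + (M : ℝ) - (l : ℝ))) = Q at *
    linear_combination P * h3 - P * Q * rise (β + 1 - r) M * (-1) ^ r * hs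
  · rw [zero_mul, interpPoly]
    have : rise (-(R : ℝ)) j = 0 :=
      Finset.prod_eq_zero (i := R) (by simpa using hR) (by ring)
    rw [this]; simp

end

/-! ### The correction factors through H(0). -/

section

open Finset (range)
open MeasureTheory

theorem rise_one (N : ℕ) : rise 1 N = N.factorial := by
  rw [rise, ← Finset.prod_range_add_one_eq_factorial]
  push_cast
  exact Finset.prod_congr rfl fun l _ => by ring

theorem factorial_mul_prod_sub (N i : ℕ) (hi : i ≤ N) :
    (N - i).factorial * ∏ j ∈ range i, ((N : ℝ) + 1 - (j + 1)) = N.factorial := by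
  obtain ⟨M, rfl⟩ := Nat.exists_eq_add_of_le' hi
  have h := rise_reverse 0 M i
  rw [zero_add, rise_one, rise_one] at h
  rw [Nat.add_sub_cancel, h]
  congr 1
  exact Finset.prod_congr rfl fun l _ => by ring

/-- Each factor of the product is quadratic in x = 1/n and absorbs one n². This dictates the scaling
t = σ/n² and the conjugation by n^(2i). -/
theorem pow_mul_rowFactor (α β : ℝ) (N i : ℕ) (hi : i ≤ N) :
    ((N : ℝ) + 1) ^ (2 * i) * rowFactor α β ((N : ℝ) + 1)⁻¹ i
      = (-1) ^ i / i.factorial * (N.factorial / (N - i).factorial) *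
        ∏ j ∈ range i, (α + β + (j + 1) + (N + 1)) / (α + (j + 1)) := by
  have h1 : ((N.factorial : ℝ) / (N - i).factorial) = ∏ j ∈ range i, ((N : ℝ) + 1 - (j + 1)) := by
    rw [← factorial_mul_prod_sub N i hi]
    have : ((N - i).factorial : ℝ) ≠ 0 := by positivity
    field_simp
  have h2 : ((N : ℝ) + 1) ^ (2 * i) = ∏ j ∈ range i, ((N : ℝ) + 1) ^ 2 := by simp [pow_mul]
  rw [h1, h2, rowFactor, mul_assoc, ← Finset.prod_mul_distrib, mul_left_comm,
    ← Finset.prod_mul_distrib]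
  congr 1
  refine Finset.prod_congr rfl fun j _ => ?_
  have : (N : ℝ) + 1 ≠ 0 := by positivity
  field_simp
  ring

theorem pow_mul_regFactor (α β : ℝ) (N m : ℕ) :
    ((N : ℝ) + 1) ^ (2 * (m + 1)) * regFactor α β ((N : ℝ) + 1)⁻¹ m
      = 1 / m.factorial * rise (N + 1) (m + 1) *
        ∏ j ∈ range (m + 1), ((α - j) + N + 1 + β) / (α - j) := by
  have h2 : ((N : ℝ) + 1) ^ (2 * (m + 1)) = ∏ j ∈ range (m + 1), ((N : ℝ) + 1) ^ 2 := by
    simp [pow_mul]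
  rw [h2, regFactor, mul_left_comm, ← Finset.prod_mul_distrib, rise, mul_assoc,
    ← Finset.prod_mul_distrib]
  congr 1
  refine Finset.prod_congr rfl fun j _ => ?_
  have : (N : ℝ) + 1 ≠ 0 := by positivity
  rw [mul_div_assoc', mul_div_assoc']
  congr 1
  field_simp
  ring

/-- Interpolation at ζ = α - m: the vector of regular coefficients, indexed by j, becomes an
explicit combination of the columns of H(0), that is, H(0)⁻¹ is applied in closed form. -/
theorem betaSeries_sub_eq_sum {α β : ℝ} (hα : 0 < α) (hβ : 0 < β) (hαZ : ∀ k : ℤ, α ≠ k)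
    {N j : ℕ} (hj : j ≤ N) (m : ℕ) :
    betaSeries β (α + j - m) = ∑ i ∈ range (N + 1), betaSeries β (α + 1 + j + i) *
      (((N : ℝ) + 1) ^ (2 * (m + 1 + i)) * (rowFactor α β ((N : ℝ) + 1)⁻¹ i *
        regFactor α β ((N : ℝ) + 1)⁻¹ m / (m + 1 + i))) := by
  have hz : ∀ r : ℕ, α - m + r ≠ 0 := fun r h => hαZ (m - r) (by push_cast; linarith)
  have hm : (0 : ℝ) ≤ m := by positivity
  rw [show α + j - m = α - m + j by ring, betaSeries_eq_interpConst_mul hβ hz hj,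
    interpPoly_lagrange (α := α) hj (by linarith), Finset.mul_sum]
  refine Finset.sum_congr rfl fun i hi => ?_
  have hiN : i ≤ N := by simpa [Nat.lt_succ_iff] using hi
  have e1 := betaSeries_eq_interpConst_mul hβ (ζ := α + 1 + i) (fun r => by positivity) hj
  have e2 := interpConst_sub hβ hαZ N m
  have e3 := interpConst_add hα hβ N i
  have e4 := pow_mul_rowFactor α β N i hiN
  have e5 := pow_mul_regFactor α β N m
  have e6 : rise ((m : ℝ) + 1) (N + 1) * m.factorial = N.factorial * rise (N + 1) (m + 1) := by
    have h1 := rise_add 1 m (N + 1)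
    have h2 := rise_add 1 N (m + 1)
    rw [show N + (m + 1) = m + (N + 1) by ring, h1, rise_one, rise_one,
      add_comm (1 : ℝ), add_comm (1 : ℝ)] at h2
    linarith
  have hmf : (m.factorial : ℝ) ≠ 0 := by positivity
  have e7 : rise ((m : ℝ) + 1) (N + 1) = N.factorial * rise (N + 1) (m + 1) / m.factorial := by
    rw [← e6]; field_simp
  have e8 : ((N : ℝ) + 1) ^ (2 * (m + 1 + i)) * (rowFactor α β ((N : ℝ) + 1)⁻¹ i *
        regFactor α β ((N : ℝ) + 1)⁻¹ m / (m + 1 + i))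
      = (((N : ℝ) + 1) ^ (2 * i) * rowFactor α β ((N : ℝ) + 1)⁻¹ i) *
        (((N : ℝ) + 1) ^ (2 * (m + 1)) * regFactor α β ((N : ℝ) + 1)⁻¹ m) / (m + 1 + i) := by
    rw [mul_add, pow_add]; ring
  rw [show α + 1 + j + i = α + 1 + i + j by ring, e1, e8, e4, e5, e2, e3,
    show α + 1 - (α - m) = m + 1 by ring, e7]
  have : (m : ℝ) + 1 + i ≠ 0 := by positivity
  generalize (∏ j ∈ range i, (α + β + ((j : ℝ) + 1) + (N + 1)) / (α + (j + 1))) = P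
  generalize (∏ j ∈ range (m + 1), ((α - (j : ℝ)) + N + 1 + β) / (α - j)) = Q
  field_simp

theorem pow_mul_singFactor {α : ℝ} (hα : 0 < α) (β : ℝ) (N R : ℕ) :
    ((N : ℝ) + 1) ^ (2 * R) * singFactor α β ((N : ℝ) + 1)⁻¹ R * rise (α + 1) R ^ 2
      = Real.Gamma (-α) / R.factorial * (∏ l ∈ range R, (β - (l + 1) + (N + 1))) *
        rise (α + 1 + (N + 1)) R := by
  have h2 : ((N : ℝ) + 1) ^ (2 * R) = ∏ j ∈ range R, ((N : ℝ) + 1) ^ 2 := by simp [pow_mul]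
  rw [h2, singFactor, mul_left_comm, ← Finset.prod_mul_distrib, rise, rise, ← Finset.prod_pow,
    mul_assoc, mul_assoc, ← Finset.prod_mul_distrib, ← Finset.prod_mul_distrib]
  congr 1
  refine Finset.prod_congr rfl fun j _ => ?_
  have : (N : ℝ) + 1 ≠ 0 := by positivity
  have : α + (j + 1) ≠ 0 := by positivity
  field_simp
  ring

theorem Gamma_sub_nat_mul_rise {α : ℝ} (hαZ : ∀ k : ℤ, α ≠ k) (R : ℕ) :
    Real.Gamma (-α - R) * rise (α + 1) R = (-1) ^ R * Real.Gamma (-α) := by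
  induction R with
  | zero => simp [rise_zero]
  | succ R ih =>
    have h := Real.Gamma_add_one (s := -α - (R + 1 : ℕ))
      (fun h => hαZ (-(R + 1 : ℕ)) (by push_cast at h ⊢; linarith))
    rw [show -α - (R + 1 : ℕ) + 1 = -α - R by push_cast; ring] at h
    rw [rise_succ, pow_succ]
    push_cast at h ⊢
    linear_combination -ih + rise (α + 1) R * h

/-- The constant in front of the singular part of the `(N + 1) × (N + 1)` matrix. -/
noncomputable def singConst (α β : ℝ) (N : ℕ) : ℝ :=
  rise (α + 1) (N + 1) / (rise (β + 1) N * interpConst β N (α + 1) * N.factorial)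

/-- The same inversion at ζ = -R, for the coefficients of t^(α+1+k+R). -/
theorem binomCoeff_mul_Gamma_eq_sum {α β : ℝ} (hα : 0 < α) (hβ : 0 < β) (hαZ : ∀ k : ℤ, α ≠ k)
    {N j : ℕ} (hj : j ≤ N) (R : ℕ) :
    Real.Gamma (-α - R) * (if j ≤ R then binomCoeff β (R - j) else 0)
      = ∑ i ∈ range (N + 1), betaSeries β (α + 1 + j + i) *
      (((N : ℝ) + 1) ^ (2 * (R + i)) * (singConst α β N * (rowFactor α β ((N : ℝ) + 1)⁻¹ i *
        singFactor α β ((N : ℝ) + 1)⁻¹ R / (i + R + 1 + α)))) := by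
  have hR : (0 : ℝ) ≤ R := by positivity
  have hb := binomCoeff_eq_interpPoly (β := β) hj R
  have hr0 := rise_pos (show 0 < β + 1 by linarith) N
  rw [interpPoly_lagrange (α := α) hj (show -(R : ℝ) < α + 1 by linarith), Finset.sum_mul] at hb
  rw [← mul_right_cancel_iff_of_pos hr0, mul_assoc, hb, Finset.mul_sum, Finset.sum_mul]
  refine Finset.sum_congr rfl fun i hi => ?_
  have hiN : i ≤ N := by simpa [Nat.lt_succ_iff] using hi
  have e1 := betaSeries_eq_interpConst_mul hβ (ζ := α + 1 + i) (fun r => by positivity) hj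
  have e3 := interpConst_add hα hβ N i
  have e4 := pow_mul_rowFactor α β N i hiN
  have e5 := pow_mul_singFactor hα β N R
  have e6 := Gamma_sub_nat_mul_rise hαZ R
  have hra := rise_pos (show 0 < α + 1 by linarith) R
  have e7 : rise (α + 1) R * rise (α + 1 + R) (N + 1)
      = rise (α + 1) (N + 1) * rise (α + 1 + (N + 1)) R := by
    have h1 := rise_add (α + 1) R (N + 1)
    have h2 := rise_add (α + 1) (N + 1) R
    rw [add_comm R, h2] at h1
    push_cast at h1
    exact h1.symm
  have e8 : ((N : ℝ) + 1) ^ (2 * (R + i)) * (singConst α β N * (rowFactor α β ((N : ℝ) + 1)⁻¹ i *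
        singFactor α β ((N : ℝ) + 1)⁻¹ R / (i + R + 1 + α)))
      = singConst α β N * (((N : ℝ) + 1) ^ (2 * i) * rowFactor α β ((N : ℝ) + 1)⁻¹ i) *
        (((N : ℝ) + 1) ^ (2 * R) * singFactor α β ((N : ℝ) + 1)⁻¹ R) / (i + R + 1 + α) := by
    rw [mul_add, pow_add]; ring
  have hκ := interpConst_pos hβ (z := α + 1 + i) (by linarith [Nat.cast_nonneg (α := ℝ) i]) N
  have hP : 0 < ∏ j ∈ range i, (α + β + ((j : ℝ) + 1) + (N + 1)) / (α + (j + 1)) :=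
    Finset.prod_pos fun j _ => by positivity
  have e5' : ((N : ℝ) + 1) ^ (2 * R) * singFactor α β ((N : ℝ) + 1)⁻¹ R
      = Real.Gamma (-α) / R.factorial * (∏ l ∈ range R, (β - (l + 1) + (N + 1))) *
        rise (α + 1 + (N + 1)) R / rise (α + 1) R ^ 2 := by
    rw [← e5]; field_simp
  have e6' : Real.Gamma (-α - R) = (-1) ^ R * Real.Gamma (-α) / rise (α + 1) R := by
    rw [← e6]; field_simp
  have e7' : rise (α + 1 + R) (N + 1)
      = rise (α + 1) (N + 1) * rise (α + 1 + (N + 1)) R / rise (α + 1) R := by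
    rw [← e7]; field_simp
  have hs : (-1 : ℝ) ^ R * (-1) ^ R = 1 := by rw [← mul_pow]; simp
  rw [show α + 1 + j + i = α + 1 + i + j by ring, e1, e8, e4, e5', e6', singConst, e3,
    show α + 1 - -(R : ℝ) = α + 1 + R by ring, e7']
  generalize (∏ j ∈ range i, (α + β + ((j : ℝ) + 1) + (N + 1)) / (α + (j + 1))) = P at *
  generalize (∏ l ∈ range R, (β - ((l : ℝ) + 1) + (N + 1))) = Q
  have h1 : α + 1 + R + i ≠ 0 := by positivity
  have h2 : (i : ℝ) + R + 1 + α ≠ 0 := by positivity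
  field_simp
  rw [sq, hs]
  ring

theorem summable_coeff_mul_pow {α β x : ℝ} (hα : 0 < α) (hβ : 0 < β) (hαZ : ∀ k : ℤ, α ≠ k)
    (hx : IsScale x) (σ : ℝ) (i k : ℕ) :
    (Summable fun m => regCoeff α β x i k m * σ ^ (k + m + 1)) ∧
    (Summable fun m => singCoeff α β x i k m * σ ^ (k + m)) := by
  obtain ⟨c, C, K, hc, hC, hK, h⟩ := exists_coeff_bound hα hβ hαZ
  have hs := (Real.summable_pow_div_factorial (K * |σ|)).mul_left
    (C * (c ^ i / i.factorial) * (1 / k.factorial))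
  constructor
  · refine .of_norm_bounded (hs.mul_right (|σ| ^ (k + 1))) fun m => ?_
    rw [norm_mul, norm_pow, Real.norm_eq_abs, Real.norm_eq_abs]
    calc _ ≤ C * (c ^ i / i.factorial) * (1 / k.factorial) * (K ^ m / m.factorial) *
          |σ| ^ (k + m + 1) := by gcongr; exact (h x hx i k m).1
      _ = _ := by rw [mul_pow, show k + m + 1 = m + (k + 1) by ring, pow_add]; ring
  · refine .of_norm_bounded (hs.mul_right (|σ| ^ k)) fun m => ?_
    rw [norm_mul, norm_pow, Real.norm_eq_abs, Real.norm_eq_abs]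
    calc _ ≤ C * (c ^ i / i.factorial) * (1 / k.factorial) * (K ^ m / m.factorial) *
          |σ| ^ (k + m) := by gcongr; exact (h x hx i k m).2
      _ = _ := by rw [mul_pow, add_comm k m, pow_add]; ring

/-- The divisor is the power of n left over from t^(α+1) = (σ/n²)^(α+1). -/
noncomputable def scaleConst (α β : ℝ) (N : ℕ) : ℝ :=
  singConst α β N / ((N : ℝ) + 1) ^ (2 * (α + 1))

/-- The truncated moments factor through the Hankel matrix at `t = 0`. -/
theorem integral_truncExp_eq_sum {α β σ : ℝ} (hα : 0 < α) (hβ : 0 < β) (hαZ : ∀ k : ℤ, α ≠ k)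
    (hσ : 0 < σ) {N j : ℕ} (hj : j ≤ N) (k : ℕ) :
    (∫ x in (0 : ℝ)..1, x ^ (α + j + k) * (1 - x) ^ β * truncExp k (σ / ((N : ℝ) + 1) ^ 2 / x))
      = betaSeries β (α + 1 + j + k) - ∑ i ∈ range (N + 1), betaSeries β (α + 1 + j + i) *
        (((N : ℝ) + 1) ^ (2 * i) / ((N : ℝ) + 1) ^ (2 * k) *
          (∑' m, regCoeff α β ((N : ℝ) + 1)⁻¹ i k m * σ ^ (k + m + 1) +
            scaleConst α β N * σ ^ (α + 1) *
              ∑' m, singCoeff α β ((N : ℝ) + 1)⁻¹ i k m * σ ^ (k + m))) := by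
  have hν : (0 : ℝ) < N + 1 := by positivity
  set ν : ℝ := N + 1 with hνd
  have hx : IsScale ν⁻¹ := Or.inr ⟨N, rfl⟩
  have ht : 0 < σ / ν ^ 2 := by positivity
  have hkf : (k.factorial : ℝ) ≠ 0 := by positivity
  obtain ⟨A, B, hA, hB, hI⟩ := exists_hasSum_integral_truncExp hα hβ hαZ ht j k
  have hsm := fun i => summable_coeff_mul_pow hα hβ hαZ hx σ i k
  have hA' : HasSum (fun m : ℕ => (-1) ^ m * (σ / ν ^ 2) ^ (k + m + 1) /
        (m.factorial * (k + m + 1)) * betaSeries β (α + j - m))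
      (∑ i ∈ range (N + 1), betaSeries β (α + 1 + j + i) *
        (k.factorial * (ν ^ (2 * i) / ν ^ (2 * k)) *
          ∑' m, regCoeff α β ν⁻¹ i k m * σ ^ (k + m + 1))) := by
    have h := hasSum_sum (s := range (N + 1)) fun i _ => ((hsm i).1.hasSum.mul_left
      (k.factorial * (ν ^ (2 * i) / ν ^ (2 * k)))).mul_left (betaSeries β (α + 1 + j + i))
    convert! h using 2 with m
    rw [betaSeries_sub_eq_sum hα hβ hαZ hj m, Finset.mul_sum]
    refine Finset.sum_congr rfl fun i _ => ?_
    rw [regCoeff, div_pow, ← pow_mul, ← hνd]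
    have e : ν ^ (2 * (k + m + 1)) = ν ^ (2 * k) * ν ^ (2 * (m + 1)) := by rw [← pow_add]; ring_nf
    have e' : ν ^ (2 * (m + 1 + i)) = ν ^ (2 * i) * ν ^ (2 * (m + 1)) := by rw [← pow_add]; ring_nf
    have h1 : (k : ℝ) + m + 1 ≠ 0 := by positivity
    have h2 : (m : ℝ) + 1 + i ≠ 0 := by positivity
    rw [e, e']
    field_simp
  have hB' : HasSum (fun R : ℕ => (σ / ν ^ 2) ^ (α + 1 + k + R) * Real.Gamma (-α - R) /
        (α + k + R + 1) * (if j ≤ R then binomCoeff β (R - j) else 0))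
      (∑ i ∈ range (N + 1), betaSeries β (α + 1 + j + i) *
        (k.factorial * (ν ^ (2 * i) / ν ^ (2 * k)) * (scaleConst α β N * σ ^ (α + 1)) *
          ∑' m, singCoeff α β ν⁻¹ i k m * σ ^ (k + m))) := by
    have h := hasSum_sum (s := range (N + 1)) fun i _ => ((hsm i).2.hasSum.mul_left
      (k.factorial * (ν ^ (2 * i) / ν ^ (2 * k)) * (scaleConst α β N * σ ^ (α + 1)))).mul_left
        (betaSeries β (α + 1 + j + i))
    convert! h using 2 with R
    rw [mul_div_right_comm, mul_assoc, binomCoeff_mul_Gamma_eq_sum hα hβ hαZ hj R,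
      Finset.mul_sum]
    refine Finset.sum_congr rfl fun i _ => ?_
    have e : (σ / ν ^ 2) ^ (α + 1 + k + R) = σ ^ (α + 1) * σ ^ (k + R) /
        (ν ^ (2 * (α + 1)) * ν ^ (2 * k) * ν ^ (2 * R)) := by
      rw [add_assoc (α + 1), ← Nat.cast_add, Real.rpow_add_natCast ht.ne', div_pow,
        Real.div_rpow hσ.le (by positivity), ← Real.rpow_natCast ν 2, ← Real.rpow_mul hν.le,
        Real.rpow_natCast, ← pow_mul, mul_add 2 k R, pow_add ν]
      push_cast
      field_simp
    have e' : ν ^ (2 * (R + i)) = ν ^ (2 * R) * ν ^ (2 * i) := by rw [← pow_add, mul_add]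
    have h1 : (i : ℝ) + R + 1 + α ≠ 0 := by positivity
    have h2 : (k : ℝ) + R + 1 + α ≠ 0 := by positivity
    have h3 : α + k + R + 1 ≠ 0 := by positivity
    rw [e, e', scaleConst, singCoeff, ← hνd]
    field_simp
    ring
  have e1 := hA.unique hA'
  have e2 := hB.unique hB'
  rw [hI, e1, e2, ← Finset.sum_add_distrib, Finset.sum_div]
  congr 1
  refine Finset.sum_congr rfl fun i _ => ?_
  field_simp

end

/-! ### The limit of the singular constant; positivity and log-convexity of Hankel determinants. -/

section

open Finset (range)
open MeasureTheory Matrix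

/-- The rising factorials and powers of n assemble into Euler's sequences for Γ(α+1), Γ(β+1) and
Γ(α+β+2), times two factors tending to 1. The value B(α+1, β+1) cancels all but Γ(α+1)⁻². -/
theorem tendsto_scaleConst {α β : ℝ} (hα : 0 < α) (hβ : 0 < β) :
    Tendsto (scaleConst α β) atTop (𝓝 (1 / Real.Gamma (α + 1) ^ 2)) := by
  have hT := betaSeries_pos hβ (show 1 ≤ α + 1 by linarith)
  have hTe := betaSeries_eq_Gamma hβ (show 1 ≤ α + 1 by linarith)
  have hg1 := Real.Gamma_pos_of_pos (show 0 < α + 1 by linarith)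
  have hg2 := Real.Gamma_pos_of_pos (show 0 < β + 1 by linarith)
  have hg3 := Real.Gamma_pos_of_pos (show 0 < α + 1 + (β + 1) by linarith)
  have hlim : Tendsto (fun N : ℕ => ((N : ℝ) / (N + 1)) ^ (2 * (α + 1)) *
      ((β + 1 + N) / (α + β + 2 + N)) * (Real.GammaSeq (β + 1) N / (Real.GammaSeq (α + 1) N *
        Real.GammaSeq (α + 1 + (β + 1)) N * betaSeries β (α + 1)))) atTop
      (𝓝 (1 / Real.Gamma (α + 1) ^ 2)) := by
    have h1 : Tendsto (fun N : ℕ => (N : ℝ) / (N + 1)) atTop (𝓝 1) :=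
      tendsto_natCast_div_add_atTop 1
    have h2 : Tendsto (fun N : ℕ => (β + 1 + N) / (α + β + 2 + N)) atTop (𝓝 1) := by
      have ha := (tendsto_const_div_atTop_nhds_zero_nat (β + 1)).add_const 1
      have hb := (tendsto_const_div_atTop_nhds_zero_nat (α + β + 2)).add_const 1
      have := ha.div hb (by norm_num)
      rw [zero_add, div_one] at this
      refine this.congr' ?_
      filter_upwards [eventually_gt_atTop 0] with N hN
      have : (0 : ℝ) < N := by exact_mod_cast hN
      simp only [Pi.div_apply]
      field_simp
    have h3 := (Real.GammaSeq_tendsto_Gamma (β + 1)).div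
      (((Real.GammaSeq_tendsto_Gamma (α + 1)).mul
        (Real.GammaSeq_tendsto_Gamma (α + 1 + (β + 1)))).mul_const (betaSeries β (α + 1)))
      (by positivity)
    have h := ((h1.rpow_const (p := 2 * (α + 1)) (Or.inl one_ne_zero)).mul h2).mul h3
    convert! h using 2
    rw [hTe, Real.one_rpow]
    field_simp
  refine hlim.congr' ?_
  filter_upwards [eventually_gt_atTop 0] with N hN
  have hN0 : (0 : ℝ) < N := by exact_mod_cast hN
  have hseq : ∀ z : ℝ, 0 < z → Real.GammaSeq z N = (N : ℝ) ^ z * N.factorial / rise z (N + 1) :=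
    fun z _ => rfl
  have hb := rise_mul_betaSeries hβ (z := α + 1) (fun r => by positivity) N
  have hTN := betaSeries_pos hβ (show 1 ≤ α + 1 + N by linarith)
  have p1 := rise_pos (show 0 < α + 1 by linarith) N
  have p2 := rise_pos (show 0 < β + 1 by linarith) N
  have p3 := rise_pos (show 0 < β + 1 + (α + 1) by linarith) N
  have p4 := rise_pos (show 0 < α + 1 by linarith) (N + 1)
  rw [hseq _ (by linarith), hseq _ (by linarith), hseq _ (by linarith), scaleConst, singConst,
    interpConst, add_comm (α + 1) (β + 1)]
  have hb' : betaSeries β (α + 1 + N)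
      = rise (α + 1) N * betaSeries β (α + 1) / rise (β + 1 + (α + 1)) N := by
    rw [hb]; field_simp
  rw [hb', rise_succ (β + 1), rise_succ (β + 1 + (α + 1)), Real.div_rpow hN0.le (by positivity)]
  have hp : (N : ℝ) ^ (2 * (α + 1)) = (N : ℝ) ^ (α + 1) * (N : ℝ) ^ (β + 1 + (α + 1))
      / (N : ℝ) ^ (β + 1) := by
    rw [← Real.rpow_add hN0, ← Real.rpow_sub hN0]; congr 1; ring
  rw [hp, show α + β + 2 + (N : ℝ) = β + 1 + (α + 1) + N by ring]
  field_simp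

section Weight

variable {t α β : ℝ}

theorem pjWeight_pos {x : ℝ} (hx : x ∈ Set.Ioo (0 : ℝ) 1) : 0 < pjWeight t α β x := by
  have h1 := hx.1
  have h2 : 0 < 1 - x := by linarith [hx.2]
  unfold pjWeight
  positivity

theorem intervalIntegrable_pjWeight (ht : 0 ≤ t) (hα : 0 < α) (hβ : 0 < β) :
    IntervalIntegrable (pjWeight t α β) volume 0 1 := by
  have h1 : IntervalIntegrable (fun _ : ℝ => (1 : ℝ)) volume 0 1 := by simp
  refine h1.mono_fun ?_ ?_
  · exact (Measurable.aestronglyMeasurable (by unfold pjWeight; fun_prop))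
  · filter_upwards [ae_restrict_mem measurableSet_uIoc] with x hx
    rw [Set.uIoc_of_le zero_le_one] at hx
    have h2 : 0 ≤ 1 - x := by linarith [hx.2]
    have h3 := hx.1
    rw [norm_one, pjWeight, norm_mul, norm_mul, Real.norm_of_nonneg (Real.rpow_nonneg h3.le _),
      Real.norm_of_nonneg (Real.rpow_nonneg h2 _), Real.norm_of_nonneg (Real.exp_pos _).le]
    refine mul_le_one₀ (mul_le_one₀ (Real.rpow_le_one h3.le hx.2 hα.le) (Real.rpow_nonneg h2 _)
      (Real.rpow_le_one h2 (by linarith) hβ.le)) (Real.exp_pos _).le (Real.exp_le_one_iff.2 ?_)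
    exact div_nonpos_of_nonpos_of_nonneg (by linarith) h3.le

theorem intervalIntegrable_mul_pjWeight (ht : 0 ≤ t) (hα : 0 < α) (hβ : 0 < β) {f : ℝ → ℝ}
    (hf : Continuous f) : IntervalIntegrable (fun x => f x * pjWeight t α β x) volume 0 1 :=
  (intervalIntegrable_pjWeight ht hα hβ).continuousOn_mul hf.continuousOn

/-- The Hankel matrix of the moments. -/
noncomputable def hankelMatrix (n : ℕ) (t α β : ℝ) : Matrix (Fin n) (Fin n) ℝ :=
  Matrix.of fun j k : Fin n => ∫ x in (0 : ℝ)..1, x ^ ((j : ℕ) + (k : ℕ)) * pjWeight t α β x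

theorem hankelMatrix_isHermitian (n : ℕ) : (hankelMatrix n t α β).IsHermitian := by
  ext j k
  simp [hankelMatrix, add_comm]

theorem dotProduct_hankelMatrix_mulVec (ht : 0 ≤ t) (hα : 0 < α) (hβ : 0 < β) {n : ℕ}
    (u v : Fin n → ℝ) :
    u ⬝ᵥ (hankelMatrix n t α β *ᵥ v) = ∫ x in (0 : ℝ)..1,
      (∑ j, u j * x ^ (j : ℕ)) * (∑ k, v k * x ^ (k : ℕ)) * pjWeight t α β x := by
  have h : ∀ x : ℝ, (∑ j, u j * x ^ (j : ℕ)) * (∑ k, v k * x ^ (k : ℕ)) * pjWeight t α β x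
      = ∑ j : Fin n, ∑ k : Fin n, u j * (x ^ ((j : ℕ) + (k : ℕ)) * pjWeight t α β x * v k) := by
    intro x
    rw [Finset.sum_mul_sum, Finset.sum_mul]
    refine Finset.sum_congr rfl fun j _ => ?_
    rw [Finset.sum_mul]
    refine Finset.sum_congr rfl fun k _ => ?_
    rw [pow_add]; ring
  simp_rw [h]
  have hi : ∀ j k : Fin n, IntervalIntegrable
      (fun x => u j * (x ^ ((j : ℕ) + (k : ℕ)) * pjWeight t α β x * v k)) volume 0 1 :=
    fun j k => ((intervalIntegrable_mul_pjWeight ht hα hβ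
      (continuous_pow ((j : ℕ) + (k : ℕ)))).mul_const _).const_mul _
  have hs : ∀ j : Fin n, IntervalIntegrable
      (fun x => ∑ k : Fin n, u j * (x ^ ((j : ℕ) + (k : ℕ)) * pjWeight t α β x * v k))
      volume 0 1 := fun j => by
    have := IntervalIntegrable.sum Finset.univ fun k _ => hi j k
    convert! this using 1
    ext x
    simp
  rw [intervalIntegral.integral_finsetSum fun j _ => hs j]
  simp only [dotProduct, mulVec, Finset.mul_sum]
  refine Finset.sum_congr rfl fun j _ => ?_
  rw [intervalIntegral.integral_finsetSum fun k _ => hi j k]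
  refine Finset.sum_congr rfl fun k _ => ?_
  rw [intervalIntegral.integral_const_mul, intervalIntegral.integral_mul_const]
  rfl

theorem hankelMatrix_posDef (ht : 0 ≤ t) (hα : 0 < α) (hβ : 0 < β) (n : ℕ) :
    (hankelMatrix n t α β).PosDef := by
  refine .of_dotProduct_mulVec_pos (hankelMatrix_isHermitian n) fun u hu => ?_
  rw [star_trivial, dotProduct_hankelMatrix_mulVec ht hα hβ]
  set p : Polynomial ℝ := ∑ j : Fin n, Polynomial.monomial (j : ℕ) (u j) with hp
  have hpe : ∀ x, p.eval x = ∑ j, u j * x ^ (j : ℕ) := by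
    intro x
    simp [hp, Polynomial.eval_finsetSum]
  have hp0 : p ≠ 0 := by
    obtain ⟨i, hi⟩ := Function.ne_iff.1 hu
    intro h
    apply hi
    have := congrArg (fun q => q.coeff (i : ℕ)) h
    simpa [hp, Polynomial.finsetSum_coeff, Polynomial.coeff_monomial, Fin.val_inj] using this
  simp_rw [← hpe]
  have hint := intervalIntegrable_mul_pjWeight ht hα hβ (p.continuous.mul p.continuous)
  simp only [Pi.mul_apply] at hint
  rw [intervalIntegral.integral_pos_iff_support_of_nonneg_ae' ?_ hint]
  · refine ⟨one_pos, ?_⟩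
    have hfin : (p.roots.toFinset : Set ℝ).Finite := Finset.finite_toSet _
    have hsub : Set.Ioo (0 : ℝ) 1 \ p.roots.toFinset ⊆
        Function.support (fun x => p.eval x * p.eval x * pjWeight t α β x) ∩ Set.Ioc 0 1 := by
      intro x hx
      refine ⟨?_, Set.Ioo_subset_Ioc_self hx.1⟩
      have hx2 : p.eval x ≠ 0 := by
        have := hx.2
        simpa [hp0, Polynomial.IsRoot] using this
      exact mul_ne_zero (mul_ne_zero hx2 hx2) (pjWeight_pos hx.1).ne'
    refine lt_of_lt_of_le ?_ (measure_mono hsub)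
    rw [measure_sdiff_null (hfin.measure_zero _)]
    simp
  · have h1 : ∀ᵐ x : ℝ, x ≠ 1 := by simp [ae_iff, measure_singleton]
    rw [Filter.EventuallyLE, ae_restrict_iff' measurableSet_uIoc]
    filter_upwards [h1] with x hx1 hx
    rw [Set.uIoc_of_le zero_le_one] at hx
    exact mul_nonneg (mul_self_nonneg _) (pjWeight_pos ⟨hx.1, lt_of_le_of_ne hx.2 hx1⟩).le

theorem hankelDet_pos (ht : 0 ≤ t) (hα : 0 < α) (hβ : 0 < β) (n : ℕ) : 0 < hankelDet n t α β :=
  (hankelMatrix_posDef ht hα hβ n).det_pos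

theorem Matrix.PosSemidef.one_le_det_one_add {ι : Type*} [Fintype ι] [DecidableEq ι]
    {X : Matrix ι ι ℝ} (hX : X.PosSemidef) : 1 ≤ (1 + X).det := by
  have hH : (1 + X).IsHermitian := Matrix.isHermitian_one.add hX.1
  rw [hH.det_eq_prod_eigenvalues]
  simp only [RCLike.ofReal_real_eq_id, id]
  refine Finset.one_le_prod fun i => ?_
  rw [hH.eigenvalues_eq]
  have h1 := hX.dotProduct_mulVec_nonneg (⇑(hH.eigenvectorBasis i))
  have h2 : star (⇑(hH.eigenvectorBasis i)) ⬝ᵥ ⇑(hH.eigenvectorBasis i) = 1 := by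
    have := (hH.eigenvectorBasis.orthonormal.1 i)
    have h3 := EuclideanSpace.inner_eq_star_dotProduct (𝕜 := ℝ) (hH.eigenvectorBasis i)
      (hH.eigenvectorBasis i)
    rw [real_inner_self_eq_norm_sq, this, one_pow] at h3
    rw [dotProduct_comm]; exact h3.symm
  rw [add_mulVec, one_mulVec, dotProduct_add, h2]
  simpa using h1

-- With A = CᴴC one has B = Cᴴ(1 + X)C for a positive semidefinite X, and det(1 + X) ≥ 1.
open scoped MatrixOrder in
theorem Matrix.PosDef.det_le_det {ι : Type*} [Fintype ι] [DecidableEq ι]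
    {A B : Matrix ι ι ℝ} (hA : A.PosDef) (hAB : (B - A).PosSemidef) : A.det ≤ B.det := by
  obtain ⟨C, hC⟩ := CStarAlgebra.nonneg_iff_eq_star_mul_self.mp hA.posSemidef.nonneg
  rw [star_eq_conjTranspose] at hC
  have hdet : A.det = C.det * C.det := by rw [hC, det_mul, det_conjTranspose, star_trivial]
  have hC0 : IsUnit C.det := by
    rw [isUnit_iff_ne_zero]
    intro h
    have := hA.det_pos
    rw [hdet, h] at this
    simp at this
  have hX := hAB.conjTranspose_mul_mul_same C⁻¹
  have hB : B = Cᴴ * (1 + C⁻¹ᴴ * (B - A) * C⁻¹) * C := by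
    have h1 : Cᴴ * C⁻¹ᴴ = 1 := by
      rw [← conjTranspose_mul, nonsing_inv_mul _ hC0, conjTranspose_one]
    have h2 : C⁻¹ * C = 1 := nonsing_inv_mul _ hC0
    calc B = A + (B - A) := by abel
      _ = Cᴴ * C + (Cᴴ * C⁻¹ᴴ) * (B - A) * (C⁻¹ * C) := by rw [h1, h2, ← hC]; simp
      _ = _ := by noncomm_ring
  have h3 := hX.one_le_det_one_add
  rw [hdet, hB, det_mul, det_mul, det_conjTranspose, star_trivial]
  nlinarith [mul_self_nonneg C.det]

/-- Log-convexity of the Hankel determinant. -/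
theorem hankelDet_sq_le (ht : 0 ≤ t) (hα : 0 < α) (hβ : 0 < β) (n : ℕ) :
    hankelDet n t α β ^ 2 ≤ hankelDet n 0 α β * hankelDet n (2 * t) α β := by
  set A := hankelMatrix n 0 α β with hA
  set B := hankelMatrix n t α β with hB
  set C := hankelMatrix n (2 * t) α β with hC
  have pA : A.PosDef := hankelMatrix_posDef le_rfl hα hβ n
  have pB : B.PosDef := hankelMatrix_posDef ht hα hβ n
  have hBH : Bᴴ = B := pB.1
  have hAH : A.IsHermitian := pA.1
  have uA : IsUnit A.det := isUnit_iff_ne_zero.2 pA.det_pos.ne'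
  have uB : IsUnit B := pB.isUnit
  have p1 : (B * A⁻¹ * B).PosDef := by
    have := pA.inv.conjTranspose_mul_mul_same (B := B) (mulVec_injective_iff_isUnit.2 uB)
    rwa [hBH] at this
  -- Schur complement of the block matrix with rows (A, B) and (B, C). The weights at 0, t, 2t are
  -- w, ew, e²w with e = e^(-t/x), so the block form is the integral of (p + eq)² w; u is its
  -- minimizer for given v.
  have p2 : (C - B * A⁻¹ * B).PosSemidef := by
    refine .of_dotProduct_mulVec_nonneg
      ((hankelMatrix_isHermitian n).sub p1.1) fun v => ?_
    set u := -(A⁻¹ *ᵥ (B *ᵥ v)) with hu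
    have hAu : A *ᵥ u = -(B *ᵥ v) := by
      rw [hu, mulVec_neg, mulVec_mulVec, mul_nonsing_inv _ uA, one_mulVec]
    have e1 : star v ⬝ᵥ ((C - B * A⁻¹ * B) *ᵥ v)
        = u ⬝ᵥ (A *ᵥ u) + 2 * (u ⬝ᵥ (B *ᵥ v)) + v ⬝ᵥ (C *ᵥ v) := by
      have e2 : v ⬝ᵥ (B *ᵥ u) = u ⬝ᵥ (B *ᵥ v) := by
        rw [dotProduct_mulVec, dotProduct_comm, ← mulVec_transpose]
        congr 2
      have e3 : v ⬝ᵥ ((B * A⁻¹ * B) *ᵥ v) = -(v ⬝ᵥ (B *ᵥ u)) := by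
        rw [hu, mulVec_neg, dotProduct_neg, neg_neg, mulVec_mulVec, mulVec_mulVec, mul_assoc]
      rw [star_trivial, sub_mulVec, dotProduct_sub, e3, hAu, e2, dotProduct_neg]
      ring
    rw [e1, dotProduct_hankelMatrix_mulVec le_rfl hα hβ, dotProduct_hankelMatrix_mulVec ht hα hβ,
      dotProduct_hankelMatrix_mulVec (by linarith) hα hβ]
    have hc : ∀ w : Fin n → ℝ, Continuous fun x : ℝ => ∑ j, w j * x ^ (j : ℕ) := fun w => by
      fun_prop
    have i1 := intervalIntegrable_mul_pjWeight (t := 0) le_rfl hα hβ ((hc u).mul (hc u))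
    have i2 := (intervalIntegrable_mul_pjWeight ht hα hβ ((hc u).mul (hc v))).const_mul 2
    have i3 := intervalIntegrable_mul_pjWeight (t := 2 * t) (by linarith) hα hβ
      ((hc v).mul (hc v))
    simp only [Pi.mul_apply] at i1 i2 i3
    rw [← intervalIntegral.integral_const_mul, ← intervalIntegral.integral_add i1 i2,
      ← intervalIntegral.integral_add (i1.add i2) i3]
    refine intervalIntegral.integral_nonneg zero_le_one fun x hx => ?_
    have hw : 0 ≤ x ^ α * (1 - x) ^ β :=
      mul_nonneg (Real.rpow_nonneg hx.1 _) (Real.rpow_nonneg (by linarith [hx.2]) _)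
    have hexp : Real.exp (-(2 * t) / x) = Real.exp (-t / x) ^ 2 := by
      rw [← Real.exp_nat_mul]; congr 1; push_cast; ring
    simp only [pjWeight, hexp, neg_zero, zero_div, Real.exp_zero, mul_one]
    have := mul_nonneg hw (sq_nonneg ((∑ j, u j * x ^ (j : ℕ)) +
      Real.exp (-t / x) * ∑ j, v j * x ^ (j : ℕ)))
    nlinarith [this]
  have h := p1.det_le_det p2
  rw [det_mul, det_mul, det_nonsing_inv, Ring.inverse_eq_inv'] at h
  change B.det ^ 2 ≤ A.det * C.det
  have pos := pA.det_pos
  rw [mul_right_comm, ← sq, ← div_eq_mul_inv, div_le_iff₀ pos] at h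
  linarith

end Weight

end

/-! ### The determinant ratio as det(1 + M). -/

section

open Finset (range)
open MeasureTheory Matrix

/-- The entries of the perturbation, for real arguments. -/
noncomputable def realEntry (α β x c σ : ℝ) (i k : ℕ) : ℝ :=
  -(∑' m, regCoeff α β x i k m * σ ^ (k + m + 1) +
    c * σ ^ (α + 1) * ∑' m, singCoeff α β x i k m * σ ^ (k + m))

theorem hankelMatrix_zero_apply {α β : ℝ} (hα : 0 < α) (hβ : 0 < β) {n : ℕ} (j k : Fin n) :
    hankelMatrix n 0 α β j k = betaSeries β (α + 1 + j + k) := by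
  rw [show α + 1 + j + k = α + j + k + 1 by ring,
    ← integral_rpow_mul_one_sub_rpow (by positivity) hβ]
  refine intervalIntegral.integral_congr_ae (.of_forall fun x hx => ?_)
  rw [Set.uIoc_of_le zero_le_one] at hx
  rw [pjWeight, show α + j + k = α + ((j : ℕ) + (k : ℕ) : ℕ) by push_cast; ring,
    Real.rpow_add_natCast hx.1.ne']
  simp
  ring

/-- The unipotent change of basis `x ^ k ↦ ∑ m ≤ k, t ^ (k - m) / (k - m)! * x ^ m`. -/
noncomputable def truncMatrix (n : ℕ) (t : ℝ) : Matrix (Fin n) (Fin n) ℝ :=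
  Matrix.of fun m k : Fin n => if m ≤ k then t ^ ((k : ℕ) - m) / ((k : ℕ) - m).factorial else 0

theorem det_truncMatrix (n : ℕ) (t : ℝ) : (truncMatrix n t).det = 1 := by
  rw [det_of_isUpperTriangular]
  · simp [truncMatrix]
  · intro i j hij
    have : ¬ i ≤ j := not_le.2 hij
    simp [truncMatrix, this]

theorem hankelMatrix_mul_truncMatrix_apply {t α β : ℝ} (ht : 0 ≤ t) (hα : 0 < α) (hβ : 0 < β)
    {n : ℕ} (j k : Fin n) : (hankelMatrix n t α β * truncMatrix n t) j k
      = ∫ x in (0 : ℝ)..1, x ^ (α + (j : ℕ) + (k : ℕ)) * (1 - x) ^ β * truncExp k (t / x) := by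
  rw [mul_apply]
  simp only [hankelMatrix, truncMatrix, of_apply]
  simp_rw [← intervalIntegral.integral_mul_const]
  rw [← intervalIntegral.integral_finsetSum fun m _ => (intervalIntegrable_mul_pjWeight ht hα hβ
    (continuous_pow _)).mul_const _]
  refine intervalIntegral.integral_congr_ae (.of_forall fun x hx => ?_)
  rw [Set.uIoc_of_le zero_le_one] at hx
  have hx0 := hx.1
  have h1 : ∑ m : Fin n, x ^ ((j : ℕ) + (m : ℕ)) * pjWeight t α β x *
        (if m ≤ k then t ^ ((k : ℕ) - m) / ((k : ℕ) - m).factorial else 0)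
      = ∑ m ∈ range (k + 1), x ^ ((j : ℕ) + m) * pjWeight t α β x *
        (t ^ ((k : ℕ) - m) / ((k : ℕ) - m).factorial) := by
    have h2 := Fin.sum_univ_eq_sum_range (fun m => x ^ ((j : ℕ) + m) * pjWeight t α β x *
        (if m ≤ (k : ℕ) then t ^ ((k : ℕ) - m) / ((k : ℕ) - m).factorial else 0)) n
    simp only [Fin.le_def]
    rw [h2]
    have hsub : range ((k : ℕ) + 1) ⊆ range n := by
      intro m hm
      have := k.2
      simp only [Finset.mem_range] at *
      omega
    rw [← Finset.sum_subset hsub]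
    · refine Finset.sum_congr rfl fun m hm => ?_
      rw [if_pos (by simpa [Nat.lt_succ_iff] using hm)]
    · intro m _ hm
      rw [if_neg (by simpa [Nat.lt_succ_iff] using hm), mul_zero]
  rw [h1, ← Finset.sum_range_reflect, truncExp, Finset.mul_sum, Finset.mul_sum]
  refine Finset.sum_congr rfl fun m hm => ?_
  have hm : m ≤ (k : ℕ) := by simpa [Nat.lt_succ_iff] using hm
  obtain ⟨l, hl⟩ := Nat.exists_eq_add_of_le hm
  rw [hl, show m + l + 1 - 1 - m = l by omega, show m + l - l = m by omega, pjWeight, div_pow,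
    show α + (j : ℕ) + (m + l : ℕ) = α + ((j : ℕ) + l + m : ℕ) by push_cast; ring,
    Real.rpow_add_natCast hx0.ne', pow_add x _ m, neg_div]
  field_simp

/-- The determinant ratio at `t = σ / n ^ 2` is the determinant of a perturbation of the
identity. -/
theorem hankelDet_eq_mul_det {α β σ : ℝ} (hα : 0 < α) (hβ : 0 < β) (hαZ : ∀ k : ℤ, α ≠ k)
    (hσ : 0 < σ) (N : ℕ) :
    hankelDet (N + 1) (σ / ((N : ℝ) + 1) ^ 2) α β = hankelDet (N + 1) 0 α β *
      (1 + Matrix.of fun i k : Fin (N + 1) =>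
        realEntry α β ((N : ℝ) + 1)⁻¹ (scaleConst α β N) σ i k).det := by
  have hν : (0 : ℝ) < N + 1 := by positivity
  set t := σ / ((N : ℝ) + 1) ^ 2 with ht
  set M : Matrix (Fin (N + 1)) (Fin (N + 1)) ℝ := Matrix.of fun i k : Fin (N + 1) =>
        realEntry α β ((N : ℝ) + 1)⁻¹ (scaleConst α β N) σ i k with hM
  set D : Matrix (Fin (N + 1)) (Fin (N + 1)) ℝ :=
    diagonal fun i : Fin (N + 1) => ((N : ℝ) + 1) ^ (2 * (i : ℕ)) with hD
  set D' : Matrix (Fin (N + 1)) (Fin (N + 1)) ℝ :=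
    diagonal fun i : Fin (N + 1) => (((N : ℝ) + 1) ^ (2 * (i : ℕ)))⁻¹ with hD'
  have hDD : D * D' = 1 := by
    rw [hD, hD', diagonal_mul_diagonal, ← diagonal_one]
    congr 1
    ext i
    exact mul_inv_cancel₀ (by positivity)
  -- The correction is H(0) D M D⁻¹, because the coefficient found for (i, k) carries n^(2i) /
  -- n^(2k).
  have key : hankelMatrix (N + 1) t α β * truncMatrix (N + 1) t
      = hankelMatrix (N + 1) 0 α β * (D * (1 + M) * D') := by
    have h1 : D * (1 + M) * D' = 1 + D * M * D' := by
      rw [mul_add, add_mul, mul_one, hDD]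
    rw [h1, mul_add, mul_one]
    ext j k
    rw [hankelMatrix_mul_truncMatrix_apply (by positivity) hα hβ, ht,
      integral_truncExp_eq_sum hα hβ hαZ hσ (Nat.lt_succ_iff.1 j.2), Matrix.add_apply,
      hankelMatrix_zero_apply hα hβ, mul_apply, sub_eq_add_neg, ← Finset.sum_neg_distrib,
      ← Fin.sum_univ_eq_sum_range (fun i => -(betaSeries β (α + 1 + (j : ℕ) + i) *
        (((N : ℝ) + 1) ^ (2 * i) / ((N : ℝ) + 1) ^ (2 * (k : ℕ)) *
          (∑' m, regCoeff α β ((N : ℝ) + 1)⁻¹ i k m * σ ^ ((k : ℕ) + m + 1) +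
            scaleConst α β N * σ ^ (α + 1) *
              ∑' m, singCoeff α β ((N : ℝ) + 1)⁻¹ i k m * σ ^ ((k : ℕ) + m)))))]
    congr 1
    refine Finset.sum_congr rfl fun i _ => ?_
    rw [hankelMatrix_zero_apply hα hβ, hD, hD', mul_diagonal, diagonal_mul, hM, of_apply,
      realEntry]
    ring
  have h := congrArg det key
  have hd : D.det * D'.det = 1 := by rw [← det_mul, hDD, det_one]
  rw [det_mul, det_truncMatrix, mul_one, det_mul, det_mul, det_mul] at h
  change (hankelMatrix (N + 1) t α β).det = (hankelMatrix (N + 1) 0 α β).det * _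
  rw [h]
  linear_combination (hankelMatrix (N + 1) 0 α β).det * (1 + M).det * hd

end

/-! ### Infinite determinants as sums of principal minors. -/

section

open Finset (range)
open MeasureTheory Matrix

/-- The principal minor of an infinite matrix on a finite index set. -/
noncomputable def minor (M : ℕ → ℕ → ℂ) (S : Finset ℕ) : ℂ :=
  (Matrix.of fun i k : S => M i k).det

/-- Evaluate at X = 1 the polynomial det(1 + XM), whose coefficients are the sums of the principal
minors of each size. -/
theorem det_one_add_eq_sum_minors {ι : Type*} [Fintype ι] [DecidableEq ι] (M : Matrix ι ι ℂ) :
    (1 + M).det = ∑ S : Finset ι, (M.submatrix (Subtype.val : S → ι) (Subtype.val : S → ι)).det := by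
  open Polynomial in
  set p : ℂ[X] := (1 + (X : ℂ[X]) • M.map C).det with hp
  have hdeg : p.natDegree < Fintype.card ι + 1 := by
    have := natDegree_det_X_add_C_le M 1
    rw [Matrix.map_one _ C.map_zero C.map_one, add_comm] at this
    exact Nat.lt_succ_of_le this
  have heval : p.eval 1 = (1 + M).det := by
    rw [hp, eval_det]
    congr 1
    ext i j
    simp [Matrix.one_apply]
  rw [← heval, eval_eq_sum_range' hdeg]
  simp only [one_pow, mul_one, hp, coeff_det_one_add_X_smul_eq_sum_minors]
  rw [← Finset.powerset_univ, Finset.sum_powerset, Finset.card_univ]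

/-- Enlarge the sum over permutations to all maps ι → ι; it then factors into column sums. -/
theorem norm_det_le_prod_sum {ι : Type*} [Fintype ι] [DecidableEq ι] (A : Matrix ι ι ℂ) :
    ‖A.det‖ ≤ ∏ k, ∑ i, ‖A i k‖ := by
  rw [det_apply, Finset.prod_univ_sum, Fintype.piFinset_univ]
  calc _ ≤ ∑ σ : Equiv.Perm ι, ∏ k, ‖A (σ k) k‖ := by
        refine (norm_sum_le _ _).trans (Finset.sum_le_sum fun σ _ => ?_)
        rw [← norm_prod]
        rcases Int.units_eq_one_or (Equiv.Perm.sign σ) with h | h <;> simp [h]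
    _ = ∑ f ∈ Finset.univ.map ⟨fun σ : Equiv.Perm ι => (σ : ι → ι), DFunLike.coe_injective⟩,
          ∏ k, ‖A (f k) k‖ := by rw [Finset.sum_map]; rfl
    _ ≤ _ := Finset.sum_le_sum_of_subset_of_nonneg (Finset.subset_univ _)
        fun f _ _ => Finset.prod_nonneg fun _ _ => norm_nonneg _

/-- The product form of the bound is summable over all finite sets S as soon as v is summable. -/
theorem norm_minor_le {M : ℕ → ℕ → ℂ} {u v : ℕ → ℝ} (hu : ∀ i, 0 ≤ u i) (hv : ∀ i, 0 ≤ v i)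
    (hus : Summable u) (hM : ∀ i k, ‖M i k‖ ≤ u i * v k) (S : Finset ℕ) :
    ‖minor M S‖ ≤ ∏ k ∈ S, (∑' i, u i) * v k := by
  refine (norm_det_le_prod_sum _).trans ?_
  rw [← Finset.prod_coe_sort S]
  refine Finset.prod_le_prod (fun _ _ => Finset.sum_nonneg fun _ _ => norm_nonneg _) fun k _ => ?_
  calc _ ≤ ∑ i : S, u i * v k := Finset.sum_le_sum fun i _ => hM i k
    _ = (∑ i ∈ S, u i) * v k := by rw [← Finset.sum_mul, Finset.sum_coe_sort S]
    _ ≤ _ := by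
      gcongr
      · exact hv _
      · exact hus.sum_le_tsum _ fun i _ => hu i

/-- Minors meeting an index ≥ n have a zero row. All sizes n thus share one index set, as dominated
convergence requires. -/
theorem det_one_add_eq_tsum_minor {M : ℕ → ℕ → ℂ} {n : ℕ} (hM : ∀ i k, n ≤ i → M i k = 0) :
    (1 + Matrix.of fun i k : Fin n => M i k).det = ∑' S, minor M S := by
  rw [det_one_add_eq_sum_minors, ← tsum_fintype (L := .unconditional _)]
  rw [← (Finset.map_injective (Fin.valEmbedding (n := n))).tsum_eq]
  · refine tsum_congr fun S => ?_
    have hb : Function.Bijective fun i : S =>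
        (⟨(i : Fin n), Finset.mem_map_of_mem Fin.valEmbedding i.2⟩ : S.map Fin.valEmbedding) := by
      constructor
      · intro a b h
        exact Subtype.ext (Fin.ext (congrArg Subtype.val h))
      · rintro ⟨b, hb⟩
        obtain ⟨a, ha, rfl⟩ := Finset.mem_map.1 hb
        exact ⟨⟨a, ha⟩, rfl⟩
    rw [minor, ← det_submatrix_equiv_self (Equiv.ofBijective _ hb)]
    rfl
  · intro S hS
    by_cases h : ∀ i ∈ S, i < n
    · exact ⟨S.attachFin h, Finset.map_valEmbedding_attachFin h⟩
    · push Not at h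
      obtain ⟨i, hi, hin⟩ := h
      exact absurd (det_eq_zero_of_row_eq_zero (⟨i, hi⟩ : S) fun k => hM i k hin) hS

/-- The entries of the perturbation as functions of two complex variables. -/
noncomputable def regEntry (α β x : ℝ) (i k : ℕ) (σ : ℂ) : ℂ :=
  ∑' m, (regCoeff α β x i k m : ℂ) * σ ^ (k + m + 1)

noncomputable def singEntry (α β x : ℝ) (i k : ℕ) (σ : ℂ) : ℂ :=
  ∑' m, (singCoeff α β x i k m : ℂ) * σ ^ (k + m)

/-- τ stands for the multiple of σ^(α+1), the only ingredient that is not entire in σ; kept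
independent, it leaves a function entire in each variable. -/
noncomputable def entry (α β x : ℝ) (σ τ : ℂ) (i k : ℕ) : ℂ :=
  -(regEntry α β x i k σ + τ * singEntry α β x i k σ)

/-- The determinant of the perturbed identity; `x = 1 / n` for finite matrices, `x = 0` for
the limit. -/
noncomputable def infDet (α β x : ℝ) (σ τ : ℂ) : ℂ := ∑' S, minor (entry α β x σ τ) S

theorem tendsto_minor {ι : Type*} {l : Filter ι} {M : ι → ℕ → ℕ → ℂ} {M' : ℕ → ℕ → ℂ}
    (h : ∀ i k, Tendsto (fun a => M a i k) l (𝓝 (M' i k))) (S : Finset ℕ) :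
    Tendsto (fun a => minor (M a) S) l (𝓝 (minor M' S)) := by
  have hc : Continuous fun A : Matrix S S ℂ => A.det := continuous_id.matrix_det
  refine (hc.tendsto _).comp ?_
  exact tendsto_pi_nhds.2 fun i => tendsto_pi_nhds.2 fun k => h i k

theorem differentiable_minor {M : ℂ → ℕ → ℕ → ℂ} (h : ∀ i k, Differentiable ℂ fun z => M z i k)
    (S : Finset ℕ) : Differentiable ℂ fun z => minor (M z) S := by
  simp only [minor, det_apply, of_apply]
  refine Differentiable.fun_sum fun σ _ => Differentiable.const_smul ?_ _
  exact Differentiable.fun_finsetProd fun i _ => h _ _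

section Bounds

variable {α β : ℝ}

/-- Uniform bounds for the entries. -/
theorem exists_entry_bound (hα : 0 < α) (hβ : 0 < β) (hαZ : ∀ k : ℤ, α ≠ k) (ρ : ℝ) :
    ∃ c B : ℝ, 0 < c ∧ 0 < B ∧
      (∀ i k : ℕ, ∃ b : ℕ → ℝ, Summable b ∧ ∀ x, IsScale x → ∀ σ : ℂ, ‖σ‖ ≤ ρ → ∀ m,
        ‖(regCoeff α β x i k m : ℂ) * σ ^ (k + m + 1)‖ ≤ b m ∧
        ‖(singCoeff α β x i k m : ℂ) * σ ^ (k + m)‖ ≤ b m) ∧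
      ∀ x, IsScale x → ∀ σ : ℂ, ‖σ‖ ≤ ρ → ∀ i k : ℕ,
        ‖regEntry α β x i k σ‖ ≤ B * (c ^ i / i.factorial) * (‖σ‖ ^ (k + 1) / k.factorial) ∧
        ‖singEntry α β x i k σ‖ ≤ B * (c ^ i / i.factorial) * (‖σ‖ ^ k / k.factorial) := by
  obtain ⟨c, C, K, hc, hC, hK, h⟩ := exists_coeff_bound hα hβ hαZ
  have hsum : ∀ r : ℝ, HasSum (fun m : ℕ => (K * r) ^ m / m.factorial) (Real.exp (K * r)) := by
    intro r
    have := NormedSpace.expSeries_div_hasSum_exp (K * r)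
    rwa [← Real.exp_eq_exp_ℝ] at this
  have t1 : ∀ x, IsScale x → ∀ (σ : ℂ) (i k m : ℕ),
      ‖(regCoeff α β x i k m : ℂ) * σ ^ (k + m + 1)‖ ≤
        C * (c ^ i / i.factorial) * (‖σ‖ ^ (k + 1) / k.factorial) *
          ((K * ‖σ‖) ^ m / m.factorial) := by
    intro x hx σ i k m
    rw [norm_mul, norm_pow, Complex.norm_real]
    calc _ ≤ C * (c ^ i / i.factorial) * (1 / k.factorial) * (K ^ m / m.factorial) *
          ‖σ‖ ^ (k + m + 1) := by gcongr; exact (h x hx i k m).1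
      _ = _ := by rw [mul_pow, show k + m + 1 = m + (k + 1) by ring, pow_add]; ring
  have t2 : ∀ x, IsScale x → ∀ (σ : ℂ) (i k m : ℕ),
      ‖(singCoeff α β x i k m : ℂ) * σ ^ (k + m)‖ ≤
        C * (c ^ i / i.factorial) * (‖σ‖ ^ k / k.factorial) *
          ((K * ‖σ‖) ^ m / m.factorial) := by
    intro x hx σ i k m
    rw [norm_mul, norm_pow, Complex.norm_real]
    calc _ ≤ C * (c ^ i / i.factorial) * (1 / k.factorial) * (K ^ m / m.factorial) *
          ‖σ‖ ^ (k + m) := by gcongr; exact (h x hx i k m).2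
      _ = _ := by rw [mul_pow, show k + m = m + k by ring, pow_add]; ring
  refine ⟨c, C * Real.exp (K * ρ), hc, by positivity, fun i k => ?_, fun x hx σ hσ i k => ?_⟩
  · refine ⟨fun m => (C * (c ^ i / i.factorial) * (|ρ| ^ (k + 1) / k.factorial) +
      C * (c ^ i / i.factorial) * (|ρ| ^ k / k.factorial)) *
          ((K * |ρ|) ^ m / m.factorial), (hsum _).summable.mul_left _, fun x hx σ hσ m => ?_⟩
    have hσ' : ‖σ‖ ≤ |ρ| := hσ.trans (le_abs_self _)
    beta_reduce
    rw [add_mul]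
    constructor
    · refine (t1 x hx σ i k m).trans (le_add_of_le_of_nonneg ?_ (by positivity))
      gcongr
    · refine (t2 x hx σ i k m).trans (le_add_of_nonneg_of_le (by positivity) ?_)
      gcongr
  · constructor
    · refine (tsum_of_norm_bounded ((hsum ‖σ‖).mul_left _) fun m => t1 x hx σ i k m).trans ?_
      calc _ ≤ C * (c ^ i / i.factorial) * (‖σ‖ ^ (k + 1) / k.factorial) * Real.exp (K * ρ) := by
            gcongr
        _ = _ := by ring
    · refine (tsum_of_norm_bounded ((hsum ‖σ‖).mul_left _) fun m => t2 x hx σ i k m).trans ?_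
      calc _ ≤ C * (c ^ i / i.factorial) * (‖σ‖ ^ k / k.factorial) * Real.exp (K * ρ) := by
            gcongr
        _ = _ := by ring

theorem differentiable_regEntry (hα : 0 < α) (hβ : 0 < β) (hαZ : ∀ k : ℤ, α ≠ k) {x : ℝ}
    (hx : IsScale x) (i k : ℕ) : Differentiable ℂ (regEntry α β x i k) := by
  intro z
  obtain ⟨c, B, -, -, hb, -⟩ := exists_entry_bound hα hβ hαZ (‖z‖ + 1)
  obtain ⟨b, hbs, hb⟩ := hb i k
  have h := Complex.differentiableOn_tsum_of_summable_norm (U := Metric.ball 0 (‖z‖ + 1)) hbs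
    (F := fun m σ => (regCoeff α β x i k m : ℂ) * σ ^ (k + m + 1))
    (fun m => by fun_prop) Metric.isOpen_ball
    (fun m w hw => (hb x hx w (by simpa using (Metric.mem_ball.1 hw).le) m).1)
  exact h.differentiableAt (Metric.isOpen_ball.mem_nhds (by simp))

theorem differentiable_singEntry (hα : 0 < α) (hβ : 0 < β) (hαZ : ∀ k : ℤ, α ≠ k) {x : ℝ}
    (hx : IsScale x) (i k : ℕ) : Differentiable ℂ (singEntry α β x i k) := by
  intro z
  obtain ⟨c, B, -, -, hb, -⟩ := exists_entry_bound hα hβ hαZ (‖z‖ + 1)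
  obtain ⟨b, hbs, hb⟩ := hb i k
  have h := Complex.differentiableOn_tsum_of_summable_norm (U := Metric.ball 0 (‖z‖ + 1)) hbs
    (F := fun m σ => (singCoeff α β x i k m : ℂ) * σ ^ (k + m))
    (fun m => by fun_prop) Metric.isOpen_ball
    (fun m w hw => (hb x hx w (by simpa using (Metric.mem_ball.1 hw).le) m).2)
  exact h.differentiableAt (Metric.isOpen_ball.mem_nhds (by simp))

/-- A summable bound for the minors which is uniform in the scale. -/
theorem exists_minor_bound (hα : 0 < α) (hβ : 0 < β) (hαZ : ∀ k : ℤ, α ≠ k) (ρ T : ℝ) :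
    ∃ b : Finset ℕ → ℝ, Summable b ∧ ∀ x, IsScale x → ∀ σ τ : ℂ, ‖σ‖ ≤ ρ → ‖τ‖ ≤ T →
      ∀ S, ‖minor (entry α β x σ τ) S‖ ≤ b S := by
  obtain ⟨c, B, hc, hB, -, h⟩ := exists_entry_bound hα hβ hαZ ρ
  have hu : Summable fun i : ℕ => B * (c ^ i / i.factorial) :=
    (Real.summable_pow_div_factorial c).mul_left B
  have hv : Summable fun k : ℕ => (|ρ| + |T|) * (|ρ| ^ k / k.factorial) :=
    (Real.summable_pow_div_factorial |ρ|).mul_left _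
  refine ⟨fun S => ∏ k ∈ S, (∑' i : ℕ, B * (c ^ i / i.factorial)) *
    ((|ρ| + |T|) * (|ρ| ^ k / k.factorial)), ?_, fun x hx σ τ hσ hτ S => ?_⟩
  · exact summable_finsetProd_of_summable_nonneg
      (fun k => mul_nonneg (tsum_nonneg fun _ => by positivity) (by positivity)) (hv.mul_left _)
  · refine norm_minor_le (fun i => by positivity) (fun k => by positivity) hu (fun i k => ?_) S
    have hσ' : ‖σ‖ ≤ |ρ| := hσ.trans (le_abs_self _)
    have hτ' : ‖τ‖ ≤ |T| := hτ.trans (le_abs_self _)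
    obtain ⟨h1, h2⟩ := h x hx σ hσ i k
    rw [entry, norm_neg]
    calc _ ≤ ‖regEntry α β x i k σ‖ + ‖τ‖ * ‖singEntry α β x i k σ‖ := by
          rw [← norm_mul]; exact norm_add_le _ _
      _ ≤ B * (c ^ i / i.factorial) * (|ρ| ^ (k + 1) / k.factorial) +
          |T| * (B * (c ^ i / i.factorial) * (|ρ| ^ k / k.factorial)) := by
          gcongr
          · exact h1.trans (by gcongr)
          · exact h2.trans (by gcongr)
      _ = _ := by rw [pow_succ]; ring

theorem exists_norm_infDet_le (hα : 0 < α) (hβ : 0 < β) (hαZ : ∀ k : ℤ, α ≠ k) (ρ T : ℝ) :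
    ∃ C : ℝ, 0 ≤ C ∧ ∀ x, IsScale x → ∀ σ τ : ℂ, ‖σ‖ ≤ ρ → ‖τ‖ ≤ T →
      ‖infDet α β x σ τ‖ ≤ C := by
  obtain ⟨b, hb, h⟩ := exists_minor_bound hα hβ hαZ ρ T
  refine ⟨|∑' S, b S|, abs_nonneg _, fun x hx σ τ hσ hτ => ?_⟩
  exact (tsum_of_norm_bounded hb.hasSum (h x hx σ τ hσ hτ)).trans (le_abs_self _)

/-- The series of minors converges locally uniformly. Allowing entire σ and τ covers each variable
separately as well as the substitution σ = e^ζ/2. -/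
theorem differentiable_infDet_comp (hα : 0 < α) (hβ : 0 < β) (hαZ : ∀ k : ℤ, α ≠ k) {x : ℝ}
    (hx : IsScale x) {σ τ : ℂ → ℂ} (hσ : Differentiable ℂ σ) (hτ : Differentiable ℂ τ) :
    Differentiable ℂ fun z => infDet α β x (σ z) (τ z) := by
  intro z
  obtain ⟨ρ, hρ⟩ := (isCompact_closedBall z 1).exists_bound_of_continuousOn
    hσ.continuous.continuousOn
  obtain ⟨T, hT⟩ := (isCompact_closedBall z 1).exists_bound_of_continuousOn
    hτ.continuous.continuousOn
  obtain ⟨b, hb, h⟩ := exists_minor_bound hα hβ hαZ ρ T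
  have hd := Complex.differentiableOn_tsum_of_summable_norm (U := Metric.ball z 1) hb
    (F := fun S w => minor (entry α β x (σ w) (τ w)) S)
    (fun S => (differentiable_minor (fun i k => by
      unfold entry
      exact (((differentiable_regEntry hα hβ hαZ hx i k).comp hσ).add
        (hτ.mul ((differentiable_singEntry hα hβ hαZ hx i k).comp hσ))).neg) S).differentiableOn)
    Metric.isOpen_ball
    (fun S w hw => h x hx _ _ (hρ w (Metric.ball_subset_closedBall hw))
      (hT w (Metric.ball_subset_closedBall hw)) S)
  exact hd.differentiableAt (Metric.isOpen_ball.mem_nhds (by simp))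

/-- Dominated convergence twice: over the minors, and over the power series inside each entry. -/
theorem tendsto_infDet (hα : 0 < α) (hβ : 0 < β) (hαZ : ∀ k : ℤ, α ≠ k) (σ : ℂ) {τ : ℕ → ℂ}
    {τ₀ : ℂ} (hτ : Tendsto τ atTop (𝓝 τ₀)) :
    Tendsto (fun N : ℕ => infDet α β ((N : ℝ) + 1)⁻¹ σ (τ N)) atTop (𝓝 (infDet α β 0 σ τ₀)) := by
  have hx : ∀ N : ℕ, IsScale ((N : ℝ) + 1)⁻¹ := fun N => Or.inr ⟨N, rfl⟩
  have hx0 : Tendsto (fun N : ℕ => ((N : ℝ) + 1)⁻¹) atTop (𝓝 0) := by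
    simpa using tendsto_one_div_add_atTop_nhds_zero_nat (𝕜 := ℝ)
  obtain ⟨T, hT⟩ := hτ.norm.bddAbove_range
  obtain ⟨b, hb, h⟩ := exists_minor_bound hα hβ hαZ ‖σ‖ T
  obtain ⟨c, B, -, -, hbd, -⟩ := exists_entry_bound hα hβ hαZ ‖σ‖
  refine tendsto_tsum_of_dominated_convergence hb (fun S => tendsto_minor (fun i k => ?_) S)
    (.of_forall fun N S => h _ (hx N) _ _ le_rfl (hT ⟨N, rfl⟩) S)
  obtain ⟨b', hbs, hb'⟩ := hbd i k
  refine (Tendsto.add ?_ (hτ.mul ?_)).neg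
  · refine tendsto_tsum_of_dominated_convergence hbs (fun m => ?_)
      (.of_forall fun N m => (hb' _ (hx N) σ le_rfl m).1)
    refine Tendsto.mul_const _ ?_
    exact (Complex.continuous_ofReal.tendsto _).comp
      (((continuous_regCoeff α β i k m).tendsto 0).comp hx0)
  · refine tendsto_tsum_of_dominated_convergence hbs (fun m => ?_)
      (.of_forall fun N m => (hb' _ (hx N) σ le_rfl m).2)
    refine Tendsto.mul_const _ ?_
    exact (Complex.continuous_ofReal.tendsto _).comp
      (((continuous_singCoeff α β i k m).tendsto 0).comp hx0)

theorem entry_eq_ofReal (x c : ℝ) {σ : ℝ} (i k : ℕ) :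
    entry α β x (σ : ℂ) (c * σ ^ (α + 1) : ℝ) i k = (realEntry α β x c σ i k : ℂ) := by
  rw [entry, realEntry, regEntry, singEntry]
  push_cast
  rfl

theorem hankelDet_ratio_eq_infDet (hα : 0 < α) (hβ : 0 < β) (hαZ : ∀ k : ℤ, α ≠ k) {σ : ℝ}
    (hσ : 0 < σ) (N : ℕ) :
    ((hankelDet (N + 1) (σ / ((N : ℝ) + 1) ^ 2) α β / hankelDet (N + 1) 0 α β : ℝ) : ℂ)
      = infDet α β ((N : ℝ) + 1)⁻¹ σ (scaleConst α β N * σ ^ (α + 1) : ℝ) := by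
  rw [hankelDet_eq_mul_det hα hβ hαZ hσ, mul_div_cancel_left₀ _ (hankelDet_pos le_rfl hα hβ _).ne',
    infDet, ← det_one_add_eq_tsum_minor (n := N + 1)]
  · rw [← Complex.ofRealHom_eq_coe, RingHom.map_det]
    congr 1
    ext i k
    simp only [RingHom.mapMatrix_apply, Matrix.map_apply, Matrix.add_apply, Matrix.one_apply,
      of_apply, entry_eq_ofReal]
    split_ifs <;> simp
  · intro i k hi
    have h := rowFactor_eq_zero α β hi
    simp [entry, regEntry, singEntry, regCoeff, singCoeff, h]

end Bounds

end

/-! ### The limit n → ∞ on the positive axis, with derivatives. -/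

section

open MeasureTheory

/-- Cauchy's formula on the unit circle about z; bounded pointwise convergence under the integral
suffices. -/
theorem tendsto_deriv_of_tendsto_of_bounded {F : ℕ → ℂ → ℂ} {G : ℂ → ℂ} {z : ℂ} {C : ℝ}
    (hF : ∀ n, Differentiable ℂ (F n)) (hG : Differentiable ℂ G)
    (hb : ∀ n, ∀ w ∈ Metric.sphere z 1, ‖F n w‖ ≤ C)
    (hlim : ∀ w, Tendsto (fun n => F n w) atTop (𝓝 (G w))) :
    Tendsto (fun n => deriv (F n) z) atTop (𝓝 (deriv G z)) := by
  have key : ∀ f : ℂ → ℂ, Differentiable ℂ f →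
      deriv f z = (2 * Real.pi * Complex.I : ℂ)⁻¹ • ∮ w in C(z, 1), ((w - z) ^ 2)⁻¹ • f w :=
    fun f hf => (Complex.two_pi_I_inv_smul_circleIntegral_sub_sq_inv_smul_of_differentiable
      isOpen_univ (Set.subset_univ _) hf.differentiableOn
      (Metric.mem_ball_self one_pos)).symm
  simp only [key _ (hF _), key _ hG]
  refine Tendsto.const_smul ?_ _
  simp only [circleIntegral]
  have hs : ∀ θ : ℝ, circleMap z 1 θ ∈ Metric.sphere z 1 := fun θ =>
    circleMap_mem_sphere z zero_le_one θ
  have hne : ∀ θ : ℝ, circleMap z 1 θ - z ≠ 0 := fun θ => by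
    rw [circleMap_sub_center]; exact circleMap_ne_center one_ne_zero
  refine intervalIntegral.tendsto_integral_filter_of_dominated_convergence (fun _ => C)
    (.of_forall fun n => ?_) (.of_forall fun n => .of_forall fun θ _ => ?_)
    intervalIntegrable_const (.of_forall fun θ _ => ?_)
  · refine Continuous.aestronglyMeasurable ?_
    have h1 : Continuous fun θ => F n (circleMap z 1 θ) :=
      (hF n).continuous.comp (continuous_circleMap z 1)
    have h2 : Continuous fun θ => ((circleMap z 1 θ - z) ^ 2)⁻¹ :=
      (((continuous_circleMap z 1).sub continuous_const).pow 2).inv₀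
        fun θ => pow_ne_zero 2 (hne θ)
    have h3 : Continuous fun θ => deriv (circleMap z 1) θ := by
      simp only [deriv_circleMap]
      exact (continuous_circleMap 0 1).mul continuous_const
    exact h3.smul (h2.smul h1)
  · have : ‖circleMap z 1 θ - z‖ = 1 := by
      rw [← dist_eq_norm]; exact hs θ
    rw [norm_smul, norm_smul, norm_inv, norm_pow, this, deriv_circleMap, norm_mul,
      norm_circleMap_zero]
    simpa using hb n _ (hs θ)
  · exact ((hlim _).const_smul _).const_smul _

/-- A real function which is an entire function of the logarithm is differentiable. -/
theorem hasDerivAt_of_eq_comp_log {F : ℂ → ℂ} (hF : Differentiable ℂ F) {r : ℝ → ℝ}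
    (h : ∀ u : ℝ, 0 < u → (r u : ℂ) = F (Real.log u)) {s : ℝ} (hs : 0 < s) :
    ∃ d : ℝ, (d : ℂ) = deriv F (Real.log s) ∧ HasDerivAt r (d / s) s := by
  have hs' : (s : ℂ) ≠ 0 := by exact_mod_cast hs.ne'
  have h1 : HasDerivAt (fun z => F (Complex.log z)) (deriv F (Real.log s) * (s : ℂ)⁻¹) (s : ℂ) := by
    have := (hF (Complex.log s)).hasDerivAt.comp (s : ℂ)
      (Complex.hasDerivAt_log (Complex.ofReal_mem_slitPlane.2 hs))
    rwa [Complex.ofReal_log hs.le]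
  have e : ∀ᶠ u : ℝ in 𝓝 s, F (Complex.log u) = r u := by
    filter_upwards [lt_mem_nhds hs] with u hu
    rw [h u hu, Complex.ofReal_log hu.le]
  have h2 := h1.real_of_complex.congr_of_eventuallyEq
    (e.mono fun u hu => by rw [hu, Complex.ofReal_re] : r =ᶠ[𝓝 s] _)
  have h3 := h1.comp_ofReal.congr_of_eventuallyEq
    (e.mono fun u hu => hu.symm : (fun u : ℝ => (r u : ℂ)) =ᶠ[𝓝 s] _)
  -- Shows that the derivative is real: `h2` differentiates r as a real part, `h3` as a
  -- complex-valued function.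
  have h4 := h2.ofReal_comp.unique h3
  refine ⟨s * (deriv F (Real.log s) * (s : ℂ)⁻¹).re, ?_, ?_⟩
  · rw [Complex.ofReal_mul, h4]
    field_simp
  · rwa [mul_div_cancel_left₀ _ hs.ne']

section RealAxis

variable {α β : ℝ}

/-- The determinant in the variable `ζ = log s`. -/
noncomputable def logDet (α β x g : ℝ) (ζ : ℂ) : ℂ :=
  infDet α β x (Complex.exp ζ / 2) (g * Complex.exp ((α + 1) * ζ))

theorem differentiable_logDet (hα : 0 < α) (hβ : 0 < β) (hαZ : ∀ k : ℤ, α ≠ k) {x : ℝ}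
    (hx : IsScale x) (g : ℝ) : Differentiable ℂ (logDet α β x g) :=
  differentiable_infDet_comp hα hβ hαZ hx (by fun_prop) (by fun_prop)

/-- The finite and the limiting value of the normalizing constant, in terms of `s`. -/
theorem tendsto_scaleConst_div (hα : 0 < α) (hβ : 0 < β) :
    Tendsto (fun N => scaleConst α β N / 2 ^ (α + 1)) atTop
      (𝓝 (1 / Real.Gamma (α + 1) ^ 2 / 2 ^ (α + 1))) :=
  (tendsto_scaleConst hα hβ).div_const _

theorem scaledRatio_eq_logDet (hα : 0 < α) (hβ : 0 < β) (hαZ : ∀ k : ℤ, α ≠ k) (N : ℕ) {s : ℝ}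
    (hs : 0 < s) :
    (scaledRatio α β (N + 1) s : ℂ) =
      logDet α β ((N : ℝ) + 1)⁻¹ (scaleConst α β N / 2 ^ (α + 1)) (Real.log s) := by
  have h := hankelDet_ratio_eq_infDet hα hβ hαZ (half_pos hs) N
  rw [scaledRatio, logDet]
  have e1 : s / (2 * ((N + 1 : ℕ) : ℝ) ^ 2) = s / 2 / ((N : ℝ) + 1) ^ 2 := by
    push_cast; rw [div_div]
  have e2 : (Complex.exp (Real.log s) / 2 : ℂ) = ((s / 2 : ℝ) : ℂ) := by
    rw [← Complex.ofReal_exp, Real.exp_log hs]; push_cast; rfl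
  have e3 : (((scaleConst α β N / 2 ^ (α + 1) : ℝ) : ℂ) *
      Complex.exp ((α + 1) * (Real.log s : ℂ))) =
      ((scaleConst α β N * (s / 2) ^ (α + 1) : ℝ) : ℂ) := by
    rw [Real.div_rpow hs.le zero_le_two, Real.rpow_def_of_pos hs, mul_comm (Real.log s)]
    push_cast
    ring
  rw [e1, e2, e3, h]

theorem tendsto_logDet (hα : 0 < α) (hβ : 0 < β) (hαZ : ∀ k : ℤ, α ≠ k) {g : ℕ → ℝ} {g₀ : ℝ}
    (hg : Tendsto g atTop (𝓝 g₀)) (ζ : ℂ) :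
    Tendsto (fun N : ℕ => logDet α β ((N : ℝ) + 1)⁻¹ (g N) ζ) atTop (𝓝 (logDet α β 0 g₀ ζ)) :=
  tendsto_infDet hα hβ hαZ _ (((Complex.continuous_ofReal.tendsto _).comp hg).mul_const _)

theorem tendsto_deriv_logDet (hα : 0 < α) (hβ : 0 < β) (hαZ : ∀ k : ℤ, α ≠ k) {g : ℕ → ℝ}
    {g₀ : ℝ} (hg : Tendsto g atTop (𝓝 g₀)) (ζ : ℂ) :
    Tendsto (fun N : ℕ => deriv (logDet α β ((N : ℝ) + 1)⁻¹ (g N)) ζ) atTop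
      (𝓝 (deriv (logDet α β 0 g₀) ζ)) := by
  have hx : ∀ N : ℕ, IsScale ((N : ℝ) + 1)⁻¹ := fun N => Or.inr ⟨N, rfl⟩
  obtain ⟨G, hG⟩ := hg.norm.bddAbove_range
  obtain ⟨ρ, hρ⟩ := (isCompact_sphere ζ 1).exists_bound_of_continuousOn
    (f := fun w => Complex.exp w / 2) (by fun_prop)
  obtain ⟨T, hT⟩ := (isCompact_sphere ζ 1).exists_bound_of_continuousOn
    (f := fun w => Complex.exp ((α + 1) * w)) (by fun_prop)
  obtain ⟨C, -, hC⟩ := exists_norm_infDet_le hα hβ hαZ ρ (G * T)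
  refine tendsto_deriv_of_tendsto_of_bounded (C := C)
    (fun N => differentiable_logDet hα hβ hαZ (hx N) _)
    (differentiable_logDet hα hβ hαZ (Or.inl rfl) _) (fun N w hw => ?_)
    (fun w => tendsto_logDet hα hβ hαZ hg w)
  refine hC _ (hx N) _ _ (hρ w hw) ?_
  rw [norm_mul, Complex.norm_real]
  have h1 : ‖g N‖ ≤ G := hG ⟨N, rfl⟩
  exact mul_le_mul h1 (hT w hw) (norm_nonneg _) ((norm_nonneg _).trans h1)

theorem scaledRatio_pos (hα : 0 < α) (hβ : 0 < β) (n : ℕ) {s : ℝ} (hs : 0 < s) :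
    0 < scaledRatio α β n s :=
  div_pos (hankelDet_pos (by positivity) hα hβ n) (hankelDet_pos le_rfl hα hβ n)

/-- This inequality survives n → ∞ and excludes zeros of the limit, which positivity at finite n
does not. -/
theorem scaledRatio_sq_le (hα : 0 < α) (hβ : 0 < β) (n : ℕ) {s : ℝ} (hs : 0 < s) :
    scaledRatio α β n s ^ 2 ≤ scaledRatio α β n (2 * s) := by
  have h0 := hankelDet_pos le_rfl hα hβ n
  have h := hankelDet_sq_le (t := s / (2 * (n : ℝ) ^ 2)) (by positivity) hα hβ n
  rw [scaledRatio, scaledRatio, div_pow, mul_div_assoc, div_le_div_iff₀ (by positivity) h0]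
  nlinarith

theorem differentiableAt_log_scaledRatio (hα : 0 < α) (hβ : 0 < β) (hαZ : ∀ k : ℤ, α ≠ k) (n : ℕ)
    {s : ℝ} (hs : 0 < s) :
    DifferentiableAt ℝ (fun u : ℝ => Real.log (scaledRatio α β n u)) s := by
  rcases n with _ | N
  · have : scaledRatio α β 0 = fun _ => 1 := by
      ext u
      simp [scaledRatio, hankelDet]
    simp [this]
  · obtain ⟨d, -, hd⟩ := hasDerivAt_of_eq_comp_log
      (differentiable_logDet hα hβ hαZ (Or.inr ⟨N, rfl⟩) _)
      (fun u hu => scaledRatio_eq_logDet hα hβ hαZ N hu) hs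
    exact hd.differentiableAt.log (scaledRatio_pos hα hβ _ hs).ne'

/-- The limits of the ratio and of its logarithmic derivative, given positivity of the limit. -/
theorem exists_limits (hα : 0 < α) (hβ : 0 < β) (hαZ : ∀ k : ℤ, α ≠ k)
    (h0 : Tendsto (fun s : ℝ => logDet α β 0 (1 / Real.Gamma (α + 1) ^ 2 / 2 ^ (α + 1))
      (Real.log s)) (𝓝[>] 0) (𝓝 1)) :
    ∃ Δ H : ℝ → ℝ, ∀ s : ℝ, 0 < s →
      (Tendsto (fun n : ℕ => scaledRatio α β n s) atTop (𝓝 (Δ s)) ∧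
        0 < Δ s ∧
        DifferentiableAt ℝ Δ s ∧
        Tendsto (fun n : ℕ => scaledLogDeriv α β n s) atTop (𝓝 (H s)) ∧
        H s = s * deriv (fun u : ℝ => Real.log (Δ u)) s) ∧
      (H s : ℂ) = logDeriv (logDet α β 0 (1 / Real.Gamma (α + 1) ^ 2 / 2 ^ (α + 1)))
        (Real.log s) := by
  have hg := tendsto_scaleConst_div hα hβ
  set g₀ := 1 / Real.Gamma (α + 1) ^ 2 / 2 ^ (α + 1) with hg₀
  set F := logDet α β 0 g₀ with hFdef
  have hF : Differentiable ℂ F := differentiable_logDet hα hβ hαZ (Or.inl rfl) _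
  set Δ : ℝ → ℝ := fun s => (F (Real.log s)).re with hΔ
  have hlimC : ∀ s : ℝ, 0 < s →
      Tendsto (fun N : ℕ => (scaledRatio α β (N + 1) s : ℂ)) atTop (𝓝 (F (Real.log s))) := by
    intro s hs
    simp only [scaledRatio_eq_logDet hα hβ hαZ _ hs]
    exact tendsto_logDet hα hβ hαZ hg _
  have hlim' : ∀ s : ℝ, 0 < s →
      Tendsto (fun N : ℕ => scaledRatio α β (N + 1) s) atTop (𝓝 (Δ s)) := fun s hs =>
    (Complex.continuous_re.tendsto _).comp (hlimC s hs)
  have hlim : ∀ s : ℝ, 0 < s →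
      Tendsto (fun n : ℕ => scaledRatio α β n s) atTop (𝓝 (Δ s)) := fun s hs =>
    (tendsto_add_atTop_iff_nat 1).1 (hlim' s hs)
  have hΔF : ∀ s : ℝ, 0 < s → (Δ s : ℂ) = F (Real.log s) := fun s hs =>
    tendsto_nhds_unique ((Complex.continuous_ofReal.tendsto _).comp (hlim' s hs)) (hlimC s hs)
  have hsq : ∀ s : ℝ, 0 < s → Δ s ^ 2 ≤ Δ (2 * s) := fun s hs =>
    le_of_tendsto_of_tendsto' ((hlim s hs).pow 2) (hlim (2 * s) (by positivity))
      fun n => scaledRatio_sq_le hα hβ n hs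
  -- Positivity propagates from s/2^k to s by repeated doubling, and holds for large k because Δ
  -- tends to 1 at 0.
  have hpos : ∀ s : ℝ, 0 < s → 0 < Δ s := by
    intro s hs
    have hd : ∀ k : ℕ, 0 < Δ (s / 2 ^ k) → 0 < Δ s := by
      intro k
      induction k with
      | zero => simp
      | succ k ih =>
        intro h
        refine ih ?_
        have := hsq (s / 2 ^ (k + 1)) (by positivity)
        rw [show 2 * (s / 2 ^ (k + 1)) = s / 2 ^ k by rw [pow_succ]; field_simp] at this
        exact (pow_pos h 2).trans_le this
    have ht : Tendsto (fun k : ℕ => s / 2 ^ k) atTop (𝓝[>] 0) := by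
      refine tendsto_nhdsWithin_iff.2 ⟨?_, .of_forall fun k => by
        simp only [Set.mem_Ioi]; positivity⟩
      have := (tendsto_pow_atTop_nhds_zero_of_lt_one (r := (1 / 2 : ℝ)) (by norm_num)
        (by norm_num)).const_mul s
      simpa [div_eq_mul_inv] using this
    have h1 : Tendsto (fun k : ℕ => Δ (s / 2 ^ k)) atTop (𝓝 1) :=
      (Complex.continuous_re.tendsto _).comp (h0.comp ht)
    obtain ⟨k, hk⟩ := (h1.eventually (lt_mem_nhds one_pos)).exists
    exact hd k hk
  refine ⟨Δ, fun s => s * deriv (fun u : ℝ => Real.log (Δ u)) s, fun s hs => ?_⟩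
  obtain ⟨d, hd, hd'⟩ := hasDerivAt_of_eq_comp_log hF hΔF hs
  have hlog : s * deriv (fun u : ℝ => Real.log (Δ u)) s = d / Δ s := by
    rw [(hd'.log (hpos s hs).ne').deriv]
    field_simp
  refine ⟨⟨hlim s hs, hpos s hs, hd'.differentiableAt, ?_, rfl⟩, ?_⟩
  · beta_reduce
    rw [hlog, ← tendsto_add_atTop_iff_nat 1]
    choose e he he' using fun N : ℕ => hasDerivAt_of_eq_comp_log
      (differentiable_logDet hα hβ hαZ (Or.inr ⟨N, rfl⟩) _)
      (fun u hu => scaledRatio_eq_logDet hα hβ hαZ N hu) hs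
    have hl : ∀ N : ℕ, scaledLogDeriv α β (N + 1) s = e N / scaledRatio α β (N + 1) s := by
      intro N
      rw [scaledLogDeriv, ((he' N).log (scaledRatio_pos hα hβ _ hs).ne').deriv]
      field_simp
    simp only [hl]
    refine Tendsto.div ?_ (hlim' s hs) (hpos s hs).ne'
    have h1 := tendsto_deriv_logDet hα hβ hαZ hg (Real.log s : ℂ)
    simp only [← he, ← hFdef, ← hd] at h1
    exact (Complex.continuous_re.tendsto _).comp h1
  · beta_reduce
    rw [hlog, logDeriv_apply, ← hd, ← hΔF s hs]
    push_cast
    rfl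

end RealAxis

end

/-! ### The limiting determinant near σ = τ = 0. -/

section

open Finset (range)

/-- The remainder is τ² times the second divided difference at 0. On |w| = 2 the first divided
difference is at most C and f'(0) at most C/2, so the maximum principle bounds the second by C. -/
theorem norm_sub_taylor_le {f : ℂ → ℂ} (hf : Differentiable ℂ f) {C : ℝ}
    (hC : ∀ z, ‖z‖ ≤ 2 → ‖f z‖ ≤ C) {τ : ℂ} (hτ : ‖τ‖ ≤ 1) :
    ‖f τ - f 0 - τ * deriv f 0‖ ≤ C * ‖τ‖ ^ 2 := by
  have hd : ∀ g : ℂ → ℂ, Differentiable ℂ g → Differentiable ℂ (dslope g 0) := fun g hg =>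
    differentiableOn_univ.1 ((Complex.differentiableOn_dslope univ_mem).2 hg.differentiableOn)
  have h1 := hd f hf
  have h2 := hd _ h1
  have hC0 := (norm_nonneg _).trans (hC 0 (by simp))
  have hder : ‖deriv f 0‖ ≤ C / 2 :=
    Complex.norm_deriv_le_of_forall_mem_sphere_norm_le two_pos hf.diffContOnCl
      fun z hz => hC z (by simpa using (mem_sphere_zero_iff_norm.1 hz).le)
  have hbd : ‖dslope (dslope f 0) 0 τ‖ ≤ C := by
    refine Complex.norm_le_of_forall_mem_frontier_norm_le (U := Metric.ball (0 : ℂ) 2)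
      Metric.isBounded_ball h2.diffContOnCl (fun w hw => ?_)
      (subset_closure (by simpa using hτ.trans_lt one_lt_two))
    rw [frontier_ball _ two_ne_zero, mem_sphere_zero_iff_norm] at hw
    have hw0 : w ≠ 0 := by rintro rfl; simp at hw
    rw [dslope_of_ne _ hw0, slope_def_module, dslope_of_ne _ hw0, dslope_same, slope_def_module,
      sub_zero, norm_smul, norm_inv, hw]
    have e : ‖(w⁻¹ • (f w - f 0) : ℂ)‖ ≤ C := by
      rw [norm_smul, norm_inv, hw]
      have := norm_sub_le (f w) (f 0)
      have := hC w hw.le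
      have := hC 0 (by simp)
      linarith
    have := norm_sub_le (w⁻¹ • (f w - f 0)) (deriv f 0)
    linarith
  have e1 := sub_smul_dslope f 0 τ
  have e2 := sub_smul_dslope (dslope f 0) 0 τ
  rw [dslope_same, sub_zero] at e2
  rw [sub_zero] at e1
  have : f τ - f 0 - τ * deriv f 0 = τ ^ 2 * dslope (dslope f 0) 0 τ := by
    rw [← e1, smul_eq_mul, ← mul_sub, ← e2, smul_eq_mul]; ring
  rw [this, norm_mul, norm_pow, mul_comm]
  gcongr

theorem norm_tsum_mul_pow_sub_le {c b : ℕ → ℝ} (hb : Summable b) (h : ∀ m, |c m| ≤ b m) (p q : ℕ)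
    {σ : ℂ} (hσ : ‖σ‖ ≤ 1) :
    ‖(∑' m, (c m : ℂ) * σ ^ (p + m)) - ∑ m ∈ range q, (c m : ℂ) * σ ^ (p + m)‖ ≤
      (∑' m, b (m + q)) * ‖σ‖ ^ (p + q) := by
  have hs : Summable fun m => (c m : ℂ) * σ ^ (p + m) := by
    refine Summable.of_norm_bounded hb fun m => ?_
    rw [norm_mul, norm_pow, Complex.norm_real]
    calc _ ≤ |c m| * 1 := by gcongr; exacts [le_rfl, pow_le_one₀ (norm_nonneg _) hσ]
      _ ≤ _ := by simpa using h m
  rw [← hs.sum_add_tsum_nat_add q, add_sub_cancel_left]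
  refine tsum_of_norm_bounded ((((summable_nat_add_iff q).2 hb).hasSum).mul_right _) fun m => ?_
  rw [norm_mul, norm_pow, Complex.norm_real]
  exact mul_le_mul (h _) (pow_le_pow_of_le_one (norm_nonneg _) hσ (by lia)) (by positivity)
    ((abs_nonneg _).trans (h _))

/-- Column k carries r^(k+1), and the sum of k + 1 over S is at least 3 except for the three
excluded sets. -/
theorem prod_mul_pow_succ_le {v : ℕ → ℝ} (hv : ∀ k, 0 ≤ v k) {r : ℝ}
    (hr : 0 ≤ r) (hr1 : r ≤ 1) {S : Finset ℕ} (hS : S ∉ ({∅, {0}, {1}} : Finset (Finset ℕ))) :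
    ∏ k ∈ S, v k * r ^ (k + 1) ≤ (∏ k ∈ S, v k) * r ^ 3 := by
  rw [Finset.prod_mul_distrib, Finset.prod_pow_eq_pow_sum]
  refine mul_le_mul_of_nonneg_left (pow_le_pow_of_le_one hr hr1 ?_)
    (Finset.prod_nonneg fun k _ => hv k)
  simp only [Finset.mem_insert, Finset.mem_singleton, not_or] at hS
  obtain ⟨h0, h1, h2⟩ := hS
  by_contra! hlt
  have hm : ∀ k ∈ S, k < 2 := fun k hk => by
    have := Finset.single_le_sum (f := fun k => k + 1) (fun _ _ => Nat.zero_le _) hk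
    beta_reduce at this
    lia
  have hsub : S ⊆ {0, 1} := fun k hk => by
    have := hm k hk
    interval_cases k <;> simp
  have : S ∈ ({0, 1} : Finset ℕ).powerset := Finset.mem_powerset.2 hsub
  have hp : ({0, 1} : Finset ℕ).powerset = {∅, {0}, {1}, {0, 1}} := by decide
  rw [hp] at this
  simp only [Finset.mem_insert, Finset.mem_singleton, h0, h1, h2, false_or] at this
  subst this
  simp at hlt

section Limit

variable {α β : ℝ}

theorem differentiable_infDet_right (hα : 0 < α) (hβ : 0 < β) (hαZ : ∀ k : ℤ, α ≠ k) (σ : ℂ) :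
    Differentiable ℂ (infDet α β 0 σ) :=
  differentiable_infDet_comp hα hβ hαZ (Or.inl rfl) (differentiable_const σ) differentiable_id

theorem differentiable_infDet_left (hα : 0 < α) (hβ : 0 < β) (hαZ : ∀ k : ℤ, α ≠ k) (τ : ℂ) :
    Differentiable ℂ fun σ => infDet α β 0 σ τ :=
  differentiable_infDet_comp hα hβ hαZ (Or.inl rfl) differentiable_id (differentiable_const τ)

theorem exists_norm_infDet_sub_le (hα : 0 < α) (hβ : 0 < β) (hαZ : ∀ k : ℤ, α ≠ k) (ρ : ℝ) :
    ∃ C : ℝ, 0 ≤ C ∧ ∀ σ τ : ℂ, ‖σ‖ ≤ ρ → ‖τ‖ ≤ 1 →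
      ‖infDet α β 0 σ τ - infDet α β 0 σ 0 - τ * deriv (infDet α β 0 σ) 0‖ ≤ C * ‖τ‖ ^ 2 := by
  obtain ⟨C, hC0, hC⟩ := exists_norm_infDet_le hα hβ hαZ ρ 2
  exact ⟨C, hC0, fun σ τ hσ hτ => norm_sub_taylor_le (differentiable_infDet_right hα hβ hαZ σ)
    (fun z hz => hC 0 (Or.inl rfl) σ z hσ hz) hτ⟩

/-- By the uniform Taylor bound, the difference quotients at τ = 1/(N+1) converge uniformly on balls
in σ, and a locally uniform limit of holomorphic functions is holomorphic. -/
theorem differentiable_deriv_infDet (hα : 0 < α) (hβ : 0 < β) (hαZ : ∀ k : ℤ, α ≠ k) :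
    Differentiable ℂ fun σ => deriv (infDet α β 0 σ) 0 := by
  intro z
  obtain ⟨C, hC0, hC⟩ := exists_norm_infDet_sub_le hα hβ hαZ (‖z‖ + 1)
  have hlim : TendstoUniformlyOn
      (fun (N : ℕ) σ => ((N : ℂ) + 1) * (infDet α β 0 σ ((N : ℂ) + 1)⁻¹ - infDet α β 0 σ 0))
      (fun σ => deriv (infDet α β 0 σ) 0) atTop (Metric.ball 0 (‖z‖ + 1)) := by
    rw [Metric.tendstoUniformlyOn_iff]
    intro ε hε
    have h0 : Tendsto (fun N : ℕ => C * ((N : ℝ) + 1)⁻¹) atTop (𝓝 0) := by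
      have := (tendsto_one_div_add_atTop_nhds_zero_nat (𝕜 := ℝ)).const_mul C
      simpa using this
    filter_upwards [h0.eventually (gt_mem_nhds hε)] with N hN σ hσ
    refine lt_of_le_of_lt ?_ hN
    have hn : ‖(N : ℂ) + 1‖ = (N : ℝ) + 1 := by
      have : ((N : ℂ) + 1) = ((N + 1 : ℕ) : ℂ) := by push_cast; rfl
      rw [this, Complex.norm_natCast]; push_cast; rfl
    have hne : (N : ℂ) + 1 ≠ 0 := by
      rw [← norm_ne_zero_iff, hn]; positivity
    have h := hC σ ((N : ℂ) + 1)⁻¹ (by simpa using (Metric.mem_ball.1 hσ).le)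
      (by rw [norm_inv, hn]; exact inv_le_one_of_one_le₀ (by linarith [N.cast_nonneg (α := ℝ)]))
    rw [dist_comm, dist_eq_norm]
    calc _ = ‖((N : ℂ) + 1) * (infDet α β 0 σ ((N : ℂ) + 1)⁻¹ - infDet α β 0 σ 0 -
            ((N : ℂ) + 1)⁻¹ * deriv (infDet α β 0 σ) 0)‖ := by
          congr 1; field_simp
      _ ≤ ((N : ℝ) + 1) * (C * ‖((N : ℂ) + 1)⁻¹‖ ^ 2) := by
          rw [norm_mul, hn]; gcongr
      _ = _ := by rw [norm_inv, hn]; field_simp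
  have hd := hlim.tendstoLocallyUniformlyOn.differentiableOn (.of_forall fun N =>
    (((differentiable_infDet_left hα hβ hαZ _).sub
      (differentiable_infDet_left hα hβ hαZ 0)).const_mul _).differentiableOn) Metric.isOpen_ball
  exact hd.differentiableAt (Metric.isOpen_ball.mem_nhds (by simp))

theorem minor_eq_zero_of_col {M : ℕ → ℕ → ℂ} {S : Finset ℕ} {k : ℕ} (hk : k ∈ S)
    (h : ∀ i, M i k = 0) : minor M S = 0 :=
  Matrix.det_eq_zero_of_column_eq_zero (⟨k, hk⟩ : S) fun i => h i

theorem minor_empty (M : ℕ → ℕ → ℂ) : minor M ∅ = 1 := Matrix.det_isEmpty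

theorem minor_singleton (M : ℕ → ℕ → ℂ) (k : ℕ) : minor M {k} = M k k := by
  rw [minor, Matrix.det_eq_elem_of_subsingleton _ (⟨k, by simp⟩ : ({k} : Finset ℕ))]
  rfl

/-- At σ = 0 every column except the first vanishes, and there only the constant term k = m = 0 of
the singular part survives. -/
theorem infDet_zero_left (α β : ℝ) (τ : ℂ) :
    infDet α β 0 0 τ = 1 - τ * (Real.Gamma (-α) / (α + 1) ^ 2 : ℝ) := by
  have hr : ∀ i k, regEntry α β 0 i k 0 = 0 := fun i k => by simp [regEntry]
  have hs : ∀ i k, k ≠ 0 → singEntry α β 0 i k 0 = 0 := fun i k hk => by simp [singEntry, hk]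
  have hs0 : singEntry α β 0 0 0 0 = (Real.Gamma (-α) / (α + 1) ^ 2 : ℝ) := by
    rw [singEntry, tsum_eq_single 0 (fun m hm => by simp [hm])]
    simp only [singCoeff, rowFactor, singFactor]
    push_cast
    simp [sq, add_comm]
  rw [infDet, tsum_eq_sum (s := {∅, {0}})]
  · rw [Finset.sum_pair (Finset.singleton_ne_empty 0).symm, minor_empty, minor_singleton, entry,
      hr, hs0]
    ring
  · intro S hS
    simp only [Finset.mem_insert, Finset.mem_singleton, not_or] at hS
    obtain ⟨k, hk, hk0⟩ : ∃ k ∈ S, k ≠ 0 := by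
      by_contra! h
      exact (Finset.subset_singleton_iff.1 fun k hk => Finset.mem_singleton.2 (h k hk)).elim
        hS.1 hS.2
    exact minor_eq_zero_of_col hk fun i => by simp [entry, hr, hs i k hk0]

theorem deriv_infDet_zero_zero (α β : ℝ) :
    deriv (infDet α β 0 0) 0 = -(Real.Gamma (-α) / (α + 1) ^ 2 : ℝ) := by
  have : infDet α β 0 0 = fun τ : ℂ => 1 - τ * (Real.Gamma (-α) / (α + 1) ^ 2 : ℝ) :=
    funext (infDet_zero_left α β)
  rw [this, deriv_const_sub, deriv_mul_const differentiableAt_id]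
  simp

theorem isBigO_regEntry_sub (hα : 0 < α) (hβ : 0 < β) (hαZ : ∀ k : ℤ, α ≠ k) (i k q : ℕ) :
    (fun σ => regEntry α β 0 i k σ -
      ∑ m ∈ range q, (regCoeff α β 0 i k m : ℂ) * σ ^ (k + 1 + m)) =O[𝓝 0]
      fun σ => σ ^ (k + 1 + q) := by
  obtain ⟨c, B, -, -, hb, -⟩ := exists_entry_bound hα hβ hαZ 1
  obtain ⟨b, hbs, hb⟩ := hb i k
  refine IsBigO.of_bound (∑' m, b (m + q)) ?_
  filter_upwards [Metric.closedBall_mem_nhds (0 : ℂ) one_pos] with σ hσ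
  have h := norm_tsum_mul_pow_sub_le (c := regCoeff α β 0 i k) hbs
    (fun m => by simpa using (hb 0 (Or.inl rfl) 1 (by simp) m).1) (k + 1) q
    (mem_closedBall_zero_iff.1 hσ)
  rw [norm_pow]
  refine le_trans (le_of_eq ?_) h
  congr 2
  exact tsum_congr fun m => by rw [add_right_comm]

/-- The regular part of the determinant, to second order. -/
theorem isBigO_infDet_zero_right (hα : 0 < α) (hβ : 0 < β) (hαZ : ∀ k : ℤ, α ≠ k) :
    (fun σ : ℂ => infDet α β 0 σ 0 - (1 - σ / α + σ ^ 2 / (2 * ((α : ℂ) ^ 2 - 1)))) =O[𝓝 0]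
      fun σ => σ ^ 3 := by
  have hmain : (fun σ : ℂ => infDet α β 0 σ 0 -
      (1 - regEntry α β 0 0 0 σ - regEntry α β 0 1 1 σ)) =O[𝓝 0] fun σ => σ ^ 3 := by
    obtain ⟨c, B, hc, hB, -, h⟩ := exists_entry_bound hα hβ hαZ 1
    have hu : Summable fun i : ℕ => B * (c ^ i / i.factorial) :=
      (Real.summable_pow_div_factorial c).mul_left B
    set U := ∑' i : ℕ, B * (c ^ i / i.factorial) with hU
    have hU0 : 0 ≤ U := tsum_nonneg fun _ => by positivity
    have hv : Summable fun k : ℕ => U * (1 / (k.factorial : ℝ)) := by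
      have := (Real.summable_pow_div_factorial 1).mul_left U
      simpa using this
    have hP := summable_finsetProd_of_summable_nonneg
      (fun k : ℕ => (by positivity : 0 ≤ U * (1 / (k.factorial : ℝ)))) hv
    obtain ⟨b', hb', hbd⟩ := exists_minor_bound hα hβ hαZ 1 1
    refine IsBigO.of_bound (∑' S : Finset ℕ, ∏ k ∈ S, U * (1 / (k.factorial : ℝ))) ?_
    filter_upwards [Metric.closedBall_mem_nhds (0 : ℂ) one_pos] with σ hσ
    have hσ1 : ‖σ‖ ≤ 1 := mem_closedBall_zero_iff.1 hσ
    have hs : Summable fun S => minor (entry α β 0 σ 0) S :=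
      Summable.of_norm_bounded hb' fun S => hbd 0 (Or.inl rfl) σ 0 hσ1 (by simp) S
    have hT : ∑ S ∈ ({∅, {0}, {1}} : Finset (Finset ℕ)), minor (entry α β 0 σ 0) S =
        1 - regEntry α β 0 0 0 σ - regEntry α β 0 1 1 σ := by
      rw [Finset.sum_insert (by decide), Finset.sum_pair (by decide), minor_empty,
        minor_singleton, minor_singleton, entry, entry]
      ring
    rw [← hT, infDet]
    set T : Finset (Finset ℕ) := {∅, {0}, {1}} with hTdef
    have hsum := hs.hasSum.sub (hasSum_sum_of_ne_finset_zero
      (f := fun S => if S ∈ T then minor (entry α β 0 σ 0) S else 0) (s := T)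
      fun S hS => if_neg hS)
    rw [Finset.sum_congr rfl fun S hS => if_pos hS] at hsum
    rw [← hsum.tsum_eq, norm_pow]
    refine tsum_of_norm_bounded (hP.hasSum.mul_right (‖σ‖ ^ 3)) fun S => ?_
    split_ifs with hS
    · simp only [sub_self, norm_zero]
      exact mul_nonneg (Finset.prod_nonneg fun _ _ => by positivity) (by positivity)
    · rw [sub_zero]
      refine le_trans ?_ (prod_mul_pow_succ_le (fun k => by positivity) (norm_nonneg σ) hσ1 hS)
      refine (norm_minor_le (u := fun i => B * (c ^ i / i.factorial))
        (v := fun k => ‖σ‖ ^ (k + 1) / k.factorial) (fun i => by positivity)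
        (fun k => by positivity) hu (fun i k => ?_) S).trans (le_of_eq ?_)
      · rw [entry, zero_mul, add_zero, norm_neg]
        exact (h 0 (Or.inl rfl) σ hσ1 i k).1
      · exact Finset.prod_congr rfl fun k _ => by rw [← hU]; ring
  -- Modulo σ³, entry (0, 0) contributes two terms and entry (1, 1), which starts at σ², one.
  have h0 := isBigO_regEntry_sub hα hβ hαZ 0 0 2
  have h1 := isBigO_regEntry_sub hα hβ hαZ 1 1 1
  have hα1 : (α : ℂ) - 1 ≠ 0 := fun h => hαZ 1 (by
    have := sub_eq_zero.1 h
    rw [Int.cast_one]; exact_mod_cast this)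
  have hα2 : (α : ℂ) + 1 ≠ 0 := by
    have : (α + 1 : ℝ) ≠ 0 := by positivity
    exact_mod_cast this
  have hα0 : (α : ℂ) ≠ 0 := by exact_mod_cast hα.ne'
  have hα3 : (α : ℂ) ^ 2 - 1 ≠ 0 := by
    rw [show (α : ℂ) ^ 2 - 1 = (α - 1) * (α + 1) by ring]
    exact mul_ne_zero hα1 hα2
  refine ((hmain.sub h0).sub h1).congr_left fun σ => ?_
  simp only [Finset.sum_range_succ, Finset.sum_range_zero, regCoeff, rowFactor, regFactor,
    Finset.prod_range_succ, Finset.prod_range_zero]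
  push_cast
  simp only [Nat.factorial]
  push_cast
  simp only [zero_add]
  field_simp
  ring

end Limit

end

/-! ### Asymptotics of logarithmic derivatives. -/

theorem isBigO_deriv_of_isBigO_exp {f : ℂ → ℂ} (hf : Differentiable ℂ f) {b : ℝ} (hb : 0 ≤ b)
    (h : f =O[comap Complex.re atBot] fun ζ => Real.exp (b * ζ.re)) :
    deriv f =O[comap Complex.re atBot] fun ζ => Real.exp (b * ζ.re) := by
  obtain ⟨C, hC0, hC⟩ := h.exists_nonneg
  obtain ⟨M, -, hM⟩ := (atBot_basis.comap Complex.re).eventually_iff.1 hC.bound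
  refine IsBigO.of_bound (C * Real.exp b)
    ((atBot_basis.comap Complex.re).eventually_iff.2 ⟨M - 1, trivial, fun ζ hζ => ?_⟩)
  have hζ' : ζ.re ≤ M - 1 := hζ
  -- Cauchy's estimate on the unit circle; moving the real part by at most 1 costs the factor e^b.
  have := Complex.norm_deriv_le_of_forall_mem_sphere_norm_le (c := ζ) one_pos hf.diffContOnCl
    (C := C * Real.exp b * Real.exp (b * ζ.re)) fun w hw => by
      have h1 : w.re - ζ.re ≤ 1 := by
        rw [← Complex.sub_re]
        exact (Complex.re_le_norm _).trans (mem_sphere_iff_norm.1 hw).le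
      refine (hM (show w.re ≤ M by linarith)).trans ?_
      rw [Real.norm_eq_abs, Real.abs_exp, mul_assoc, ← Real.exp_add]
      gcongr
      nlinarith
  rwa [div_one, ← Real.abs_exp (b * ζ.re), ← Real.norm_eq_abs] at this

/-- Cauchy's estimate on the circle of radius |z| about z, where |w| ≤ 2|z|. -/
theorem isBigO_mul_deriv_of_isBigO_pow {f : ℂ → ℂ} (hf : Differentiable ℂ f) {n : ℕ}
    (h : f =O[𝓝 0] fun z => z ^ n) : (fun z => z * deriv f z) =O[𝓝 0] fun z => z ^ n := by
  obtain ⟨C, hC0, hC⟩ := h.exists_nonneg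
  obtain ⟨ε, hε, hM⟩ := Metric.eventually_nhds_iff_ball.1 hC.bound
  refine IsBigO.of_bound (C * 2 ^ n) ?_
  filter_upwards [Metric.ball_mem_nhds (0 : ℂ) (half_pos hε)] with z hz
  rw [mem_ball_zero_iff] at hz
  rcases eq_or_ne z 0 with rfl | hz0
  · rw [zero_mul, norm_zero]; positivity
  have hz1 := norm_pos_iff.2 hz0
  have := Complex.norm_deriv_le_of_forall_mem_sphere_norm_le (c := z) hz1 hf.diffContOnCl
    (C := C * (2 * ‖z‖) ^ n) fun w hw => by
      have h1 : ‖w‖ ≤ 2 * ‖z‖ := by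
        have := norm_le_norm_add_norm_sub' w z
        have := mem_sphere_iff_norm.1 hw
        linarith
      refine (hM w (by rw [mem_ball_zero_iff]; linarith)).trans ?_
      rw [norm_pow]
      gcongr
  rw [le_div_iff₀ hz1] at this
  rw [norm_mul, norm_pow, mul_comm, mul_assoc, ← mul_pow]
  exact this

/-- The second order expansion of `z f'(z) / f(z)`. -/
theorem isBigO_mul_logDeriv_sub {f : ℂ → ℂ} (hf : Differentiable ℂ f) {a b : ℂ}
    (h : (fun z => f z - (1 - a * z + b * z ^ 2)) =O[𝓝 0] fun z => z ^ 3) (h0 : f 0 = 1) :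
    (fun z => z * deriv f z / f z - (-(a * z) + (2 * b - a ^ 2) * z ^ 2)) =O[𝓝 0]
      fun z => z ^ 3 := by
  have hc : Tendsto f (𝓝 0) (𝓝 1) := h0 ▸ hf.continuous.tendsto 0
  have hinv : (fun z => (f z)⁻¹) =O[𝓝 0] fun _ => (1 : ℂ) :=
    (hc.inv₀ one_ne_zero).isBigO_one ℂ
  have hd := isBigO_mul_deriv_of_isBigO_pow (f := fun z => f z - (1 - a * z + b * z ^ 2))
    (by fun_prop) h
  have hder : ∀ z, deriv (fun z => f z - (1 - a * z + b * z ^ 2)) z =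
      deriv f z - (-a + 2 * b * z) := by
    intro z
    have h1 : HasDerivAt (fun z : ℂ => 1 - a * z + b * z ^ 2) (-a + 2 * b * z) z := by
      have := (((hasDerivAt_id z).const_mul a).const_sub 1).add ((hasDerivAt_pow 2 z).const_mul b)
      convert! this using 1
      simp; ring
    exact ((hf z).hasDerivAt.sub h1).deriv
  have hp1 : (fun z : ℂ => -(a * z) + (2 * b - a ^ 2) * z ^ 2) =O[𝓝 0] fun _ => (1 : ℂ) :=
    (show ContinuousAt (fun z : ℂ => -(a * z) + (2 * b - a ^ 2) * z ^ 2) 0 by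
      fun_prop).tendsto.isBigO_one ℂ
  have hp2 : (fun z : ℂ => a * b + a * (2 * b - a ^ 2) - b * (2 * b - a ^ 2) * z) =O[𝓝 0]
      fun _ => (1 : ℂ) :=
    (show ContinuousAt (fun z : ℂ => a * b + a * (2 * b - a ^ 2) - b * (2 * b - a ^ 2) * z) 0 by
      fun_prop).tendsto.isBigO_one ℂ
  -- With q the quadratic approximating f and p the claimed expansion, zf' - pf = z(f-q)' - p(f-q) +
  -- (zq' - pq), and zq' - pq is z³ times the polynomial in `hp2`.
  have h2 := hp1.mul h
  have h3 := hp2.mul (isBigO_refl (fun z : ℂ => z ^ 3) (𝓝 0))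
  have h4 := hinv.mul (((hd.sub (h2.trans (by simp [isBigO_refl]))).add
    (h3.trans (by simp [isBigO_refl]))))
  simp only [one_mul] at h4
  refine h4.congr' ?_ .rfl
  filter_upwards [hc.eventually_ne one_ne_zero] with z hz
  rw [hder]
  field_simp
  ring

/-- The filter describes s → 0 in ζ = log s with no restriction on the imaginary part. With z = e^ζ,
τ = ce^(aζ) and F = P + τQ + R, the logarithmic derivative is expanded to first order in τ; R and R'
are both O(τ²) in scale. -/
theorem isBigO_logDeriv_sub {F P Q : ℂ → ℂ} {c : ℂ} {a : ℝ} (ha : 0 < a)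
    (hF : Differentiable ℂ F) (hP : Differentiable ℂ P) (hQ : Differentiable ℂ Q) (hP0 : P 0 = 1)
    (hR : (fun ζ => F ζ - P (Complex.exp ζ) - c * Complex.exp (a * ζ) * Q (Complex.exp ζ))
      =O[comap Complex.re atBot] fun ζ => Real.exp (2 * a * ζ.re)) :
    Tendsto F (comap Complex.re atBot) (𝓝 1) ∧
    (fun ζ => logDeriv F ζ - Complex.exp ζ * deriv P (Complex.exp ζ) / P (Complex.exp ζ) -
      c * Complex.exp (a * ζ) *
        (((a * Q (Complex.exp ζ) + Complex.exp ζ * deriv Q (Complex.exp ζ)) * P (Complex.exp ζ) -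
          Complex.exp ζ * deriv P (Complex.exp ζ) * Q (Complex.exp ζ)) / P (Complex.exp ζ) ^ 2))
      =O[comap Complex.re atBot] fun ζ => Real.exp (2 * a * ζ.re) := by
  set l := comap Complex.re atBot with hl
  have hexp : Tendsto Complex.exp l (𝓝 0) := by
    rw [hl, ← Complex.comap_exp_nhds_zero]; exact tendsto_comap
  have hE : Tendsto (fun ζ : ℂ => Real.exp (a * ζ.re)) l (𝓝 0) :=
    Real.tendsto_exp_atBot.comp (tendsto_comap.const_mul_atBot ha)
  have hE2 : ∀ ζ : ℂ, Real.exp (2 * a * ζ.re) = Real.exp (a * ζ.re) * Real.exp (a * ζ.re) :=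
    fun ζ => by rw [← Real.exp_add]; ring_nf
  have hE2' : Tendsto (fun ζ : ℂ => Real.exp (2 * a * ζ.re)) l (𝓝 0) := by
    simp only [hE2]; simpa using hE.mul hE
  have hT : (fun ζ : ℂ => c * Complex.exp (a * ζ)) =O[l] fun ζ => Real.exp (a * ζ.re) := by
    refine IsBigO.of_bound ‖c‖ (.of_forall fun ζ => ?_)
    rw [norm_mul, Complex.norm_exp, Real.norm_eq_abs, Real.abs_exp, Complex.re_ofReal_mul]
  have hT0 : Tendsto (fun ζ : ℂ => c * Complex.exp (a * ζ)) l (𝓝 0) := hT.trans_tendsto hE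
  have hcd : ∀ f : ℂ → ℂ, Differentiable ℂ f → Continuous (deriv f) := fun f hf =>
    (hf.contDiff (n := 1)).continuous_deriv le_rfl
  have hbd : ∀ f : ℂ → ℂ, Continuous f → (fun ζ => f (Complex.exp ζ)) =O[l] fun _ => (1 : ℝ) :=
    fun f hf => ((hf.tendsto 0).comp hexp).isBigO_one ℝ
  have hPl : Tendsto (fun ζ => P (Complex.exp ζ)) l (𝓝 1) :=
    hP0 ▸ (hP.continuous.tendsto 0).comp hexp
  have hQl : Tendsto (fun ζ => Q (Complex.exp ζ)) l (𝓝 (Q 0)) :=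
    (hQ.continuous.tendsto 0).comp hexp
  have hRd : Differentiable ℂ fun ζ =>
      F ζ - P (Complex.exp ζ) - c * Complex.exp (a * ζ) * Q (Complex.exp ζ) := by
    have h1 := hP.comp Complex.differentiable_exp
    have h2 := hQ.comp Complex.differentiable_exp
    exact (hF.sub h1).sub (Differentiable.mul (by fun_prop) h2)
  have hFl : Tendsto F l (𝓝 1) := by
    have h1 := ((hR.trans_tendsto hE2').add hPl).add (hT0.mul hQl)
    rw [zero_add, zero_mul, add_zero] at h1
    exact h1.congr fun ζ => by ring
  refine ⟨hFl, ?_⟩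
  have hder : ∀ ζ, deriv (fun ζ =>
      F ζ - P (Complex.exp ζ) - c * Complex.exp (a * ζ) * Q (Complex.exp ζ)) ζ =
      deriv F ζ - Complex.exp ζ * deriv P (Complex.exp ζ) - c * Complex.exp (a * ζ) *
        (a * Q (Complex.exp ζ) + Complex.exp ζ * deriv Q (Complex.exp ζ)) := by
    intro ζ
    have h1 := (hP (Complex.exp ζ)).hasDerivAt.comp ζ (Complex.hasDerivAt_exp ζ)
    have h2 := (hQ (Complex.exp ζ)).hasDerivAt.comp ζ (Complex.hasDerivAt_exp ζ)
    have h3 : HasDerivAt (fun ζ : ℂ => c * Complex.exp (a * ζ))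
        (c * (Complex.exp (a * ζ) * a)) ζ :=
      ((((hasDerivAt_id ζ).const_mul (a : ℂ)).cexp).const_mul c).congr_deriv (by simp)
    refine ((((hF ζ).hasDerivAt.sub h1).sub (h3.mul h2)).congr_deriv ?_).deriv
    simp only [Function.comp_apply]
    ring
  have hR' := (isBigO_deriv_of_isBigO_exp hRd (by positivity) hR).congr_left hder
  have hN0 := hbd (fun z => z * deriv P z) (continuous_id.mul (hcd P hP))
  have hN : (fun ζ => (fun z => (a * Q z + z * deriv Q z) * P z - z * deriv P z * Q z)
      (Complex.exp ζ)) =O[l] fun _ => (1 : ℝ) := by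
    have h1 := hcd P hP
    have h2 := hcd Q hQ
    have h3 := hP.continuous
    have h4 := hQ.continuous
    exact hbd (fun z => (a * Q z + z * deriv Q z) * P z - z * deriv P z * Q z) (by fun_prop)
  have hPb := hbd P hP.continuous
  have hQb := hbd Q hQ.continuous
  have hinv : (fun ζ => (F ζ * P (Complex.exp ζ) ^ 2)⁻¹) =O[l] fun _ => (1 : ℝ) :=
    ((hFl.mul (hPl.pow 2)).inv₀ (by simp)).isBigO_one ℝ
  have hT1 : (fun ζ : ℂ => c * Complex.exp (a * ζ)) =O[l] fun _ => (1 : ℝ) := hT0.isBigO_one ℝ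
  have hTT := hT.mul hT
  simp only [← hE2] at hTT
  -- With N = (aQ + zQ')P - zP'Q, the difference to be bounded, times FP², equals P²R' - zP'PR -
  -- τ²NQ - τNR.
  have t1 := (hPb.mul hPb).mul hR'
  have t2 := (hN0.mul hPb).mul hR
  have t3 := (hN.mul hQb).mul hTT
  have t4 := (hT1.mul hN).mul hR
  simp only [one_mul] at t1 t2 t3 t4
  have t := hinv.mul (((t1.sub t2).sub t3).sub t4)
  simp only [one_mul] at t
  refine t.congr' ?_ .rfl
  filter_upwards [hFl.eventually_ne one_ne_zero, hPl.eventually_ne one_ne_zero] with ζ h1 h2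
  rw [logDeriv_apply]
  field_simp
  ring

/-! ### The coefficient of s^(α+1) and the final expansion. -/

theorem specialCoeff_eq {α : ℝ} (hα : 0 < α) :
    specialCoeff α = 1 / Real.Gamma (α + 1) ^ 2 / 2 ^ (α + 1) *
      ((α + 1) * -(Real.Gamma (-α) / (α + 1) ^ 2)) := by
  -- The reflection formula gives Γ(-α)Γ(α+1) = -π/sin(πα), hence the third power of Γ(α+1) and the
  -- sign.
  have h := Real.Gamma_mul_Gamma_one_sub (-α)
  rw [show 1 - -α = α + 1 by ring, show Real.pi * -α = -(α * Real.pi) by ring, Real.sin_neg] at h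
  have hG : Real.Gamma (α + 1) ≠ 0 := (Real.Gamma_pos_of_pos (by linarith)).ne'
  have hp : (2 : ℝ) ^ (α + 1) ≠ 0 := by positivity
  have ha : α + 1 ≠ 0 := by positivity
  rw [← eq_div_iff hG] at h
  rw [h, specialCoeff, div_neg]
  rcases eq_or_ne (Real.sin (α * Real.pi)) 0 with hs | hs
  · simp [hs]
  · field_simp

theorem specialCoeff_ne_zero {α : ℝ} (hα : 0 < α) (hαZ : ∀ k : ℤ, α ≠ k) :
    specialCoeff α ≠ 0 := by
  have hG := (Real.Gamma_pos_of_pos (show 0 < α + 1 by linarith)).ne'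
  have hs : Real.sin (α * Real.pi) ≠ 0 := fun h => by
    obtain ⟨k, hk⟩ := Real.sin_eq_zero_iff.1 h
    exact hαZ k (mul_right_cancel₀ Real.pi_ne_zero hk).symm
  have := Real.pi_ne_zero
  unfold specialCoeff
  positivity

/-- Re log s = log |s| whatever the argument; this is the source of the uniformity in |arg s| < π.
-/
theorem tendsto_log_slitPlane :
    Tendsto Complex.log (𝓝[Complex.slitPlane] 0) (comap Complex.re atBot) := by
  rw [tendsto_comap_iff]
  have h : Tendsto (fun s : ℂ => ‖s‖) (𝓝[Complex.slitPlane] 0) (𝓝[>] 0) := by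
    refine tendsto_nhdsWithin_iff.2 ⟨?_, ?_⟩
    · simpa using (continuous_norm.tendsto (0 : ℂ)).mono_left nhdsWithin_le_nhds
    · filter_upwards [self_mem_nhdsWithin] with s hs
      exact norm_pos_iff.2 (Complex.slitPlane_ne_zero hs)
  refine (Real.tendsto_log_nhdsGT_zero.comp h).congr fun s => ?_
  simp [Complex.log_re]

theorem tendsto_ofReal_log :
    Tendsto (fun s : ℝ => (Real.log s : ℂ)) (𝓝[>] 0) (comap Complex.re atBot) := by
  rw [tendsto_comap_iff]
  exact Real.tendsto_log_nhdsGT_zero.congr fun s => by simp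

theorem corollary3 (α β : ℝ) (hα : 0 < α) (hβ : 0 < β) (hαZ : ∀ k : ℤ, α ≠ (k : ℝ)) :
    (∀ (n : ℕ) (t : ℝ), 0 ≤ t → 0 < hankelDet n t α β) ∧
    (∀ (n : ℕ) (s : ℝ), 0 < s →
      DifferentiableAt ℝ (fun u : ℝ => Real.log (scaledRatio α β n u)) s) ∧
    ∃ Δ H : ℝ → ℝ,
      (∀ s : ℝ, 0 < s →
        Tendsto (fun n : ℕ => scaledRatio α β n s) atTop (𝓝 (Δ s)) ∧
        0 < Δ s ∧
        DifferentiableAt ℝ Δ s ∧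
        Tendsto (fun n : ℕ => scaledLogDeriv α β n s) atTop (𝓝 (H s)) ∧
        H s = s * deriv (fun u : ℝ => Real.log (Δ u)) s) ∧
      -- `Hc` is the analytic continuation of `H` to `|arg s| < π`, `|s| < ρ`
      ∃ ρ : ℝ, 0 < ρ ∧ ∃ Hc R₁ R₂ R₃ : ℂ → ℂ,
        DifferentiableOn ℂ Hc (Complex.slitPlane ∩ Metric.ball 0 ρ) ∧
        (∀ s : ℝ, 0 < s → s < ρ → Hc (s : ℂ) = (H s : ℂ)) ∧
        AnalyticAt ℂ R₁ 0 ∧ (R₁ =O[𝓝 0] fun s : ℂ => s ^ 3) ∧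
        AnalyticAt ℂ R₂ 0 ∧ (R₂ =O[𝓝 0] fun s : ℂ => s) ∧
        (R₃ =O[𝓝[Complex.slitPlane] 0] fun s : ℂ => ‖s‖ ^ (2 * (α + 1))) ∧
        ∀ s ∈ Complex.slitPlane ∩ Metric.ball 0 ρ,
          Hc s = -s / (2 * (α : ℂ)) + s ^ 2 / (4 * (α : ℂ) ^ 2 * ((α : ℂ) ^ 2 - 1)) + R₁ s
            + (specialCoeff α : ℂ) * s ^ ((α : ℂ) + 1) * (1 + R₂ s) + R₃ s := by
  set g : ℝ := 1 / Real.Gamma (α + 1) ^ 2 / 2 ^ (α + 1) with hg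
  set F : ℂ → ℂ := logDet α β 0 g with hFdef
  -- P and Q are the Taylor coefficients of order 0 and 1 in τ, at σ = z/2.
  set P : ℂ → ℂ := fun z => infDet α β 0 (z / 2) 0 with hPdef
  set Q : ℂ → ℂ := fun z => deriv (infDet α β 0 (z / 2)) 0 with hQdef
  have hF : Differentiable ℂ F := differentiable_logDet hα hβ hαZ (Or.inl rfl) g
  have hP : Differentiable ℂ P :=
    (differentiable_infDet_left hα hβ hαZ 0).comp (differentiable_id.div_const 2)
  have hQ : Differentiable ℂ Q :=
    (differentiable_deriv_infDet hα hβ hαZ).comp (differentiable_id.div_const 2)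
  have hP0 : P 0 = 1 := by simp [hPdef, infDet_zero_left]
  have hQ0 : Q 0 = -(Real.Gamma (-α) / (α + 1) ^ 2 : ℝ) := by
    simp only [hQdef, zero_div]; exact deriv_infDet_zero_zero α β
  have ha : 0 < α + 1 := by linarith
  have hR : (fun ζ => F ζ - P (Complex.exp ζ) -
      (g : ℂ) * Complex.exp (((α + 1 : ℝ) : ℂ) * ζ) * Q (Complex.exp ζ))
      =O[comap Complex.re atBot] fun ζ => Real.exp (2 * (α + 1) * ζ.re) := by
    obtain ⟨C, hC0, hC⟩ := exists_norm_infDet_sub_le hα hβ hαZ 1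
    have hexp : Tendsto Complex.exp (comap Complex.re atBot) (𝓝 0) := by
      rw [← Complex.comap_exp_nhds_zero]; exact tendsto_comap
    have hE : Tendsto (fun ζ : ℂ => ‖(g : ℂ)‖ * Real.exp ((α + 1) * ζ.re))
        (comap Complex.re atBot) (𝓝 (‖(g : ℂ)‖ * 0)) :=
      (Real.tendsto_exp_atBot.comp (tendsto_comap.const_mul_atBot ha)).const_mul _
    rw [mul_zero] at hE
    refine IsBigO.of_bound (C * ‖(g : ℂ)‖ ^ 2) ?_
    filter_upwards [hexp.eventually (Metric.closedBall_mem_nhds 0 two_pos),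
      hE.eventually (Iic_mem_nhds one_pos)] with ζ h1 h2
    have hn : ‖(g : ℂ) * Complex.exp (((α + 1 : ℝ) : ℂ) * ζ)‖ =
        ‖(g : ℂ)‖ * Real.exp ((α + 1) * ζ.re) := by
      rw [norm_mul, Complex.norm_exp, Complex.re_ofReal_mul]
    have h := hC (Complex.exp ζ / 2) (g * Complex.exp (((α + 1 : ℝ) : ℂ) * ζ))
      (by
        rw [norm_div, Complex.norm_ofNat]
        have := mem_closedBall_zero_iff.1 h1
        linarith) (hn ▸ h2)
    rw [hn, mul_pow, ← mul_assoc, ← Real.exp_nat_mul,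
      show ((2 : ℕ) : ℝ) * ((α + 1) * ζ.re) = 2 * (α + 1) * ζ.re by push_cast; ring] at h
    rw [Real.norm_eq_abs, Real.abs_exp]
    simpa only [hFdef, logDet, Complex.ofReal_add, Complex.ofReal_one] using h
  obtain ⟨hF1, hmain⟩ := isBigO_logDeriv_sub ha hF hP hQ hP0 hR
  obtain ⟨Δ, H, hΔH⟩ := exists_limits hα hβ hαZ (hF1.comp tendsto_ofReal_log)
  refine ⟨fun n t ht => hankelDet_pos ht hα hβ n,
    fun n s hs => differentiableAt_log_scaledRatio hα hβ hαZ n hs, Δ, H,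
    fun s hs => (hΔH s hs).1, ?_⟩
  -- F tends to 1, so it has no zeros on some half-plane Re ζ ≤ M; in the variable s this gives ρ =
  -- e^M.
  obtain ⟨M, -, hM⟩ := (atBot_basis.comap Complex.re).eventually_iff.1
    (hF1.eventually_ne one_ne_zero)
  set K : ℂ → ℂ := fun z => (((α + 1 : ℝ) * Q z + z * deriv Q z) * P z - z * deriv P z * Q z) /
    P z ^ 2 with hK
  have hdP : Differentiable ℂ (deriv P) := hP.deriv
  have hdQ : Differentiable ℂ (deriv Q) := hQ.deriv
  have hanal : ∀ f : ℂ → ℂ, Differentiable ℂ f → AnalyticAt ℂ f 0 := fun f hf => hf.analyticAt 0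
  have hKan : AnalyticAt ℂ K 0 :=
    (hanal (fun z => ((α + 1 : ℝ) * Q z + z * deriv Q z) * P z - z * deriv P z * Q z)
      (by fun_prop)).div (hanal (fun z => P z ^ 2) (by fun_prop)) (by simp [hP0])
  -- Since P(0) = 1, K(0) = (α+1)Q(0).
  have hsc : (specialCoeff α : ℂ) = g * K 0 := by
    rw [specialCoeff_eq hα, hK]
    simp only [hP0, hQ0, ← hg]
    push_cast
    ring
  have hK0 : K 0 ≠ 0 := fun h => specialCoeff_ne_zero hα hαZ (by
    rw [h, mul_zero] at hsc; exact_mod_cast hsc)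
  -- R₁ is zP'/P minus its quadratic part, R₂ normalizes K by K(0), and R₃ is defined as what
  -- remains, so that the identity is algebra and the content lies in the bounds.
  refine ⟨Real.exp M, Real.exp_pos M, fun s => logDeriv F (Complex.log s),
    fun z => z * deriv P z / P z - (-((1 / (2 * α)) * z) +
      (2 * (1 / (8 * ((α : ℂ) ^ 2 - 1))) - (1 / (2 * α)) ^ 2) * z ^ 2),
    fun z => K z / K 0 - 1,
    fun s => logDeriv F (Complex.log s) - s * deriv P s / P s -
      g * Complex.exp ((α + 1 : ℝ) * Complex.log s) * K s, ?_, ?_, ?_, ?_, ?_, ?_, ?_, ?_⟩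
  · intro s hs
    have hre : (Complex.log s).re ≤ M := by
      rw [Complex.log_re, ← Real.log_exp M]
      exact Real.log_le_log (norm_pos_iff.2 (Complex.slitPlane_ne_zero hs.1))
        (mem_ball_zero_iff.1 hs.2).le
    have hlog : DifferentiableAt ℂ Complex.log s := Complex.differentiableAt_log hs.1
    have h1 : DifferentiableAt ℂ (logDeriv F) (Complex.log s) :=
      (hF.deriv _).div (hF _) (hM hre)
    exact (h1.comp s hlog).differentiableWithinAt
  · intro s hs _
    beta_reduce
    rw [(hΔH s hs).2, Complex.ofReal_log hs.le]
  · exact ((hanal (fun z => z * deriv P z) (by fun_prop)).div (hanal P hP) (by simp [hP0])).sub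
      (hanal _ (by fun_prop))
  · refine isBigO_mul_logDeriv_sub hP ?_ hP0
    have h1 : Tendsto (fun z : ℂ => z / 2) (𝓝 0) (𝓝 0) := by
      have := (continuous_id.div_const (2 : ℂ)).tendsto 0
      simpa using this
    have h2 := (isBigO_infDet_zero_right hα hβ hαZ).comp_tendsto h1
    refine (h2.congr_left fun z => ?_).trans
      (IsBigO.of_bound (1 / 8) (.of_forall fun z => le_of_eq ?_))
    · simp only [Function.comp_apply, hPdef]
      congr 1
      generalize (α : ℂ) ^ 2 - 1 = w
      ring
    · simp only [Function.comp_apply]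
      rw [div_pow, norm_div]
      norm_num
      ring
  · exact (hKan.div analyticAt_const hK0).sub analyticAt_const
  · have h1 := (hKan.differentiableAt.div_const (K 0)).sub_const 1 |>.isBigO_sub
    simpa [div_self hK0] using h1
  · refine ((hmain.comp_tendsto tendsto_log_slitPlane).congr' ?_ ?_)
    · filter_upwards [self_mem_nhdsWithin] with s hs
      simp only [Function.comp_apply, Complex.exp_log (Complex.slitPlane_ne_zero hs), hK]
    · filter_upwards [self_mem_nhdsWithin] with s hs
      simp only [Function.comp_apply, Complex.log_re]
      rw [Real.rpow_def_of_pos (norm_pos_iff.2 (Complex.slitPlane_ne_zero hs)), mul_comm]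
  · intro s hs
    have hs0 := Complex.slitPlane_ne_zero hs.1
    beta_reduce
    rw [hsc, Complex.cpow_def_of_ne_zero hs0, mul_comm (Complex.log s), add_sub_cancel]
    have hα0 : (α : ℂ) ≠ 0 := by exact_mod_cast hα.ne'
    have hα3 : (α : ℂ) ^ 2 - 1 ≠ 0 := by
      rw [show (α : ℂ) ^ 2 - 1 = (α - 1) * (α + 1) by ring]
      refine mul_ne_zero (fun h => hαZ 1 ?_) (by exact_mod_cast ha.ne')
      have := sub_eq_zero.1 h
      rw [Int.cast_one]; exact_mod_cast this
    have e : -s / (2 * (α : ℂ)) + s ^ 2 / (4 * (α : ℂ) ^ 2 * ((α : ℂ) ^ 2 - 1)) =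
        -((1 / (2 * α)) * s) +
      (2 * (1 / (8 * ((α : ℂ) ^ 2 - 1))) - (1 / (2 * α)) ^ 2) * s ^ 2 := by
      field_simp
      ring
    rw [e]
    push_cast
    field_simp
    ring
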